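/- A partially oriented graph $P=(V,E\cup A)$ is the edge-disjoint union of a finite simple graph $(V,E)$ and an oriented graph $(V,A)$ (no loops, at most one arc between two vertices; no two vertices are joined by both an edge and an arc). Its underlying graph $UG(P)$ is obtained by forgetting the directions of the arcs. To complete $P$ means to replace every edge in $E$ by one of its two possible arcs, keeping all arcs in $A$. An oriented graph $D$ is a local tournament if for every vertex $v$ each of $N^+(v)$, $N^-(v)$ induces a tournament in $D$, and it is locally transitive if for every $v$ each of $N^+(v)$, $N^-(v)$ induces a transitive tournament. For a graph $G$, the auxiliary graph $G^+$ has as vertices the ordered pairs $(u,v)$ with $uv$ an edge of $G$ (two for each edge). Two distinct vertices $(u,v)$, $(u',v')$ of $G^+$ are adjacent if and only if $u=u'$ and $vv'$ is not an edge of $G$, or $v=v'$ and $uu'$ is not an edge of $G$, or $u=v'$ and $v=u'$. Let $P$ be a partially oriented graph and $G=UG(P)$. $P$ is consentaneous if it contains no two arcs at odd distance in $G^+$, and never exactly one of two ordered pairs at even distance in $G^+$ is an arc of $P$ (pairs in different components of $G^+$ have no distance). Three vertices $x,y,z$ form a bad triple if $xyz$ is a triangle of $G$, its three edges correspond to vertices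 in three different connected components of $G^+$, and exactly two of its three edges are oriented in $P$. $P$ is friendly if it is consentaneous and has no bad triple. Corollary 4.13. The problem of deciding whether a friendly partially oriented graph can be completed to a locally transitive local tournament, and of obtaining such a completion if one exists, is solvable in polynomial time. That is: there are a program of a random access machine (instructions: load a constant, copy, addition, truncated subtraction, indirect load and store, jump, jump on zero; each costs one step) and a polynomial $p$ such that for every $n\ge 0$ and every friendly partially oriented graph $P$ on $\{0,\dots,n-1\}$, given by $n$ and its adjacency matrix, the program halts after at most $p(n)$ steps; it answers $1$ and outputs the adjacency matrix of a locally transitive local tournament that is a completion of $P$ if there is one, and answers $0$ if there is none. -/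

import Mathlib

/-! ### Oriented graphs and partially oriented graphs -/

/-- An oriented graph on the vertex set `V`: no loops, and at most one arc between two vertices. -/
@[ext]
structure OrientedGraph (V : Type) where
  /-- `arc u v` says that `(u, v)` is an arc. -/
  arc : V → V → Prop
  asymm : ∀ u v, arc u v → ¬ arc v u

/-- A partially oriented graph `P = (V, E ∪ A)`: the edge-disjoint union of a simple graph `(V, E)`
and an oriented graph `(V, A)`; no two vertices are joined by both an edge and an arc. -/
@[ext]
structure PartiallyOrientedGraph (V : Type) where
  /-- the unoriented edges -/
  edges : SimpleGraph V
  /-- `arc u v` says that `(u, v)` is an arc. -/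
  arc : V → V → Prop
  asymm : ∀ u v, arc u v → ¬ arc v u
  disjoint : ∀ u v, edges.Adj u v → ¬ arc u v

namespace OrientedGraph

variable {V : Type} (D : OrientedGraph V)

/-- The out-neighbours of `v`. -/
def outNeighbours (v : V) : Set V := {x | D.arc v x}

/-- The in-neighbours of `v`. -/
def inNeighbours (v : V) : Set V := {x | D.arc x v}

/-- The set `S` induces a tournament in `D`. -/
def InducesTournament (S : Set V) : Prop :=
  ∀ x ∈ S, ∀ y ∈ S, x ≠ y → D.arc x y ∨ D.arc y x

/-- The set `S` induces a transitive tournament in `D`. -/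
def InducesTransitiveTournament (S : Set V) : Prop :=
  D.InducesTournament S ∧
    ∀ x ∈ S, ∀ y ∈ S, ∀ z ∈ S, D.arc x y → D.arc y z → D.arc x z

/-- `D` is a local tournament. -/
def IsLocalTournament : Prop :=
  ∀ v, D.InducesTournament (D.outNeighbours v) ∧ D.InducesTournament (D.inNeighbours v)

/-- `D` is locally transitive. -/
def IsLocallyTransitive : Prop :=
  ∀ v, D.InducesTransitiveTournament (D.outNeighbours v) ∧
    D.InducesTransitiveTournament (D.inNeighbours v)

/-- An oriented graph, viewed as a partially oriented graph without unoriented edges. -/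
def toPartiallyOrientedGraph : PartiallyOrientedGraph V where
  edges := ⊥
  arc := D.arc
  asymm := D.asymm
  disjoint := fun _ _ h => absurd h (by simp)

end OrientedGraph

/-- The auxiliary graph `G⁺` of `G`. Its vertices are the ordered pairs `(u, v)` with `uv` an edge
of `G` (the darts of `G`); two distinct such pairs `(u, v)`, `(u', v')` are adjacent when
`u = u'` and `vv'` is not an edge, or `v = v'` and `uu'` is not an edge, or
`u = v'` and `v = u'`. -/
def SimpleGraph.auxiliaryGraph {V : Type} (G : SimpleGraph V) : SimpleGraph G.Dart where
  Adj a b := a ≠ b ∧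
    ((a.fst = b.fst ∧ ¬ G.Adj a.snd b.snd) ∨
      (¬ G.Adj a.fst b.fst ∧ a.snd = b.snd) ∨
      (a.fst = b.snd ∧ a.snd = b.fst))
  symm := ⟨by
    rintro a b ⟨hne, h⟩
    refine ⟨hne.symm, ?_⟩
    rcases h with ⟨h1, h2⟩ | ⟨h1, h2⟩ | ⟨h1, h2⟩
    · exact Or.inl ⟨h1.symm, fun h => h2 h.symm⟩
    · exact Or.inr (Or.inl ⟨fun h => h1 h.symm, h2.symm⟩)
    · exact Or.inr (Or.inr ⟨h2.symm, h1.symm⟩)⟩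
  loopless := ⟨fun _ h => h.1 rfl⟩

namespace PartiallyOrientedGraph

variable {V : Type} (P : PartiallyOrientedGraph V)

/-- The pair `u, v` is joined by an arc, in one of the two directions. -/
def Oriented (u v : V) : Prop := P.arc u v ∨ P.arc v u

/-- The underlying graph `UG(P)`. -/
def underlyingGraph : SimpleGraph V where
  Adj u v := P.edges.Adj u v ∨ P.Oriented u v
  symm := ⟨by
    rintro u v (h | h | h)
    · exact Or.inl h.symm
    · exact Or.inr (Or.inr h)
    · exact Or.inr (Or.inl h)⟩
  loopless := ⟨by
    rintro u (h | h | h)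
    · exact P.edges.loopless.irrefl u h
    · exact P.asymm u u h h
    · exact P.asymm u u h h⟩

/-- The oriented graph `D` is obtained from `P` by orienting every unoriented edge in one of the two
possible ways (and keeping every arc). -/
def IsCompletion (D : OrientedGraph V) : Prop :=
  (∀ u v, P.arc u v → D.arc u v) ∧
    ∀ u v, P.underlyingGraph.Adj u v ↔ D.arc u v ∨ D.arc v u

/-- With `G = UG(P)`: `P` does not contain two arcs at odd distance in `G⁺`, and does not contain
exactly one of two arcs at even distance in `G⁺`. (Vertices in different components of `G⁺` have
no finite distance; `dist` is `0` for them, whence the reachability hypothesis.) -/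
def IsConsentaneous : Prop :=
  (∀ a b : P.underlyingGraph.Dart, P.underlyingGraph.auxiliaryGraph.Reachable a b →
    Odd (P.underlyingGraph.auxiliaryGraph.dist a b) →
      ¬ (P.arc a.fst a.snd ∧ P.arc b.fst b.snd)) ∧
  (∀ a b : P.underlyingGraph.Dart, P.underlyingGraph.auxiliaryGraph.Reachable a b →
    Even (P.underlyingGraph.auxiliaryGraph.dist a b) →
      (P.arc a.fst a.snd ↔ P.arc b.fst b.snd))

/-- The triple `x, y, z` is bad: it is a triangle of `G = UG(P)`, its three edges belong to three
different components of `G⁺`, and exactly two of its three edges are oriented in `P`. (The pairs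
`(u, v)` and `(v, u)` are adjacent in `G⁺`, so either of them can represent the edge `uv`.) -/
def IsBadTriple (x y z : V) : Prop :=
  ∃ (hxy : P.underlyingGraph.Adj x y) (hyz : P.underlyingGraph.Adj y z)
    (hzx : P.underlyingGraph.Adj z x),
    ¬ P.underlyingGraph.auxiliaryGraph.Reachable ⟨(x, y), hxy⟩ ⟨(y, z), hyz⟩ ∧
    ¬ P.underlyingGraph.auxiliaryGraph.Reachable ⟨(y, z), hyz⟩ ⟨(z, x), hzx⟩ ∧
    ¬ P.underlyingGraph.auxiliaryGraph.Reachable ⟨(z, x), hzx⟩ ⟨(x, y), hxy⟩ ∧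
    ((P.Oriented x y ∧ P.Oriented y z ∧ ¬ P.Oriented z x) ∨
      (P.Oriented x y ∧ ¬ P.Oriented y z ∧ P.Oriented z x) ∨
      (¬ P.Oriented x y ∧ P.Oriented y z ∧ P.Oriented z x))

/-- `P` is friendly: it is consentaneous and has no bad triple. -/
def IsFriendly : Prop :=
  P.IsConsentaneous ∧ ∀ x y z, ¬ P.IsBadTriple x y z

open Classical in
/-- The entries of the adjacency matrix of `P`: `0` for a non-adjacent pair, `1` for an edge `uv`,
`2` for an arc `(u, v)`, `3` for an arc `(v, u)`. -/
noncomputable def entry (u v : V) : ℕ :=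
  if P.edges.Adj u v then 1 else if P.arc u v then 2 else if P.arc v u then 3 else 0

end PartiallyOrientedGraph

/-! ### Random access machines

The machine has registers and a memory, both indexed by `ℕ` and holding natural numbers. Every
instruction takes one step; there is no multiplication, so that this cost measure is polynomially
related to the time of Turing machines. -/

namespace RAM

/-- The instructions. -/
inductive Instr where
  /-- register `r` := the constant `k` -/
  | const (r k : ℕ)
  /-- register `r` := register `s` -/
  | copy (r s : ℕ)
  /-- register `r` := register `s` + register `t` -/
  | add (r s t : ℕ)
  /-- register `r` := register `s` - register `t`, or `0` if this is negative -/
  | sub (r s t : ℕ)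
  /-- register `r` := the memory cell whose address is in register `s` -/
  | load (r s : ℕ)
  /-- the memory cell whose address is in register `r` := register `s` -/
  | store (r s : ℕ)
  /-- go on with instruction number `l` -/
  | jump (l : ℕ)
  /-- go on with instruction number `l` if register `r` is `0`, else with the next instruction -/
  | jumpIfZero (r l : ℕ)

/-- A program is a finite list of instructions, numbered from `0`. -/
abbrev Program := List Instr

/-- A configuration: the number of the current instruction, the registers, the memory. -/
@[ext]
structure Config where
  pc : ℕ
  reg : ℕ → ℕ
  mem : ℕ → ℕ

/-- The effect of one instruction. -/
def Instr.exec (c : Config) : Instr → Config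
  | .const r k => ⟨c.pc + 1, Function.update c.reg r k, c.mem⟩
  | .copy r s => ⟨c.pc + 1, Function.update c.reg r (c.reg s), c.mem⟩
  | .add r s t => ⟨c.pc + 1, Function.update c.reg r (c.reg s + c.reg t), c.mem⟩
  | .sub r s t => ⟨c.pc + 1, Function.update c.reg r (c.reg s - c.reg t), c.mem⟩
  | .load r s => ⟨c.pc + 1, Function.update c.reg r (c.mem (c.reg s)), c.mem⟩
  | .store r s => ⟨c.pc + 1, c.reg, Function.update c.mem (c.reg r) (c.reg s)⟩
  | .jump l => ⟨l, c.reg, c.mem⟩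
  | .jumpIfZero r l => ⟨if c.reg r = 0 then l else c.pc + 1, c.reg, c.mem⟩

/-- The machine has halted when there is no current instruction. -/
def Halted (prog : Program) (c : Config) : Prop := prog.length ≤ c.pc

/-- One step of the machine; a halted machine does not move any more. -/
def step (prog : Program) (c : Config) : Config :=
  match prog[c.pc]? with
  | some i => i.exec c
  | none => c

/-- Started in `c`, the program halts after at most `T` steps, in the configuration `d`. -/
def HaltsWithin (prog : Program) (c : Config) (T : ℕ) (d : Config) : Prop :=
  ∃ t ≤ T, (step prog)^[t] c = d ∧ Halted prog d

/-- The start configuration on the input `P` with vertices `0, …, n - 1`: instruction `0` is the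
current one, register `0` holds `n`, the memory cells `0, …, n ^ 2 - 1` hold the adjacency matrix of
`P` row by row, all other registers and cells hold `0`. -/
noncomputable def start {n : ℕ} (P : PartiallyOrientedGraph (Fin n)) : Config where
  pc := 0
  reg := fun r => if r = 0 then n else 0
  mem := fun a => if h : a < n * n then P.entry (Fin.divNat ⟨a, h⟩) (Fin.modNat ⟨a, h⟩) else 0

/-- The memory cells `0, …, n ^ 2 - 1` hold the adjacency matrix of `P` row by row. -/
def Config.Stores {n : ℕ} (c : Config) (P : PartiallyOrientedGraph (Fin n)) : Prop :=
  ∀ i j : Fin n, c.mem ((i : ℕ) * n + (j : ℕ)) = P.entry i j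

end RAM

/-! ### Forcing between ordered pairs of adjacent vertices -/

/-! Let `G` be the underlying graph. In a local tournament an arc `(x, y)`, together with a
neighbour `z` of `x` apart from `y`, forces the arc `(z, x)`. Local tournament orientations of `G`
(`IsProperOrientation`) are therefore determined up to reversal on each forcing class. The classes
are governed by the co-components, the connected components of the complement of a component of `G`.
The edges from a vertex to another co-component form one class (`CoConnected.sameClass`). An edge
between twins is a class by itself (`Twins.eq_of_forced`). A twin-free triangle inside a
co-component lies in one class (`IsProperOrientation.sameClass_of_triangle`).

Local transitivity adds a condition on four pairwise adjacent vertices: none of them dominates, or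
is dominated by, a cyclic triangle. The orientations excluded by `FourGood` are those that cannot be
made transitive by switching, that is, by reversing all arcs at some of the vertices; so goodness is
invariant under switching.

No search is needed, because one orientation `canonicalArc`, defined from `P` alone, is good as soon
as any good orientation `D` exists (`canonicalArc_isGoodOrientation`). It keeps the arcs of `P`.
Inside a co-component, a class is oriented by its least pair, and twins follow the order of their
blocks. Between co-components, vertices are grouped by co-connection and arcs; this is an
equivalence because there are no bad triples. Each vertex has a sign relative to the least member of
its group, and unoriented edges follow the order of the groups, switched according to the signs.
Four pairwise adjacent vertices then look like `D` up to harmless reversals, or contain a pair or a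
transitive triple that the others see alike, or form a switched linear order, or copy the arcs of
`D` at a representative.

Deciding thus means computing the canonical orientation and checking it. It is first-order definable
from three least fixed points of arity at most four, each reached within `n ^ 4` rounds. Formulas
and fixed points compile to nested loops whose depth does not depend on `n`, which gives a
polynomial time bound (`exists_machine`). -/

namespace SimpleGraph

variable {V : Type} (G : SimpleGraph V)

/-- `x` and `y` are distinct and not adjacent. -/
def Apart (x y : V) : Prop := x ≠ y ∧ ¬ G.Adj x y

/-- In a local tournament with underlying graph `G`, the arc `a` forces the arc `b`, because two
out-neighbours (or two in-neighbours) of one vertex are adjacent. -/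
def Forces (a b : V × V) : Prop :=
  (b.2 = a.1 ∧ G.Adj b.1 a.1 ∧ G.Apart b.1 a.2) ∨ (b.1 = a.2 ∧ G.Adj b.2 a.2 ∧ G.Apart b.2 a.1)

/-- The reflexive transitive closure of `Forces`. -/
def Forced : V × V → V × V → Prop := Relation.ReflTransGen G.Forces

/-- The unordered pairs `a` and `b` belong to the same forcing class. -/
def SameClass (a b : V × V) : Prop := G.Forced a b ∨ G.Forced a b.swap

/-- Adjacent or not, `x` and `y` have the same neighbours otherwise. -/
def Twins (x y : V) : Prop := ∀ w, w ≠ x → w ≠ y → (G.Adj w x ↔ G.Adj w y)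

/-- `x` and `y` lie in the same connected component of the complement of a connected component. -/
def CoConnected : V → V → Prop := Relation.ReflTransGen fun x y => G.Reachable x y ∧ G.Apart x y

/-- The vertex `t` belongs to some pair forced by `a`. -/
def Touches (a : V × V) (t : V) : Prop := ∃ p, G.Forced a (t, p) ∨ G.Forced a (p, t)

variable {G}

theorem Apart.symm {x y : V} (h : G.Apart x y) : G.Apart y x :=
  ⟨h.1.symm, fun h' => h.2 h'.symm⟩

theorem Forces.left {x y z : V} (h' : G.Adj x z) (hyz : G.Apart y z) :
    G.Forces (x, y) (z, x) := Or.inl ⟨rfl, h'.symm, hyz.symm⟩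

theorem Forces.right {x y z : V} (h' : G.Adj z y) (hxz : G.Apart x z) :
    G.Forces (x, y) (y, z) := Or.inr ⟨rfl, h', hxz.symm⟩

theorem Forces.swap {a b : V × V} (h : G.Forces a b) : G.Forces a.swap b.swap := by
  obtain ⟨a1, a2⟩ := a
  obtain ⟨b1, b2⟩ := b
  rcases h with ⟨h1, h2, h3⟩ | ⟨h1, h2, h3⟩
  · exact Or.inr ⟨h1, h2, h3⟩
  · exact Or.inl ⟨h1, h2, h3⟩

theorem Forces.symm {a b : V × V} (h : G.Forces a b) (ha : G.Adj a.1 a.2) : G.Forces b a := by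
  obtain ⟨a1, a2⟩ := a
  obtain ⟨b1, b2⟩ := b
  rcases h with ⟨h1, h2, h3⟩ | ⟨h1, h2, h3⟩
  · simp only at h1 h2 h3 ha; subst h1
    exact Or.inr ⟨rfl, ha.symm, h3.symm⟩
  · simp only at h1 h2 h3 ha; subst h1
    exact Or.inl ⟨rfl, ha, h3.symm⟩

theorem Forces.adj {a b : V × V} (h : G.Forces a b) : G.Adj b.1 b.2 := by
  obtain ⟨a1, a2⟩ := a
  obtain ⟨b1, b2⟩ := b
  rcases h with ⟨h1, h2, h3⟩ | ⟨h1, h2, h3⟩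
  · simp only at h1 h2 ⊢; rwa [h1]
  · simp only at h1 h2 ⊢; rw [h1]; exact h2.symm

theorem Forced.refl (a : V × V) : G.Forced a a := Relation.ReflTransGen.refl

theorem Forced.trans {a b c : V × V} (h : G.Forced a b) (h' : G.Forced b c) : G.Forced a c :=
  Relation.ReflTransGen.trans h h'

theorem Forced.adj {a b : V × V} (h : G.Forced a b) (ha : G.Adj a.1 a.2) : G.Adj b.1 b.2 := by
  cases h with
  | refl => exact ha
  | tail _ h => exact h.adj

theorem Forced.symm {a b : V × V} (h : G.Forced a b) (ha : G.Adj a.1 a.2) : G.Forced b a := by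
  induction h with
  | refl => exact Forced.refl a
  | tail h1 h2 ih => exact Relation.ReflTransGen.head (h2.symm (Forced.adj h1 ha)) ih

theorem Forced.swap {a b : V × V} (h : G.Forced a b) : G.Forced a.swap b.swap := by
  induction h with
  | refl => exact Forced.refl _
  | tail _ h2 ih => exact Relation.ReflTransGen.tail ih h2.swap

theorem Forced.left {x y z : V} (h' : G.Adj x z) (hyz : G.Apart y z) :
    G.Forced (x, y) (z, x) := Relation.ReflTransGen.single (Forces.left h' hyz)

theorem Forced.right {x y z : V} (h' : G.Adj z y) (hxz : G.Apart x z) :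
    G.Forced (x, y) (y, z) := Relation.ReflTransGen.single (Forces.right h' hxz)

theorem SameClass.symm {a b : V × V} (h : G.SameClass a b) (ha : G.Adj a.1 a.2) :
    G.SameClass b a := by
  rcases h with h | h
  · exact Or.inl (h.symm ha)
  · exact Or.inr (by simpa using (h.symm ha).swap)

theorem SameClass.trans {a b c : V × V} (h : G.SameClass a b) (h' : G.SameClass b c) :
    G.SameClass a c := by
  rcases h with h | h <;> rcases h' with h' | h'
  · exact Or.inl (h.trans h')
  · exact Or.inr (h.trans h')
  · exact Or.inr (h.trans h'.swap)
  · exact Or.inl (by simpa using h.trans h'.swap)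

theorem SameClass.swap_right {a b : V × V} (h : G.SameClass a b) : G.SameClass a b.swap := by
  rcases h with h | h
  · exact Or.inr (by simpa using h)
  · exact Or.inl h

theorem SameClass.swap_left {a b : V × V} (h : G.SameClass a b) : G.SameClass a.swap b := by
  rcases h with h | h
  · exact Or.inr h.swap
  · exact Or.inl (by simpa using h.swap)

theorem SameClass.refl (a : V × V) : G.SameClass a a := Or.inl (Forced.refl a)

theorem CoConnected.refl (x : V) : G.CoConnected x x := Relation.ReflTransGen.refl

theorem CoConnected.symm {x y : V} (h : G.CoConnected x y) : G.CoConnected y x := by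
  induction h with
  | refl => exact CoConnected.refl _
  | tail _ h2 ih => exact Relation.ReflTransGen.head ⟨h2.1.symm, h2.2.symm⟩ ih

theorem CoConnected.trans {x y z : V} (h : G.CoConnected x y) (h' : G.CoConnected y z) :
    G.CoConnected x z := Relation.ReflTransGen.trans h h'

theorem coConnected_of_apart {x y z : V} (h : G.Adj x y) (h' : G.Adj x z) (hyz : G.Apart y z) :
    G.CoConnected y z :=
  Relation.ReflTransGen.single ⟨h.symm.reachable.trans h'.reachable, hyz⟩

theorem adj_of_not_coConnected {x y : V} (h : G.Reachable x y) (h' : ¬ G.CoConnected x y) :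
    G.Adj x y := by
  by_contra hn
  refine h' (Relation.ReflTransGen.single ⟨h, ?_, hn⟩)
  rintro rfl
  exact h' (CoConnected.refl _)

theorem Twins.symm {x y : V} (h : G.Twins x y) : G.Twins y x :=
  fun w h1 h2 => (h w h2 h1).symm

theorem Twins.apart {x y z : V} (h : G.Twins x y) (hxy : G.Adj x y) (hz : G.Apart x z) :
    G.Apart y z := by
  have hzy : z ≠ y := by rintro rfl; exact hz.2 hxy
  exact ⟨hzy.symm, fun h' => hz.2 ((h z hz.1.symm hzy).2 h'.symm).symm⟩

theorem Twins.trans {x y z : V} (hxy : G.Adj x y) (hyz : G.Adj y z)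
    (h : G.Twins x y) (h' : G.Twins y z) : G.Twins x z := by
  intro w h1 h2
  by_cases hw : w = y
  · subst hw; exact ⟨fun _ => hyz, fun _ => hxy.symm⟩
  · exact (h w h1 hw).trans (h' w hw h2)

/-- A forcing step keeps one end of the edge, in the other coordinate, and replaces the other end by
a vertex apart from it with a common neighbour. So the two co-components persist and trade
coordinates. -/
theorem Forces.coConnected {x y u v : V} (h : G.Forces (x, y) (u, v)) (hxy : G.Adj x y) :
    G.CoConnected x v ∧ G.CoConnected y u := by
  rcases h with ⟨h1, h2, h3⟩ | ⟨h1, h2, h3⟩ <;> simp only at h1 h2 h3 <;> subst h1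
  · exact ⟨CoConnected.refl _, coConnected_of_apart hxy h2.symm h3.symm⟩
  · exact ⟨coConnected_of_apart hxy.symm h2.symm h3.symm, CoConnected.refl _⟩

theorem Forced.coConnected {x y : V} {a : V × V} (h : G.Forced (x, y) a) (hxy : G.Adj x y) :
    (G.CoConnected x a.1 ∧ G.CoConnected y a.2) ∨ (G.CoConnected x a.2 ∧ G.CoConnected y a.1) := by
  induction h with
  | refl => exact Or.inl ⟨CoConnected.refl _, CoConnected.refl _⟩
  | tail h1 h2 ih =>
    have h3 := Forces.coConnected h2 (Forced.adj h1 hxy)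
    rcases ih with ⟨i1, i2⟩ | ⟨i1, i2⟩
    · exact Or.inr ⟨i1.trans h3.1, i2.trans h3.2⟩
    · exact Or.inl ⟨i1.trans h3.2, i2.trans h3.1⟩

theorem SameClass.coConnected {x y u v : V} (h : G.SameClass (x, y) (u, v)) (hxy : G.Adj x y) :
    (G.CoConnected x u ∧ G.CoConnected y v) ∨ (G.CoConnected x v ∧ G.CoConnected y u) := by
  rcases h with h | h
  · exact h.coConnected hxy
  · exact (h.coConnected hxy).symm

/-- The edges between a vertex and another co-component form one forcing class. -/
theorem CoConnected.sameClass {x y z : V} (h : G.CoConnected x y) (hz : G.Adj z x)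
    (hzx : ¬ G.CoConnected z x) : G.Adj z y ∧ G.SameClass (z, x) (z, y) := by
  induction h with
  | refl => exact ⟨hz, SameClass.refl _⟩
  | @tail b c h1 h2 ih =>
    have hc : G.Adj z c := adj_of_not_coConnected (ih.1.reachable.trans h2.1)
      fun h => hzx (h.trans (CoConnected.symm (Relation.ReflTransGen.tail h1 h2)))
    exact ⟨hc, ih.2.trans (Or.inr (Forced.left hc h2.2))⟩

/-- Forcing needs a vertex adjacent to one end and apart from the other. Hence an edge between twins
is a forcing class by itself. -/
theorem Twins.not_forces {x y : V} {b : V × V} (h : G.Twins x y)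
    (hf : G.Forces (x, y) b) : False := by
  obtain ⟨b1, b2⟩ := b
  rcases hf with ⟨h1, h2, h3⟩ | ⟨h1, h2, h3⟩ <;> simp only at h1 h2 h3
  · exact h3.2 ((h b1 h2.ne h3.1).1 h2)
  · exact h3.2 ((h b2 h3.1 h2.ne).2 h2)

theorem Twins.eq_of_forced {x y : V} {b : V × V} (h : G.Twins x y)
    (hf : G.Forced (x, y) b) : b = (x, y) := by
  induction hf with
  | refl => rfl
  | tail _ h2 ih => subst ih; exact (h.not_forces h2).elim

/-! ### Orientations that respect the forcing -/

/-- The relation `D` orients every edge of `G` in such a way that the out-neighbours, and the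
in-neighbours, of every vertex are pairwise adjacent. -/
structure IsProperOrientation (G : SimpleGraph V) (D : V → V → Prop) : Prop where
  iff_not : ∀ ⦃x y⦄, G.Adj x y → (D x y ↔ ¬ D y x)
  flip : ∀ ⦃x y z⦄, G.Adj x y → G.Adj x z → G.Apart y z → (D x y ↔ D z x)

namespace IsProperOrientation

variable {D D' : V → V → Prop}

theorem forces (h : G.IsProperOrientation D) {a b : V × V} (hab : G.Forces a b)
    (ha : G.Adj a.1 a.2) : D a.1 a.2 ↔ D b.1 b.2 := by
  obtain ⟨a1, a2⟩ := a
  obtain ⟨b1, b2⟩ := b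
  rcases hab with ⟨h1, h2, h3⟩ | ⟨h1, h2, h3⟩ <;> simp only at h1 h2 h3 ha ⊢ <;> subst h1
  · exact h.flip ha h2.symm h3.symm
  · have h4 := h.flip ha.symm h2.symm h3.symm
    rw [h.iff_not ha, h4, h.iff_not h2.symm]

theorem forced (h : G.IsProperOrientation D) {a b : V × V} (hab : G.Forced a b)
    (ha : G.Adj a.1 a.2) : D a.1 a.2 ↔ D b.1 b.2 := by
  induction hab with
  | refl => rfl
  | tail h1 h2 ih => exact ih.trans (h.forces h2 (Forced.adj h1 ha))

/-- On a forcing class, two orientations agree everywhere or nowhere. -/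
theorem sameClass (h : G.IsProperOrientation D) (h' : G.IsProperOrientation D') {x y u v : V}
    (hs : G.SameClass (x, y) (u, v)) (ha : G.Adj x y) :
    (D x y ↔ D' x y) ↔ (D u v ↔ D' u v) := by
  rcases hs with hs | hs
  · have := h.forced hs ha
    have := h'.forced hs ha
    simp only at *
    tauto
  · have h1 := h.forced hs ha
    have h2 := h'.forced hs ha
    have h3 : G.Adj v u := Forced.adj hs ha
    have h4 := h.iff_not h3
    have h5 := h'.iff_not h3
    simp only [Prod.fst_swap, Prod.snd_swap] at *
    tauto

/-- Two of the three arcs at `x` would point the same way, so their other ends would have to be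
adjacent. -/
theorem no_claw (h : G.IsProperOrientation D) {x a b c : V} (ha : G.Adj x a) (hb : G.Adj x b)
    (hc : G.Adj x c) (hab : G.Apart a b) (hbc : G.Apart b c) (hac : G.Apart a c) : False := by
  have h1 := h.flip ha hb hab
  have h2 := h.flip hb hc hbc
  have h3 := h.flip ha hc hac
  have h4 := h.iff_not ha
  have h5 := h.iff_not hb
  have h6 := h.iff_not hc
  tauto

/-- Whether two co-connected vertices lie on the same side, as seen from another co-component, does
not depend on the vertex from which they are seen. -/
theorem same_side_iff (h : G.IsProperOrientation D) (h' : G.IsProperOrientation D') {x y z w : V}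
    (hxy : G.CoConnected x y) (hz : G.Adj z x) (hzx : ¬ G.CoConnected z x) (hw : G.Adj w x)
    (hwx : ¬ G.CoConnected w x) : (D z x ↔ D z y) ↔ (D' w x ↔ D' w y) := by
  induction hxy with
  | refl => simp
  | @tail b c h1 h2 ih =>
    have hzb := (CoConnected.sameClass h1 hz hzx).1
    have hwb := (CoConnected.sameClass h1 hw hwx).1
    have h3 : G.CoConnected x c := Relation.ReflTransGen.tail h1 h2
    have hzc := (CoConnected.sameClass h3 hz hzx).1
    have hwc := (CoConnected.sameClass h3 hw hwx).1
    -- Moving to a vertex apart from the current one changes the side, whether seen from `z` or from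
    -- `w`; only the parity of the number of moves counts.
    have e1 := h.flip hzb hzc h2.2
    have e2 := h'.flip hwb hwc h2.2
    have e3 := h.iff_not hzc
    have e4 := h'.iff_not hwc
    tauto

end IsProperOrientation

/-! ### Vertices touched by a forcing class; triangles and twins inside a co-component -/

theorem touches_fst (a : V × V) : G.Touches a a.1 := ⟨a.2, Or.inl (Forced.refl _)⟩

theorem touches_snd (a : V × V) : G.Touches a a.2 := ⟨a.1, Or.inr (Forced.refl _)⟩

/-- The vertices touched by a forcing class form a module. -/
theorem adj_iff_of_not_touches {x y t : V} (ht : ¬ G.Touches (x, y) t) {p : V}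
    (hp : G.Touches (x, y) p) : G.Adj t p ↔ G.Adj t x := by
  -- A vertex adjacent to exactly one end of a forced pair lies in a pair forced next, so an
  -- untouched vertex sees both ends alike.
  have key : ∀ a : V × V, G.Forced (x, y) a → (G.Adj t a.1 ↔ G.Adj t a.2) := by
    intro a ha
    by_contra hne
    have h1 : t ≠ a.1 := by rintro rfl; exact ht ⟨a.2, Or.inl ha⟩
    have h2 : t ≠ a.2 := by rintro rfl; exact ht ⟨a.1, Or.inr ha⟩
    by_cases h3 : G.Adj t a.1
    · have h4 : ¬ G.Adj t a.2 := fun h => hne (by simp [h3, h])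
      exact ht ⟨a.1, Or.inl (Relation.ReflTransGen.tail ha (Or.inl ⟨rfl, h3, h2, h4⟩))⟩
    · have h4 : G.Adj t a.2 := by by_contra h; exact hne (by simp [h3, h])
      exact ht ⟨a.2, Or.inr (Relation.ReflTransGen.tail ha (Or.inr ⟨rfl, h4, h1, h3⟩))⟩
  have main : ∀ a : V × V, G.Forced (x, y) a → (G.Adj t a.1 ↔ G.Adj t x) := by
    intro a ha
    induction ha with
    | refl => rfl
    | @tail b c h1 h2 ih =>
      have hc := key c (Relation.ReflTransGen.tail h1 h2)
      have hb := key b h1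
      rcases h2 with ⟨h3, -⟩ | ⟨h3, -⟩
      · rw [hc, h3, ih]
      · rw [h3, ← hb, ih]
  obtain ⟨q, hq | hq⟩ := hp
  · exact main _ hq
  · exact (key _ hq).symm.trans (main _ hq)

/-- The set of vertices touched by a forcing class with more than one edge is a union of
co-components. -/
theorem IsProperOrientation.touches_of_coConnected {D : V → V → Prop}
    (h : G.IsProperOrientation D) {x y t t' : V} (hnt : ¬ G.Twins x y)
    (ht : G.Touches (x, y) t) (hc : G.CoConnected t t') : G.Touches (x, y) t' := by
  -- A vertex that distinguishes `x` from `y` is touched, and is apart from one of them. This pair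
  -- supplies two leaves of the claw below.
  obtain ⟨p, q, hp, hq, hpq⟩ : ∃ p q, G.Touches (x, y) p ∧ G.Touches (x, y) q ∧ G.Apart p q := by
    simp only [Twins, not_forall] at hnt
    obtain ⟨w, hwx, hwy, hne⟩ := hnt
    by_cases h3 : G.Adj w x
    · have h4 : ¬ G.Adj w y := fun h => hne (by simp [h3, h])
      exact ⟨w, y, ⟨x, Or.inl (Relation.ReflTransGen.single (Or.inl ⟨rfl, h3, hwy, h4⟩))⟩,
        touches_snd _, hwy, h4⟩
    · have h4 : G.Adj w y := by by_contra h; exact hne (by simp [h3, h])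
      exact ⟨w, x, ⟨y, Or.inr (Relation.ReflTransGen.single (Or.inr ⟨rfl, h4, hwx, h3⟩))⟩,
        touches_fst _, hwx, h3⟩
  induction hc with
  | refl => exact ht
  | @tail b c _ h2 ih =>
    by_contra hct
    -- Walking away from `b`, an untouched vertex is adjacent to all touched ones. If its
    -- predecessor is touched, this is the module property. If the predecessor is itself adjacent to
    -- all touched vertices, then otherwise it would be the centre of a claw with leaves `v`, `p`,
    -- `q`.
    have key : ∀ v, G.Reachable b v →
        G.Touches (x, y) v ∨ ∀ s, G.Touches (x, y) s → G.Adj v s := by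
      intro v hv
      rw [SimpleGraph.reachable_iff_reflTransGen] at hv
      induction hv with
      | refl => exact Or.inl ih
      | @tail u v _ huv ihu =>
        by_cases hvt : G.Touches (x, y) v
        · exact Or.inl hvt
        right
        rcases ihu with ihu | ihu
        · intro s hs
          rw [adj_iff_of_not_touches hvt hs, ← adj_iff_of_not_touches hvt ihu]
          exact huv.symm
        · by_contra hn
          push Not at hn
          obtain ⟨s, hs, hvs⟩ := hn
          have hall : ∀ s, G.Touches (x, y) s → G.Apart v s := by
            intro s' hs'
            refine ⟨by rintro rfl; exact hvt hs', ?_⟩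
            rwa [adj_iff_of_not_touches hvt hs', ← adj_iff_of_not_touches hvt hs]
          exact h.no_claw huv (ihu p hp) (ihu q hq) (hall p hp) hpq (hall q hq)
    rcases key c h2.1 with h3 | h3
    · exact hct h3
    · exact h2.2.2 (h3 b ih).symm

/-- Otherwise the class of `xz` never reaches `y`: along the forcing, `y` stays adjacent to both
ends through edges outside the class. But `y` is co-connected with `x`, and since `x` and `z` are
not twins, the class touches the whole co-component. -/
theorem IsProperOrientation.sameClass_or_of_triangle {D : V → V → Prop}
    (h : G.IsProperOrientation D) {x y z : V} (hxz : G.Adj x z) (hxy : G.Adj x y)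
    (hzy : G.Adj z y) (hc : G.CoConnected x y) (hnt : ¬ G.Twins x z) :
    G.SameClass (x, z) (x, y) ∨ G.SameClass (x, z) (z, y) := by
  by_contra hn
  push Not at hn
  obtain ⟨hn1, hn2⟩ := hn
  have key : ∀ a : V × V, G.Forced (x, z) a → G.Adj a.1 y ∧ G.Adj a.2 y ∧
      ¬ G.SameClass (x, z) (a.1, y) ∧ ¬ G.SameClass (x, z) (a.2, y) := by
    have step : ∀ p q r, G.SameClass (x, z) (p, q) → G.Adj p q → G.Adj p y → G.Adj q y →
        ¬ G.SameClass (x, z) (p, y) → ¬ G.SameClass (x, z) (q, y) → G.Adj r p → G.Apart r q →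
        G.Adj r y ∧ ¬ G.SameClass (x, z) (r, y) := by
      intro p q r hf hpq hpy hqy hsp hsq hrp hrq
      -- If `r` and `y` were apart, the edge `rp` of the class would force the edge `py` into it.
      have hry : G.Adj r y := by
        by_contra hry
        have hry' : r ≠ y := by rintro rfl; exact hrq.2 hqy.symm
        refine hsp ?_
        have h1 : G.SameClass (x, z) (r, p) := hf.trans (Or.inl (Forced.left hrp.symm hrq.symm))
        exact h1.trans (Or.inl (Forced.right hpy.symm ⟨hry', hry⟩))
      refine ⟨hry, fun hs => hsq (hs.trans ?_)⟩
      have h1 := Forced.right hqy hrq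
      exact Or.inr h1
    intro a ha
    induction ha with
    | refl => exact ⟨hxy, hzy, hn1, hn2⟩
    | @tail b c h1 h2 ih =>
      obtain ⟨i1, i2, i3, i4⟩ := ih
      have hb := Forced.adj h1 hxz
      obtain ⟨b1, b2⟩ := b
      obtain ⟨c1, c2⟩ := c
      rcases h2 with ⟨h3, h4, h5⟩ | ⟨h3, h4, h5⟩ <;> simp only at * <;> subst h3
      · have := step _ _ _ (Or.inl h1) hb i1 i2 i3 i4 h4 h5
        exact ⟨this.1, i1, this.2, i3⟩
      · have := step _ _ _ (Or.inr h1) hb.symm i2 i1 i4 i3 h4 h5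
        exact ⟨i2, this.1, i4, this.2⟩
  obtain ⟨p, hp | hp⟩ := h.touches_of_coConnected hnt (touches_fst _) hc
  · exact G.loopless.irrefl _ (key _ hp).1
  · exact G.loopless.irrefl _ (key _ hp).2.1

/-- In a triangle inside a co-component, all edges that do not join twins belong to one forcing
class. -/
theorem IsProperOrientation.sameClass_of_triangle {D : V → V → Prop}
    (h : G.IsProperOrientation D) {x y z : V} (hxz : G.Adj x z) (hxy : G.Adj x y)
    (hzy : G.Adj z y) (hc : G.CoConnected x y) (hc' : G.CoConnected x z) (hnt : ¬ G.Twins x z)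
    (hnt' : ¬ G.Twins x y) : G.SameClass (x, y) (x, z) := by
  rcases h.sameClass_or_of_triangle hxz hxy hzy hc hnt with h1 | h1
  · exact h1.symm hxz
  · rcases h.sameClass_or_of_triangle hxy hxz hzy.symm hc' hnt' with h2 | h2
    · exact h2
    · exact h2.trans (h1.symm hxz).swap_left

/-- Exchanging adjacent twins is an automorphism of `G`, and forcing is defined from adjacency. -/
theorem Forced.twin_swap {x y : V} [DecidableEq V] (hxy : G.Adj x y) (h : G.Twins x y)
    {a b : V × V} (hab : G.Forced a b) :
    G.Forced (Equiv.swap x y a.1, Equiv.swap x y a.2) (Equiv.swap x y b.1, Equiv.swap x y b.2) := by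
  have hadj : ∀ u v, G.Adj u v → G.Adj (Equiv.swap x y u) (Equiv.swap x y v) := by
    have aux : ∀ w, w ≠ x → w ≠ y → (G.Adj x w ↔ G.Adj y w) := fun w h1 h2 => by
      rw [G.adj_comm x, G.adj_comm y]; exact h w h1 h2
    intro u v huv
    by_cases hux : u = x
    · subst hux
      by_cases hvy : v = y
      · subst hvy; simpa using hxy.symm
      · rw [Equiv.swap_apply_left, Equiv.swap_apply_of_ne_of_ne huv.ne' hvy]
        exact (aux v huv.ne' hvy).1 huv
    by_cases huy : u = y
    · subst huy
      by_cases hvx : v = x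
      · subst hvx; simpa using hxy
      · rw [Equiv.swap_apply_right, Equiv.swap_apply_of_ne_of_ne hvx huv.ne']
        exact (aux v hvx huv.ne').2 huv
    rw [Equiv.swap_apply_of_ne_of_ne hux huy]
    by_cases hvx : v = x
    · subst hvx
      rw [Equiv.swap_apply_left]
      exact (h u hux huy).1 huv
    by_cases hvy : v = y
    · subst hvy
      rw [Equiv.swap_apply_right]
      exact (h u hux huy).2 huv
    rwa [Equiv.swap_apply_of_ne_of_ne hvx hvy]
  have hadj' : ∀ u v, G.Adj (Equiv.swap x y u) (Equiv.swap x y v) ↔ G.Adj u v := by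
    intro u v
    refine ⟨fun h => ?_, hadj u v⟩
    simpa using hadj _ _ h
  have hap : ∀ u v, G.Apart (Equiv.swap x y u) (Equiv.swap x y v) ↔ G.Apart u v := by
    intro u v
    simp [Apart, hadj']
  refine Relation.ReflTransGen.lift (fun c : V × V => (Equiv.swap x y c.1, Equiv.swap x y c.2)) ?_ _ _ hab
  intro c d hcd
  simpa [Forces, hadj', hap] using hcd

/-- A vertex that is adjacent to the twins `x` and `y` but not a twin of theirs sees them in the
same way, unless they are adjacent to all vertices of their component. -/
theorem IsProperOrientation.twins_iff {D : V → V → Prop} (h : G.IsProperOrientation D)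
    {x y s u : V} (hxy : G.Adj x y) (ht : G.Twins x y) (hs : G.Reachable x s) (hxs : G.Apart x s)
    (hux : G.Adj u x) (huy : G.Adj u y) (hn : ¬ G.Twins u x) : D u x ↔ D u y := by
  classical
  have hys := ht.apart hxy hxs
  -- The class of `ux` reaches a pair containing `s`. Neither `x` nor `y` is in that pair, both
  -- being apart from `s`. Exchanging the twins fixes the pair, so `(u, x)` and `(u, y)` force the
  -- same arc.
  obtain ⟨p, hp⟩ := h.touches_of_coConnected hn (touches_snd _)
    (Relation.ReflTransGen.single ⟨hs, hxs⟩)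
  have hsw := fun q (hq : G.Forced (u, x) q) => Forced.twin_swap hxy ht hq
  rcases hp with hp | hp
  · have hsp := Forced.adj hp hux
    have h1 := h.forced hp hux
    have h2 := hsw _ hp
    have hpx : p ≠ x := by rintro rfl; exact hxs.2 hsp.symm
    have hpy : p ≠ y := by rintro rfl; exact hys.2 hsp.symm
    rw [Equiv.swap_apply_of_ne_of_ne hux.ne huy.ne, Equiv.swap_apply_left,
      Equiv.swap_apply_of_ne_of_ne hxs.1.symm hys.1.symm, Equiv.swap_apply_of_ne_of_ne hpx hpy] at h2
    exact h1.trans (h.forced h2 huy).symm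
  · have hsp := Forced.adj hp hux
    have h1 := h.forced hp hux
    have h2 := hsw _ hp
    have hpx : p ≠ x := by rintro rfl; exact hxs.2 hsp
    have hpy : p ≠ y := by rintro rfl; exact hys.2 hsp
    rw [Equiv.swap_apply_of_ne_of_ne hux.ne huy.ne, Equiv.swap_apply_left,
      Equiv.swap_apply_of_ne_of_ne hxs.1.symm hys.1.symm, Equiv.swap_apply_of_ne_of_ne hpx hpy] at h2
    exact h1.trans (h.forced h2 huy).symm

theorem CoConnected.exists_apart {x y : V} (h : G.CoConnected x y) (hxy : x ≠ y) :
    ∃ s, G.Reachable x s ∧ G.Apart x s := by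
  rcases Relation.ReflTransGen.cases_head h with h | ⟨s, hs, -⟩
  · exact absurd h hxy
  · exact ⟨s, hs⟩

/-- Otherwise a walk from `x` could never leave the closed neighbourhood of `x`, so it would not
reach `s`. -/
theorem exists_adj_not_twins {x s : V} (h : G.Reachable x s) (hs : G.Apart x s) :
    ∃ u v, G.Adj u x ∧ G.Adj u v ∧ G.Apart v x := by
  by_contra hn
  push Not at hn
  have key : ∀ v, G.Reachable x v → v = x ∨ G.Adj v x := by
    intro v hv
    rw [SimpleGraph.reachable_iff_reflTransGen] at hv
    induction hv with
    | refl => exact Or.inl rfl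
    | @tail u v _ huv ih =>
      rcases ih with rfl | ih
      · exact Or.inr huv.symm
      · by_contra hv
        push Not at hv
        exact hn u v ih huv hv
  rcases key s h with h1 | h1
  · exact hs.1 h1.symm
  · exact hs.2 h1.symm

end SimpleGraph

/-! ### Orientations of the complete graph on four vertices -/

/-- In the orientation of the complete graph on `a, b, c, e` in which `ab` says that `a → b` and so
on, no vertex dominates a cyclic triangle, and no vertex is dominated by one. -/
def FourGood (ab ac ae bc be ce : Prop) : Prop :=
  ¬ ((ab ↔ ac) ∧ (ac ↔ ae) ∧ (bc ↔ ce) ∧ (bc ↔ ¬ be)) ∧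
  ¬ ((ab ↔ ¬ bc) ∧ (bc ↔ be) ∧ (ac ↔ ce) ∧ (ac ↔ ¬ ae)) ∧
  ¬ ((ac ↔ bc) ∧ (ce ↔ ¬ ac) ∧ (ab ↔ be) ∧ (ab ↔ ¬ ae)) ∧
  ¬ ((ae ↔ be) ∧ (be ↔ ce) ∧ (ab ↔ bc) ∧ (ab ↔ ¬ ac))

namespace FourGood

variable {ab ac ae bc be ce ab' ac' ae' bc' be' ce' : Prop}

/-- In a forbidden orientation any two vertices agree on exactly one of the other two. -/
theorem of_pair (h : (ac ↔ bc) ↔ (ae ↔ be)) : FourGood ab ac ae bc be ce := by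
  unfold FourGood; grind

/-- Reversing a triangle, or all arcs at the fourth vertex, is harmless. -/
theorem of_triangle (h : FourGood ab ac ae bc be ce) (h1 : (ab ↔ ab') ↔ (ac ↔ ac'))
    (h2 : (ab ↔ ab') ↔ (bc ↔ bc')) (h3 : (ae ↔ ae') ↔ (be ↔ be'))
    (h4 : (ae ↔ ae') ↔ (ce ↔ ce')) : FourGood ab' ac' ae' bc' be' ce' := by
  unfold FourGood at *; grind

theorem of_transitive (h1 : ae ↔ be) (h2 : be ↔ ce) (h : ¬ ((ab ↔ bc) ∧ (ab ↔ ¬ ac))) :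
    FourGood ab ac ae bc be ce := by
  unfold FourGood; grind

/-- The arcs between `a, b, c` and `e` follow the arcs between `a, b, c` and a further vertex. -/
theorem of_shadow {s : Prop} (h : FourGood ab ac ae bc be ce) (h1 : ae' ↔ (s ↔ ae))
    (h2 : be' ↔ (s ↔ be)) (h3 : ce' ↔ (s ↔ ce)) : FourGood ab ac ae' bc be' ce' := by
  unfold FourGood at *; grind

/-- Up to switching at `e`, the vertices `a` and `e` either agree on both `b` and `c` or disagree on
both, so the argument of `of_pair` applies to them. The hypotheses describe a vertex on the same
side as `a`, or on the opposite one, seen from `b` and `c`. -/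
theorem of_side {s p q r br cr : Prop} (h1 : p ↔ (br ↔ ¬ ab)) (h2 : p ↔ (cr ↔ ¬ ac))
    (h3 : q ↔ ¬ br) (h4 : r ↔ ¬ cr) (h5 : ae ↔ (s ↔ p)) (h6 : be ↔ (s ↔ q)) (h7 : ce ↔ (s ↔ r)) :
    FourGood ab ac ae bc be ce := by
  unfold FourGood at *; grind

/-- The orientation is a linear order switched at the vertices whose sign is false. -/
theorem of_linear {V : Type} [LinearOrder V] {a b c e : V} {p q r s : Prop}
    (h1 : ab ↔ (a < b ↔ (p ↔ q))) (h2 : ac ↔ (a < c ↔ (p ↔ r))) (h3 : ae ↔ (a < e ↔ (p ↔ s)))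
    (h4 : bc ↔ (b < c ↔ (q ↔ r))) (h5 : be ↔ (b < e ↔ (q ↔ s))) (h6 : ce ↔ (c < e ↔ (r ↔ s))) :
    FourGood ab ac ae bc be ce := by
  unfold FourGood at *; grind

end FourGood

/-- No vertex among `a, b, c, e` dominates a cyclic triangle or is dominated by one. -/
def GoodAt {V : Type} (D : V → V → Prop) (a b c e : V) : Prop :=
  FourGood (D a b) (D a c) (D a e) (D b c) (D b e) (D c e)

namespace SimpleGraph

variable {V : Type} {G : SimpleGraph V} {D : V → V → Prop} {a b c e : V}

/-- The four vertices are pairwise adjacent. -/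
structure IsFour (G : SimpleGraph V) (a b c e : V) : Prop where
  ab : G.Adj a b
  ac : G.Adj a c
  ae : G.Adj a e
  bc : G.Adj b c
  be : G.Adj b e
  ce : G.Adj c e

namespace IsFour

theorem swap_fst (h : G.IsFour a b c e) : G.IsFour b a c e :=
  ⟨h.ab.symm, h.bc, h.be, h.ac, h.ae, h.ce⟩

theorem swap_mid (h : G.IsFour a b c e) : G.IsFour a c b e :=
  ⟨h.ac, h.ab, h.ae, h.bc.symm, h.ce, h.be⟩

theorem swap_lst (h : G.IsFour a b c e) : G.IsFour a b e c :=
  ⟨h.ab, h.ae, h.ac, h.be, h.bc, h.ce.symm⟩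

variable (h : G.IsFour a b c e) (hD : G.IsProperOrientation D)
include h hD

theorem good_swap_fst (hg : GoodAt D b a c e) : GoodAt D a b c e := by
  have := hD.iff_not h.ab
  unfold GoodAt FourGood at *; grind

theorem good_swap_mid (hg : GoodAt D a c b e) : GoodAt D a b c e := by
  have := hD.iff_not h.bc
  unfold GoodAt FourGood at *; grind

theorem good_swap_lst (hg : GoodAt D a b e c) : GoodAt D a b c e := by
  have := hD.iff_not h.ce
  unfold GoodAt FourGood at *; grind

end IsFour

end SimpleGraph

/-! ### Least elements of equivalence classes -/

/-- The least element that is related to `x` is smaller than everything that is related to `y`. -/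
def Before {V : Type} [LT V] (S : V → V → Prop) (x y : V) : Prop :=
  ∃ v, S v x ∧ ∀ w, S w y → v < w

/-- Least members serve as names of the classes, so that `Before`, which is a first-order condition,
becomes the order of the names. -/
theorem exists_rep {V : Type} [LinearOrder V] [WellFoundedLT V] {S : V → V → Prop}
    (hS : Equivalence S) : ∃ r : V → V, (∀ x, S (r x) x ∧ ∀ v, S v x → r x ≤ v) ∧
      (∀ x y, r x = r y ↔ S x y) ∧ ∀ x y, Before S x y ↔ r x < r y := by
  have h : ∀ x, ∃ r, S r x ∧ ∀ v, S v x → r ≤ v := by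
    intro x
    obtain ⟨m, hm, hmin⟩ := WellFounded.has_min (wellFounded_lt (α := V)) {v | S v x} ⟨x, hS.refl x⟩
    exact ⟨m, hm, fun v hv => not_lt.1 (hmin v hv)⟩
  choose r hr using h
  refine ⟨r, hr, fun x y => ⟨fun h => ?_, fun h => ?_⟩, fun x y => ⟨?_, fun h => ?_⟩⟩
  · exact hS.trans (hS.symm (hr x).1) (h ▸ (hr y).1)
  · exact le_antisymm ((hr x).2 _ (hS.trans (hr y).1 (hS.symm h)))
      ((hr y).2 _ (hS.trans (hr x).1 h))
  · rintro ⟨v, hv, hlt⟩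
    exact ((hr x).2 v hv).trans_lt (hlt _ (hr y).1)
  · exact ⟨r x, (hr x).1, fun w hw => h.trans_le ((hr y).2 w hw)⟩

/-! ### The canonical completion -/

namespace PartiallyOrientedGraph

variable {V : Type} (P : PartiallyOrientedGraph V)

/-- `v` and `x` are in one co-component, or joined by an arc. -/
def Linked (v x : V) : Prop := P.underlyingGraph.CoConnected v x ∨ P.Oriented v x

/-- `v` and `x` are equal, or twins joined by an arc. -/
def TwinLinked (v x : V) : Prop := v = x ∨ (P.underlyingGraph.Twins v x ∧ P.Oriented v x)

/-- `x` is an out-neighbour of the least vertex `r` linked to it, or is in the co-component of `r`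
and on the same side. -/
def Positive [LE V] (x : V) : Prop :=
  ∃ r, (P.Linked r x ∧ ∀ v, P.Linked v x → r ≤ v) ∧
    ((¬ P.underlyingGraph.CoConnected r x ∧ P.arc r x) ∨
      (P.underlyingGraph.CoConnected r x ∧ ∃ z, P.underlyingGraph.Adj z x ∧
        ¬ P.underlyingGraph.CoConnected z x ∧ P.underlyingGraph.Forced (z, r) (z, x)))

/-- `(x, y)` is forced by the lexicographically least pair of its class. -/
def Leading [LinearOrder V] (x y : V) : Prop :=
  ∃ u v, P.underlyingGraph.Adj u v ∧ P.underlyingGraph.Forced (u, v) (x, y) ∧ ∀ u' v', P.underlyingGraph.Adj u' v' →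
    P.underlyingGraph.SameClass (u', v') (x, y) → toLex (u, v) ≤ toLex (u', v')

/-- The arcs of the canonical completion of `P`. -/
def canonicalArc [LinearOrder V] (x y : V) : Prop :=
  P.underlyingGraph.Adj x y ∧ (P.arc x y ∨ (¬ P.arc y x ∧
    ((¬ P.underlyingGraph.CoConnected x y ∧
        (Before P.Linked x y ↔ (P.Positive x ↔ P.Positive y))) ∨
      (P.underlyingGraph.CoConnected x y ∧ P.underlyingGraph.Twins x y ∧
        Before P.TwinLinked x y) ∨
      (P.underlyingGraph.CoConnected x y ∧ ¬ P.underlyingGraph.Twins x y ∧ P.Leading x y))))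

/-- The consequences of friendliness for `P` with a completion. -/
structure IsTame : Prop where
  forced : ∀ ⦃x y u v⦄, P.underlyingGraph.Adj x y → P.underlyingGraph.Forced (x, y) (u, v) →
    (P.arc x y ↔ P.arc u v)
  triangle : ∀ ⦃x y z⦄, P.underlyingGraph.Adj x y → P.underlyingGraph.Adj y z →
    P.underlyingGraph.Adj z x → ¬ P.underlyingGraph.SameClass (x, y) (y, z) →
    ¬ P.underlyingGraph.SameClass (y, z) (z, x) → ¬ P.underlyingGraph.SameClass (z, x) (x, y) →
    P.Oriented x y → P.Oriented y z → P.Oriented z x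

/-- The arcs of a completion of `P` to a locally transitive local tournament. -/
structure IsGoodOrientation (D : V → V → Prop) : Prop where
  proper : P.underlyingGraph.IsProperOrientation D
  of_arc : ∀ ⦃x y⦄, P.arc x y → D x y
  good : ∀ ⦃a b c e⦄, P.underlyingGraph.IsFour a b c e → GoodAt D a b c e

variable {P}

theorem Oriented.adj {x y : V} (h : P.Oriented x y) : P.underlyingGraph.Adj x y := Or.inr h

theorem Oriented.symm {x y : V} (h : P.Oriented x y) : P.Oriented y x := Or.symm h

/-! ### Linked vertices and linked twins form equivalence classes -/

namespace IsTame

variable (hP : P.IsTame)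
include hP

theorem sameClass {x y u v : V} (h : P.underlyingGraph.Adj x y)
    (hs : P.underlyingGraph.SameClass (x, y) (u, v)) : P.Oriented x y ↔ P.Oriented u v := by
  have key : ∀ u v, P.underlyingGraph.Forced (x, y) (u, v) →
      (P.Oriented x y ↔ P.Oriented u v) := by
    intro u v hf
    have h1 := hP.forced h hf
    have h2 := hP.forced h.symm hf.swap
    simp only [Oriented]
    rw [h1, h2]
  rcases hs with hs | hs
  · exact key _ _ hs
  · exact (key _ _ hs).trans ⟨Oriented.symm, Oriented.symm⟩

theorem oriented_of_coConnected {x y z : V} (hxy : P.underlyingGraph.CoConnected x y)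
    (h : P.Oriented z x) (hzx : ¬ P.underlyingGraph.CoConnected z x) : P.Oriented z y :=
  (hP.sameClass h.adj (hxy.sameClass h.adj hzx).2).1 h

/-- The vertices lie in three different co-components, and forcing preserves the pair of
co-components of an edge. So the edges are in three different classes, and a missing third arc would
make a bad triple. -/
theorem oriented_trans {x y z : V} (hxy : ¬ P.underlyingGraph.CoConnected x y)
    (hyz : ¬ P.underlyingGraph.CoConnected y z) (hxz : ¬ P.underlyingGraph.CoConnected x z)
    (h : P.Oriented x y) (h' : P.Oriented y z) : P.Oriented x z := by
  have hzx : P.underlyingGraph.Adj z x := (SimpleGraph.adj_of_not_coConnected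
    (h.adj.reachable.trans h'.adj.reachable) hxz).symm
  refine (hP.triangle h.adj h'.adj hzx ?_ ?_ ?_ h h').symm <;> intro hs
  · rcases hs.coConnected h.adj with ⟨h1, -⟩ | ⟨h1, -⟩
    · exact hxy h1
    · exact hxz h1
  · rcases hs.coConnected h'.adj with ⟨h1, -⟩ | ⟨h1, -⟩
    · exact hyz h1
    · exact hxy h1.symm
  · rcases hs.coConnected hzx with ⟨h1, -⟩ | ⟨h1, -⟩
    · exact hxz h1.symm
    · exact hyz h1.symm

theorem linked_equivalence : Equivalence P.Linked where
  refl x := Or.inl (SimpleGraph.CoConnected.refl x)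
  symm h := h.imp SimpleGraph.CoConnected.symm Oriented.symm
  trans := by
    have aux : ∀ {u v w}, P.underlyingGraph.CoConnected u v → P.Oriented v w → P.Linked u w := by
      -- Unless `w` is in the co-component of `u` and `v`, the edges from `w` to that co-component
      -- form one class, so one arc among them makes all of them arcs.
      intro u v w h1 h2
      by_cases h3 : P.underlyingGraph.CoConnected u w
      · exact Or.inl h3
      · exact Or.inr (hP.oriented_of_coConnected h1.symm h2.symm
          fun h => h3 (h1.trans h.symm)).symm
    intro u v w h1 h2
    rcases h1 with h1 | h1 <;> rcases h2 with h2 | h2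
    · exact Or.inl (h1.trans h2)
    · exact aux h1 h2
    · exact (aux h2.symm h1.symm).imp SimpleGraph.CoConnected.symm Oriented.symm
    · by_cases c1 : P.underlyingGraph.CoConnected u v
      · exact aux c1 h2
      by_cases c2 : P.underlyingGraph.CoConnected v w
      · exact (aux c2.symm h1.symm).imp SimpleGraph.CoConnected.symm Oriented.symm
      by_cases c3 : P.underlyingGraph.CoConnected u w
      · exact Or.inl c3
      exact Or.inr (hP.oriented_trans c1 c2 c3 h1 h2)

theorem twinLinked_equivalence : Equivalence P.TwinLinked where
  refl x := Or.inl rfl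
  symm h := h.imp Eq.symm fun h => ⟨h.1.symm, h.2.symm⟩
  trans := by
    intro u v w h1 h2
    rcases h1 with rfl | ⟨t1, o1⟩
    · exact h2
    rcases h2 with rfl | ⟨t2, o2⟩
    · exact Or.inr ⟨t1, o1⟩
    by_cases huw : u = w
    · exact Or.inl huw
    have hwu : P.underlyingGraph.Adj w u :=
      ((t2 u o1.adj.ne huw).1 o1.adj).symm
    have t3 : P.underlyingGraph.Twins u w := SimpleGraph.Twins.trans o1.adj o2.adj t1 t2
    have huv := o1.adj.ne
    have hvw := o2.adj.ne
    -- Each of the three edges joins twins and so is a class by itself.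
    refine Or.inr ⟨t3, (hP.triangle o1.adj o2.adj hwu ?_ ?_ ?_ o1 o2).symm⟩
    · rintro (h | h)
      · exact huv (congrArg Prod.fst (t1.eq_of_forced h)).symm
      · exact huw (congrArg Prod.fst (t1.eq_of_forced h)).symm
    · rintro (h | h)
      · exact hvw (congrArg Prod.fst (t2.eq_of_forced h)).symm
      · exact huv (congrArg Prod.fst (t2.eq_of_forced h))
    · rintro (h | h)
      · exact huw (congrArg Prod.fst (t3.symm.eq_of_forced h))
      · exact hvw (congrArg Prod.fst (t3.symm.eq_of_forced h))

end IsTame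

/-! ### The canonical orientation case by case -/

section Canonical

variable [LinearOrder V] {x y : V}

theorem canonicalArc_of_arc (h : P.arc x y) : P.canonicalArc x y := ⟨Or.inr (Or.inl h), Or.inl h⟩

theorem not_canonicalArc_of_arc (h : P.arc y x) : ¬ P.canonicalArc x y := fun h' =>
  h'.2.elim (P.asymm _ _ h) fun h'' => h''.1 h

theorem canonicalArc_of_not_coConnected (h : P.underlyingGraph.Adj x y) (ho : ¬ P.Oriented x y)
    (hc : ¬ P.underlyingGraph.CoConnected x y) :
    P.canonicalArc x y ↔ (Before P.Linked x y ↔ (P.Positive x ↔ P.Positive y)) := by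
  have h1 : ¬ P.arc x y := fun h => ho (Or.inl h)
  have h2 : ¬ P.arc y x := fun h => ho (Or.inr h)
  simp [canonicalArc, h, h1, h2, hc]

theorem canonicalArc_of_twins (h : P.underlyingGraph.Adj x y) (ho : ¬ P.Oriented x y)
    (hc : P.underlyingGraph.CoConnected x y) (ht : P.underlyingGraph.Twins x y) :
    P.canonicalArc x y ↔ Before P.TwinLinked x y := by
  have h1 : ¬ P.arc x y := fun h => ho (Or.inl h)
  have h2 : ¬ P.arc y x := fun h => ho (Or.inr h)
  simp [canonicalArc, h, h1, h2, hc, ht]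

theorem canonicalArc_of_not_twins (h : P.underlyingGraph.Adj x y) (ho : ¬ P.Oriented x y)
    (hc : P.underlyingGraph.CoConnected x y) (ht : ¬ P.underlyingGraph.Twins x y) :
    P.canonicalArc x y ↔ P.Leading x y := by
  have h1 : ¬ P.arc x y := fun h => ho (Or.inl h)
  have h2 : ¬ P.arc y x := fun h => ho (Or.inr h)
  simp [canonicalArc, h, h1, h2, hc, ht]

theorem canonicalArc_of_oriented {D : V → V → Prop} (hD : P.IsGoodOrientation D)
    (ho : P.Oriented x y) : P.canonicalArc x y ↔ D x y := by
  rcases ho with h | h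
  · exact iff_of_true (canonicalArc_of_arc h) (hD.of_arc h)
  · exact iff_of_false (not_canonicalArc_of_arc h)
      ((hD.proper.iff_not (Oriented.adj (Or.inl h))).1 (hD.of_arc h))

theorem leading_of_forced {u v : V} (h : P.underlyingGraph.Adj x y)
    (hf : P.underlyingGraph.Forced (x, y) (u, v)) (hl : P.Leading x y) : P.Leading u v := by
  obtain ⟨p, q, hpq, h1, h2⟩ := hl
  refine ⟨p, q, hpq, h1.trans hf, fun u' v' ha hs => h2 u' v' ha (hs.trans (Or.inl (hf.symm h)))⟩

/-- The least pair of the class forces `(x, y)` or `(y, x)`, by the meaning of a class. It cannot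
force both, since `D` is constant along forcing. -/
theorem leading_iff_not [WellFoundedLT V] {D : V → V → Prop}
    (hD : P.underlyingGraph.IsProperOrientation D) (h : P.underlyingGraph.Adj x y) :
    P.Leading x y ↔ ¬ P.Leading y x := by
  obtain ⟨m, ⟨hm1, hm2⟩, hmin⟩ := WellFounded.has_min (wellFounded_lt (α := V ×ₗ V))
    {m | P.underlyingGraph.Adj (ofLex m).1 (ofLex m).2 ∧
      P.underlyingGraph.SameClass (ofLex m) (x, y)} ⟨toLex (x, y), h, SimpleGraph.SameClass.refl _⟩
  have hle : ∀ u' v', P.underlyingGraph.Adj u' v' →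
      P.underlyingGraph.SameClass (u', v') (x, y) → m ≤ toLex (u', v') :=
    fun u' v' h1 h2 => not_lt.1 (hmin (toLex (u', v')) ⟨h1, h2⟩)
  have hlead : ∀ u v, P.underlyingGraph.SameClass (x, y) (u, v) →
      P.underlyingGraph.SameClass (u, v) (x, y) →
      (P.Leading u v ↔ P.underlyingGraph.Forced (ofLex m) (u, v)) := by
    intro u v hs hs'
    constructor
    · rintro ⟨p, q, hpq, h1, h2⟩
      have : toLex (p, q) = m := le_antisymm (h2 _ _ hm1 (hm2.trans hs))
        (hle _ _ hpq (SimpleGraph.SameClass.trans (Or.inl h1) hs'))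
      rw [← this]
      exact h1
    · intro hf
      exact ⟨_, _, hm1, hf, fun u' v' h1 h2 => hle u' v' h1 (h2.trans hs')⟩
  rw [hlead x y (SimpleGraph.SameClass.refl _) (SimpleGraph.SameClass.refl _),
    hlead y x (SimpleGraph.SameClass.refl (x, y)).swap_right
      (SimpleGraph.SameClass.refl (x, y)).swap_left]
  constructor
  · intro h1 h2
    have e1 := hD.forced h1 hm1
    have e2 := hD.forced h2 hm1
    have e3 := hD.iff_not h
    simp only at e1 e2
    tauto
  · intro h1
    exact hm2.resolve_right h1

end Canonical

end PartiallyOrientedGraph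

namespace PartiallyOrientedGraph

section

variable {k l p q r s x y z : Prop}

theorem iff_aux₁ : ((k ↔ (p ↔ r)) ↔ (k ↔ (q ↔ r))) ↔ ((l ↔ (p ↔ s)) ↔ (l ↔ (q ↔ s))) := by
  grind

theorem iff_aux₂ (h : p ↔ (x ↔ y)) (h' : z ↔ ¬ x) : p ↔ (y ↔ ¬ z) := by grind

theorem iff_aux₃ : (k ↔ (p ↔ q)) ↔ ((k ↔ q) ↔ p) := by grind

theorem iff_aux₄ (h : p ↔ x) (h' : y ↔ ¬ x) : (k ↔ (p ↔ q)) ↔ ((k ↔ ¬ q) ↔ y) := by grind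

end

variable {V : Type} {P : PartiallyOrientedGraph V} [LinearOrder V]

/-! ### The sign of a vertex, read off from any good orientation -/

section Positive

variable {D : V → V → Prop} {r x y z : V}

/-- The observer in the definition of the sign can be replaced by any `z` outside the co-component,
by `same_side_iff`; so the sign becomes a statement about `D`. -/
theorem positive_iff_of_coConnected (hD : P.IsGoodOrientation D)
    (hr : P.Linked r x ∧ ∀ v, P.Linked v x → r ≤ v) (hrx : P.underlyingGraph.CoConnected r x)
    (hz : P.underlyingGraph.Adj z x) (hzx : ¬ P.underlyingGraph.CoConnected z x) :
    P.Positive x ↔ (D z x ↔ D z r) := by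
  constructor
  · rintro ⟨r', hr', h⟩
    obtain rfl : r' = r := le_antisymm (hr'.2 _ hr.1) (hr.2 _ hr'.1)
    rcases h with ⟨h, -⟩ | ⟨-, w, hw, hwx, hf⟩
    · exact absurd hrx h
    · have hwr := (hrx.symm.sameClass hw hwx).1
      have := hD.proper.forced hf hwr
      rw [hD.proper.same_side_iff hD.proper hrx.symm hz hzx hw hwx]
      exact this.symm
  · intro h
    refine ⟨r, hr, Or.inr ⟨hrx, z, hz, hzx, ?_⟩⟩
    obtain ⟨hzr, hs⟩ := hrx.symm.sameClass hz hzx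
    rcases hs.symm hz with hs | hs
    · exact hs
    · have e1 := hD.proper.forced hs hzr
      have e2 := hD.proper.iff_not hz
      simp only [Prod.fst_swap, Prod.snd_swap] at e1
      tauto

theorem positive_iff_of_not_coConnected (hD : P.IsGoodOrientation D)
    (hr : P.Linked r x ∧ ∀ v, P.Linked v x → r ≤ v) (hrx : ¬ P.underlyingGraph.CoConnected r x) :
    P.Positive x ↔ D r x := by
  have ho : P.Oriented r x := hr.1.resolve_left hrx
  constructor
  · rintro ⟨r', hr', h⟩
    obtain rfl : r' = r := le_antisymm (hr'.2 _ hr.1) (hr.2 _ hr'.1)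
    rcases h with ⟨-, h⟩ | ⟨h, -⟩
    · exact hD.of_arc h
    · exact absurd h hrx
  · intro h
    refine ⟨r, hr, Or.inl ⟨hrx, ho.resolve_right fun h' => ?_⟩⟩
    exact (hD.proper.iff_not ho.adj).1 h (hD.of_arc h')

/-- Both vertices have the same least linked vertex. The orientation `D` puts them on opposite
sides, as seen from `x` if that least vertex is in their co-component, and as seen from the least
vertex itself otherwise. -/
theorem positive_iff_not (hP : P.IsTame) [WellFoundedLT V] (hD : P.IsGoodOrientation D)
    (hy : P.underlyingGraph.Adj x y) (hz : P.underlyingGraph.Adj x z)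
    (hyz : P.underlyingGraph.Apart y z) (hc : ¬ P.underlyingGraph.CoConnected x y) :
    P.Positive y ↔ ¬ P.Positive z := by
  obtain ⟨r, hr, hreq, -⟩ := exists_rep hP.linked_equivalence
  have hcyz := SimpleGraph.coConnected_of_apart hy hz hyz
  have hrz := hr z
  rw [← (hreq y z).2 (Or.inl hcyz)] at hrz
  have hxz : ¬ P.underlyingGraph.CoConnected x z := fun h => hc (h.trans hcyz.symm)
  have hflip := hD.proper.flip hy hz hyz
  have hxz' := hD.proper.iff_not hz
  by_cases hry : P.underlyingGraph.CoConnected (r y) y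
  · rw [positive_iff_of_coConnected hD (hr y) hry hy hc,
      positive_iff_of_coConnected hD hrz (hry.trans hcyz) hz hxz]
    tauto
  · have hrz' : ¬ P.underlyingGraph.CoConnected (r y) z := fun h => hry (h.trans hcyz.symm)
    have a1 := ((hr y).1.resolve_left hry).adj
    have a2 := (hrz.1.resolve_left hrz').adj
    rw [positive_iff_of_not_coConnected hD (hr y) hry,
      positive_iff_of_not_coConnected hD hrz hrz', hD.proper.flip a1 a2 hyz,
      hD.proper.iff_not a2.symm]

end Positive

/-! ### The canonical orientation respects the forcing -/

section Proper

variable [WellFoundedLT V] {D : V → V → Prop}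

theorem canonicalArc_iff_not (hP : P.IsTame) (hD : P.IsGoodOrientation D) {x y : V}
    (h : P.underlyingGraph.Adj x y) : P.canonicalArc x y ↔ ¬ P.canonicalArc y x := by
  by_cases ho : P.Oriented x y
  · rw [canonicalArc_of_oriented hD ho, canonicalArc_of_oriented hD ho.symm]
    exact hD.proper.iff_not h
  have ho' : ¬ P.Oriented y x := fun h => ho h.symm
  by_cases hc : P.underlyingGraph.CoConnected x y
  · by_cases ht : P.underlyingGraph.Twins x y
    · obtain ⟨r, hr, hreq, hlt⟩ := exists_rep hP.twinLinked_equivalence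
      rw [canonicalArc_of_twins h ho hc ht, canonicalArc_of_twins h.symm ho' hc.symm ht.symm,
        hlt, hlt, not_lt]
      have : r x ≠ r y := fun h' => ((hreq x y).1 h').elim h.ne fun h => ho h.2
      exact ⟨le_of_lt, fun h => lt_of_le_of_ne h this⟩
    · have ht' : ¬ P.underlyingGraph.Twins y x := fun h => ht h.symm
      rw [canonicalArc_of_not_twins h ho hc ht, canonicalArc_of_not_twins h.symm ho' hc.symm ht']
      exact leading_iff_not hD.proper h
  · have hc' : ¬ P.underlyingGraph.CoConnected y x := fun h => hc h.symm
    obtain ⟨r, hr, hreq, hlt⟩ := exists_rep hP.linked_equivalence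
    rw [canonicalArc_of_not_coConnected h ho hc, canonicalArc_of_not_coConnected h.symm ho' hc',
      hlt, hlt]
    have : r x ≠ r y := fun h' => ((hreq x y).1 h').elim hc ho
    rcases lt_or_gt_of_ne this with h1 | h1
    · simp only [h1, h1.not_gt]; tauto
    · simp only [h1, h1.not_gt]; tauto

/-- The edges `xy` and `zx` are in one class, so both or neither are oriented in `P`. If unoriented
inside a co-component, they are not twin edges, and leading pairs are closed under forcing. Between
co-components, `y` and `z` have the same representative and opposite signs. -/
theorem canonicalArc_flip (hP : P.IsTame) (hD : P.IsGoodOrientation D) {x y z : V}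
    (hy : P.underlyingGraph.Adj x y) (hz : P.underlyingGraph.Adj x z)
    (hyz : P.underlyingGraph.Apart y z) : P.canonicalArc x y ↔ P.canonicalArc z x := by
  have hf : P.underlyingGraph.Forced (x, y) (z, x) := SimpleGraph.Forced.left hz hyz
  have ho := hP.sameClass hy (Or.inl hf)
  by_cases hoy : P.Oriented x y
  · rw [canonicalArc_of_oriented hD hoy, canonicalArc_of_oriented hD (ho.1 hoy)]
    exact hD.proper.flip hy hz hyz
  have hoz := fun h => hoy (ho.2 h)
  have hcyz := SimpleGraph.coConnected_of_apart hy hz hyz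
  by_cases hc : P.underlyingGraph.CoConnected x y
  · have hc' : P.underlyingGraph.CoConnected z x := (hc.trans hcyz).symm
    have ht : ¬ P.underlyingGraph.Twins x y := fun h =>
      hyz.2 ((h z hz.ne' hyz.1.symm).1 hz.symm).symm
    have ht' : ¬ P.underlyingGraph.Twins z x := fun h =>
      hyz.2 ((h y hyz.1 hy.ne').2 hy.symm)
    rw [canonicalArc_of_not_twins hy hoy hc ht, canonicalArc_of_not_twins hz.symm hoz hc' ht']
    exact ⟨leading_of_forced hy hf, leading_of_forced hz.symm (hf.symm hy)⟩
  · have hc' : ¬ P.underlyingGraph.CoConnected z x := fun h => hc (h.symm.trans hcyz.symm)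
    obtain ⟨r, hr, hreq, hlt⟩ := exists_rep hP.linked_equivalence
    rw [canonicalArc_of_not_coConnected hy hoy hc, canonicalArc_of_not_coConnected hz.symm hoz hc',
      hlt, hlt, (hreq y z).2 (Or.inl hcyz), positive_iff_not hP hD hy hz hyz hc]
    have : r z ≠ r x := fun h' => ((hreq z x).1 h').elim hc' hoz
    rcases lt_or_gt_of_ne this with h1 | h1
    · simp only [h1, h1.not_gt]; tauto
    · simp only [h1, h1.not_gt]; tauto

theorem canonicalArc_isProperOrientation (hP : P.IsTame) (hD : P.IsGoodOrientation D) :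
    P.underlyingGraph.IsProperOrientation P.canonicalArc where
  iff_not _ _ h := canonicalArc_iff_not hP hD h
  flip _ _ _ hy hz hyz := canonicalArc_flip hP hD hy hz hyz

end Proper

/-! ### The canonical orientation is good on four pairwise adjacent vertices -/

section Good

variable [WellFoundedLT V] {D : V → V → Prop} (hP : P.IsTame) (hD : P.IsGoodOrientation D)
  {a b c e : V}
include hP hD

/-- If all three twins are in one linked block, their arcs are those of `D`; an outside vertex `u`
sees them alike in `D`, so a cycle would be forbidden there. Otherwise arcs between different blocks
follow the order of the blocks, which rules out a cycle. -/
theorem not_cyclic_of_twins (hab : P.underlyingGraph.Adj a b) (hbc : P.underlyingGraph.Adj b c)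
    (hac : P.underlyingGraph.Adj a c) (tab : P.underlyingGraph.Twins a b)
    (tbc : P.underlyingGraph.Twins b c) (h : P.underlyingGraph.CoConnected a b)
    (h' : P.underlyingGraph.CoConnected a c) :
    ¬ ((P.canonicalArc a b ↔ P.canonicalArc b c) ∧
      (P.canonicalArc a b ↔ ¬ P.canonicalArc a c)) := by
  have tac := tab.trans hab hbc tbc
  obtain ⟨r, hr, hreq, hlt⟩ := exists_rep hP.twinLinked_equivalence
  have key : ∀ {x y}, P.underlyingGraph.Adj x y → P.underlyingGraph.CoConnected x y →
      P.underlyingGraph.Twins x y → (r x = r y → P.Oriented x y) ∧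
        (r x ≠ r y → (P.canonicalArc x y ↔ r x < r y)) := by
    intro x y h1 h2 h3
    refine ⟨fun h4 => (((hreq x y).1 h4).resolve_left h1.ne).2, fun h4 => ?_⟩
    rw [canonicalArc_of_twins h1 (fun ho => h4 ((hreq x y).2 (Or.inr ⟨h3, ho⟩))) h2 h3, hlt]
  have eqv : ∀ {x y}, P.Oriented x y → P.underlyingGraph.Twins x y → r x = r y :=
    fun h1 h2 => (hreq _ _).2 (Or.inr ⟨h2, h1⟩)
  have kab := key hab h tab
  have kbc := key hbc (h.symm.trans h') tbc
  have kac := key hac h' tac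
  by_cases e1 : r a = r b
  · by_cases e2 : r b = r c
    · rw [canonicalArc_of_oriented hD (kab.1 e1), canonicalArc_of_oriented hD (kbc.1 e2),
        canonicalArc_of_oriented hD (kac.1 (e1.trans e2))]
      obtain ⟨s, hs, hs'⟩ := h.exists_apart hab.ne
      -- The vertex `v` distinguishes `u` from the twins, so `u` is not a twin of theirs and
      -- `twins_iff` applies.
      obtain ⟨u, v, hua, huv, hva⟩ := SimpleGraph.exists_adj_not_twins hs hs'
      have hub : P.underlyingGraph.Adj u b := by
        have : u ≠ b := by rintro rfl; exact (tab.apart hab hva.symm).2 huv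
        exact (tab u hua.ne this).1 hua
      have huc : P.underlyingGraph.Adj u c := by
        have : u ≠ c := by rintro rfl; exact (tac.apart hac hva.symm).2 huv
        exact (tac u hua.ne this).1 hua
      have hn : ¬ P.underlyingGraph.Twins u a := fun ht =>
        hva.2 ((ht v huv.ne' hva.1).1 huv.symm)
      have e3 := hD.proper.twins_iff hab tab hs hs' hua hub hn
      have e4 := hD.proper.twins_iff hac tac hs hs' hua huc hn
      have hg := hD.good (⟨hab, hac, hua.symm, hbc, hub.symm, huc.symm⟩ :
        P.underlyingGraph.IsFour a b c u)
      rw [hD.proper.iff_not hua, hD.proper.iff_not hub] at e3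
      rw [hD.proper.iff_not hua, hD.proper.iff_not huc] at e4
      unfold GoodAt FourGood at hg
      grind
    · have e3 : r a ≠ r c := e1 ▸ e2
      rw [kbc.2 e2, kac.2 e3, e1]
      tauto
  · by_cases e2 : r b = r c
    · have e3 : r a ≠ r c := e2 ▸ e1
      rw [kab.2 e1, kac.2 e3, e2]
      tauto
    · by_cases e3 : r a = r c
      · rw [kab.2 e1, kbc.2 e2, ← e3]
        have := lt_or_gt_of_ne e1
        grind
      · rw [kab.2 e1, kbc.2 e2, kac.2 e3]
        grind

theorem canonicalArc_twins_iff {x y u : V} (hxy : P.underlyingGraph.Adj x y)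
    (ht : P.underlyingGraph.Twins x y) (hc : P.underlyingGraph.CoConnected x y)
    (hxu : P.underlyingGraph.Adj x u) (hyu : P.underlyingGraph.Adj y u)
    (hn : ¬ P.underlyingGraph.Twins x u) : P.canonicalArc x u ↔ P.canonicalArc y u := by
  have hp := canonicalArc_isProperOrientation hP hD
  obtain ⟨s, hs, hs'⟩ := hc.exists_apart hxy.ne
  rw [hp.iff_not hxu, hp.iff_not hyu,
    hp.twins_iff hxy ht hs hs' hxu.symm hyu.symm fun h => hn h.symm]

/-- Whether `a` and `b` are on one side is the same question seen from `c` as from `e`, by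
`same_side_iff`. -/
theorem good_of_coConnected_pair (h : P.underlyingGraph.IsFour a b c e)
    (hab : P.underlyingGraph.CoConnected a b) (hac : ¬ P.underlyingGraph.CoConnected a c)
    (hae : ¬ P.underlyingGraph.CoConnected a e) : GoodAt P.canonicalArc a b c e := by
  have hp := canonicalArc_isProperOrientation hP hD
  refine FourGood.of_pair ?_
  have := hp.same_side_iff hp hab h.ac.symm (fun h => hac h.symm) h.ae.symm (fun h => hae h.symm)
  rw [hp.iff_not h.ac, hp.iff_not h.bc, hp.iff_not h.ae, hp.iff_not h.be]
  tauto

theorem good_of_twins_pair (h : P.underlyingGraph.IsFour a b c e)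
    (hc : P.underlyingGraph.CoConnected a b) (ht : P.underlyingGraph.Twins a b)
    (hac : ¬ P.underlyingGraph.Twins a c) (hae : ¬ P.underlyingGraph.Twins a e) :
    GoodAt P.canonicalArc a b c e := by
  refine FourGood.of_pair ?_
  rw [canonicalArc_twins_iff hP hD h.ab ht hc h.ac h.bc hac,
    canonicalArc_twins_iff hP hD h.ab ht hc h.ae h.be hae]
  simp

theorem good_of_twins_three (h : P.underlyingGraph.IsFour a b c e)
    (hab : P.underlyingGraph.CoConnected a b) (hac : P.underlyingGraph.CoConnected a c)
    (tab : P.underlyingGraph.Twins a b) (tbc : P.underlyingGraph.Twins b c)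
    (hae : ¬ P.underlyingGraph.Twins a e) : GoodAt P.canonicalArc a b c e := by
  have tac := tab.trans h.ab h.bc tbc
  have e1 := canonicalArc_twins_iff hP hD h.ab tab hab h.ae h.be hae
  have e2 := canonicalArc_twins_iff hP hD h.ac tac hac h.ae h.ce hae
  exact FourGood.of_transitive e1 (e1.symm.trans e2)
    (not_cyclic_of_twins hP hD h.ab h.bc h.ac tab tbc hab hac)

-- Some vertex is apart from `x`. An adjacent twin of `x` is apart from it as well, and would thus
-- belong to the co-component of `x`.
omit hP hD [LinearOrder V] [WellFoundedLT V] in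
theorem not_twins_of_not_coConnected {x y z : V} (hc : P.underlyingGraph.CoConnected x y)
    (hxy : x ≠ y) (hz : P.underlyingGraph.Adj x z) (hxz : ¬ P.underlyingGraph.CoConnected x z) :
    ¬ P.underlyingGraph.Twins x z := by
  intro ht
  obtain ⟨s, hs, hs'⟩ := hc.exists_apart hxy
  have h1 := ht.apart hz hs'
  exact hxz (Relation.ReflTransGen.tail (Relation.ReflTransGen.single ⟨hs, hs'⟩)
    ⟨hs.symm.trans hz.reachable, h1.symm⟩)

/-- Without twins among `a, b, c`, their triangle lies in one class, and so do the edges from it to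
`e`. Hence the orientation differs from `D` at most by reversing the triangle and by switching at
`e`. Twins are seen alike by the remaining vertices. -/
theorem good_of_coConnected_three (h : P.underlyingGraph.IsFour a b c e)
    (hab : P.underlyingGraph.CoConnected a b) (hac : P.underlyingGraph.CoConnected a c)
    (hae : ¬ P.underlyingGraph.CoConnected a e) : GoodAt P.canonicalArc a b c e := by
  have hp := canonicalArc_isProperOrientation hP hD
  have hbc := hab.symm.trans hac
  have hbe : ¬ P.underlyingGraph.CoConnected b e := fun h => hae (hab.trans h)
  have hce : ¬ P.underlyingGraph.CoConnected c e := fun h => hae (hac.trans h)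
  have nta := not_twins_of_not_coConnected hab h.ab.ne h.ae hae
  have ntb := not_twins_of_not_coConnected hbc h.bc.ne h.be hbe
  by_cases tab : P.underlyingGraph.Twins a b
  · by_cases tac : P.underlyingGraph.Twins a c
    · exact good_of_twins_three hP hD h hab hac tab (tab.symm.trans h.ab.symm h.ac tac)
        nta
    · exact good_of_twins_pair hP hD h hab tab tac nta
  by_cases tac : P.underlyingGraph.Twins a c
  · exact h.good_swap_mid hp (good_of_twins_pair hP hD h.swap_mid hac tac tab nta)
  by_cases tbc : P.underlyingGraph.Twins b c
  · exact h.good_swap_fst hp (h.swap_fst.good_swap_mid hp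
      (good_of_twins_pair hP hD h.swap_fst.swap_mid hbc tbc (fun h => tab h.symm) ntb))
  · have s1 := hp.sameClass_of_triangle h.ac h.ab h.bc.symm hab hac tac tab
    have s2 := hp.sameClass_of_triangle h.bc h.ab.symm h.ac.symm hab.symm hbc tbc
      (fun h => tab h.symm)
    have s3 := (hab.sameClass h.ae.symm fun h => hae h.symm).2.swap_left.swap_right
    have s4 := (hac.sameClass h.ae.symm fun h => hae h.symm).2.swap_left.swap_right
    exact FourGood.of_triangle (hD.good h) (hD.proper.sameClass hp s1 h.ab)
      (hD.proper.sameClass hp s2.swap_left h.ab) (hD.proper.sameClass hp s3 h.ae)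
      (hD.proper.sameClass hp s4 h.ae)

/-- As before, twins are seen alike by non-twins, and four mutual twins have no cyclic triangle. If
no two are twins, the edges of the triangle `abc` lie in one class, and so do the edges at `e`,
which allows a comparison with `D`. -/
theorem good_of_coConnected_four (h : P.underlyingGraph.IsFour a b c e)
    (hab : P.underlyingGraph.CoConnected a b) (hac : P.underlyingGraph.CoConnected a c)
    (hae : P.underlyingGraph.CoConnected a e) : GoodAt P.canonicalArc a b c e := by
  have hp := canonicalArc_isProperOrientation hP hD
  have hbc := hab.symm.trans hac
  have hbe := hab.symm.trans hae
  have hce := hac.symm.trans hae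
  by_cases tab : P.underlyingGraph.Twins a b
  · have aux : ∀ {x y z w}, P.underlyingGraph.IsFour x y z w →
        P.underlyingGraph.Twins x y → P.underlyingGraph.Twins x z →
        P.underlyingGraph.Twins y z := fun h h1 h2 => h1.symm.trans h.ab.symm h.ac h2
    by_cases tac : P.underlyingGraph.Twins a c
    · by_cases tae : P.underlyingGraph.Twins a e
      · have t1 := not_cyclic_of_twins hP hD h.ab h.bc h.ac tab (aux h tab tac) hab hac
        have t2 := not_cyclic_of_twins hP hD h.ab h.be h.ae tab (aux h.swap_lst tab tae) hab hae
        have t3 := not_cyclic_of_twins hP hD h.ac h.ce h.ae tac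
          (aux h.swap_mid.swap_lst tac tae) hac hae
        have t4 := not_cyclic_of_twins hP hD h.bc h.ce h.be (aux h tab tac)
          (aux h.swap_mid.swap_lst tac tae) hbc hbe
        unfold GoodAt FourGood
        grind
      · exact good_of_twins_three hP hD h hab hac tab (aux h tab tac) tae
    · by_cases tae : P.underlyingGraph.Twins a e
      · exact h.good_swap_lst hp (good_of_twins_three hP hD h.swap_lst hab hae tab
          (aux h.swap_lst tab tae) tac)
      · exact good_of_twins_pair hP hD h hab tab tac tae
  by_cases tac : P.underlyingGraph.Twins a c
  · by_cases tae : P.underlyingGraph.Twins a e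
    · exact h.good_swap_mid hp (h.swap_mid.good_swap_lst hp
        (good_of_twins_three hP hD h.swap_mid.swap_lst hac hae tac
          (tac.symm.trans h.ac.symm h.ae tae) tab))
    · exact h.good_swap_mid hp (good_of_twins_pair hP hD h.swap_mid hac tac tab tae)
  by_cases tae : P.underlyingGraph.Twins a e
  · exact h.good_swap_lst hp (h.swap_lst.good_swap_mid hp
      (good_of_twins_pair hP hD h.swap_lst.swap_mid hae tae tab tac))
  have tba : ¬ P.underlyingGraph.Twins b a := fun h => tab h.symm
  have tca : ¬ P.underlyingGraph.Twins c a := fun h => tac h.symm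
  have tea : ¬ P.underlyingGraph.Twins e a := fun h => tae h.symm
  by_cases tbc : P.underlyingGraph.Twins b c
  · refine h.good_swap_fst hp (h.swap_fst.good_swap_mid hp ?_)
    by_cases tbe : P.underlyingGraph.Twins b e
    · refine h.swap_fst.swap_mid.good_swap_lst hp ?_
      exact good_of_twins_three hP hD h.swap_fst.swap_mid.swap_lst hbc hbe tbc
        (tbc.symm.trans h.bc.symm h.be tbe) tba
    · exact good_of_twins_pair hP hD h.swap_fst.swap_mid hbc tbc tba tbe
  by_cases tbe : P.underlyingGraph.Twins b e
  · refine h.good_swap_fst hp (h.swap_fst.good_swap_lst hp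
      (h.swap_fst.swap_lst.good_swap_mid hp ?_))
    exact good_of_twins_pair hP hD h.swap_fst.swap_lst.swap_mid hbe tbe tba tbc
  have tcb : ¬ P.underlyingGraph.Twins c b := fun h => tbc h.symm
  have teb : ¬ P.underlyingGraph.Twins e b := fun h => tbe h.symm
  by_cases tce : P.underlyingGraph.Twins c e
  · refine h.good_swap_mid hp (h.swap_mid.good_swap_fst hp
      (h.swap_mid.swap_fst.good_swap_lst hp (h.swap_mid.swap_fst.swap_lst.good_swap_mid hp ?_)))
    exact good_of_twins_pair hP hD h.swap_mid.swap_fst.swap_lst.swap_mid hce tce tca tcb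
  · have tec : ¬ P.underlyingGraph.Twins e c := fun h => tce h.symm
    have s1 := hp.sameClass_of_triangle h.ac h.ab h.bc.symm hab hac tac tab
    have s2 := hp.sameClass_of_triangle h.bc h.ab.symm h.ac.symm hab.symm hbc tbc tba
    have s3 := hp.sameClass_of_triangle h.be.symm h.ae.symm h.ab.symm.symm.symm hae.symm hbe.symm
      teb tea
    have s4 := hp.sameClass_of_triangle h.ce.symm h.ae.symm h.ac.symm.symm.symm hae.symm hce.symm
      tec tea
    exact FourGood.of_triangle (hD.good h) (hD.proper.sameClass hp s1 h.ab)
      (hD.proper.sameClass hp s2.swap_left h.ab)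
      (hD.proper.sameClass hp s3.swap_left.swap_right h.ae)
      (hD.proper.sameClass hp s4.swap_left.swap_right h.ae)

/-- The cases are the coincidences between link representatives. Four equal ones give arcs of `D`,
and four distinct ones a switched linear order. Two vertices whose common representative differs
from the other two are treated alike up to sign. If exactly three agree, their arcs to the fourth
vertex copy, up to switching, arcs of `D` at the representative. -/
theorem good_of_not_coConnected (h : P.underlyingGraph.IsFour a b c e)
    (hab : ¬ P.underlyingGraph.CoConnected a b) (hac : ¬ P.underlyingGraph.CoConnected a c)
    (hae : ¬ P.underlyingGraph.CoConnected a e) (hbc : ¬ P.underlyingGraph.CoConnected b c)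
    (hbe : ¬ P.underlyingGraph.CoConnected b e) (hce : ¬ P.underlyingGraph.CoConnected c e) :
    GoodAt P.canonicalArc a b c e := by
  have hp := canonicalArc_isProperOrientation hP hD
  obtain ⟨r, hr, hreq, hlt⟩ := exists_rep hP.linked_equivalence
  have ori : ∀ {x y}, ¬ P.underlyingGraph.CoConnected x y → r x = r y →
      (P.canonicalArc x y ↔ D x y) := fun h1 h2 =>
    canonicalArc_of_oriented hD (((hreq _ _).1 h2).resolve_left h1)
  have une : ∀ {x y}, ¬ P.underlyingGraph.CoConnected x y → r x ≠ r y →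
      P.underlyingGraph.Adj x y →
      (P.canonicalArc x y ↔ (r x < r y ↔ (P.Positive x ↔ P.Positive y))) := fun h1 h2 h3 => by
    rw [canonicalArc_of_not_coConnected h3 (fun h => h2 ((hreq _ _).2 (Or.inr h))) h1, hlt]
  have pair : ∀ {a b c e}, P.underlyingGraph.IsFour a b c e →
      ¬ P.underlyingGraph.CoConnected a c → ¬ P.underlyingGraph.CoConnected a e →
      ¬ P.underlyingGraph.CoConnected b c → ¬ P.underlyingGraph.CoConnected b e →
      r a = r b → r a ≠ r c → r a ≠ r e → GoodAt P.canonicalArc a b c e := by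
    intro a b c e h hac hae hbc hbe h1 h2 h3
    refine FourGood.of_pair ?_
    rw [une hac h2 h.ac, une hae h3 h.ae, une hbc (h1 ▸ h2) h.bc, une hbe (h1 ▸ h3) h.be, h1]
    exact iff_aux₁
  have three : ∀ {a b c e}, P.underlyingGraph.IsFour a b c e →
      ¬ P.underlyingGraph.CoConnected a b → ¬ P.underlyingGraph.CoConnected a c →
      ¬ P.underlyingGraph.CoConnected b c → ¬ P.underlyingGraph.CoConnected a e →
      ¬ P.underlyingGraph.CoConnected b e → ¬ P.underlyingGraph.CoConnected c e →
      r a = r b → r a = r c → r a ≠ r e → GoodAt P.canonicalArc a b c e := by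
    -- A representative in the co-component of `a` may equal `a` or be apart from it, so it cannot
    -- be the fourth vertex. Its position relative to `a`, seen from `b` and `c`, replaces the
    -- missing arc.
    have side : ∀ {a b c e}, P.underlyingGraph.IsFour a b c e →
        ¬ P.underlyingGraph.CoConnected a b → ¬ P.underlyingGraph.CoConnected a c →
        ¬ P.underlyingGraph.CoConnected b c → ¬ P.underlyingGraph.CoConnected a e →
        ¬ P.underlyingGraph.CoConnected b e → ¬ P.underlyingGraph.CoConnected c e →
        r a = r b → r a = r c → r a ≠ r e → P.underlyingGraph.CoConnected (r a) a →
        GoodAt P.canonicalArc a b c e := by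
      intro a b c e h hab hac hbc hae hbe hce h1 h2 h3 h4
      have h5 : ¬ P.underlyingGraph.CoConnected (r a) b := fun h => hab (h4.symm.trans h)
      have h6 : ¬ P.underlyingGraph.CoConnected (r a) c := fun h => hac (h4.symm.trans h)
      have e1 := positive_iff_of_coConnected hD (hr a) h4 h.ab.symm fun h => hab h.symm
      have e2 := positive_iff_of_coConnected hD (hr a) h4 h.ac.symm fun h => hac h.symm
      have e3 := positive_iff_of_not_coConnected hD (h1 ▸ hr b) h5
      have e4 := positive_iff_of_not_coConnected hD (h2 ▸ hr c) h6
      have b1 := hD.proper.iff_not h.ab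
      have b2 := hD.proper.iff_not h.ac
      have b3 := hD.proper.iff_not
        (h4.symm.sameClass h.ab.symm fun h => hab h.symm).1
      have b4 := hD.proper.iff_not
        (h4.symm.sameClass h.ac.symm fun h => hac h.symm).1
      unfold GoodAt
      rw [ori hab h1, ori hac h2, ori hbc (h1.symm.trans h2)]
      refine FourGood.of_side (s := r a < r e ↔ P.Positive e) (p := P.Positive a)
        (q := P.Positive b) (r := P.Positive c) (br := D b (r a)) (cr := D c (r a)) ?_ ?_ ?_ ?_
        ?_ ?_ ?_
      · exact iff_aux₂ e1 b1
      · exact iff_aux₂ e2 b2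
      · exact e3.trans (iff_not_comm.1 b3)
      · exact e4.trans (iff_not_comm.1 b4)
      · rw [une hae h3 h.ae]; exact iff_aux₃
      · rw [une hbe (h1 ▸ h3) h.be, h1]; exact iff_aux₃
      · rw [une hce (h2 ▸ h3) h.ce, h2]; exact iff_aux₃
    intro a b c e h hab hac hbc hae hbe hce h1 h2 h3
    have hba := fun h => hab (SimpleGraph.CoConnected.symm h)
    have hca := fun h => hac (SimpleGraph.CoConnected.symm h)
    have hcb := fun h => hbc (SimpleGraph.CoConnected.symm h)
    by_cases ca : P.underlyingGraph.CoConnected (r a) a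
    · exact side h hab hac hbc hae hbe hce h1 h2 h3 ca
    by_cases cb : P.underlyingGraph.CoConnected (r b) b
    · exact h.good_swap_fst hp (side h.swap_fst hba hbc hac hbe hae hce h1.symm (h1.symm.trans h2)
        (h1 ▸ h3) cb)
    by_cases cc : P.underlyingGraph.CoConnected (r c) c
    · exact h.good_swap_mid hp (h.swap_mid.good_swap_fst hp (side h.swap_mid.swap_fst hca hcb hab
        hce hae hbe h2.symm (h2.symm.trans h1) (h2 ▸ h3) cc))
    rw [← h1] at cb
    rw [← h2] at cc
    have hrb := h1 ▸ hr b
    have hrc := h2 ▸ hr c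
    have e1 := positive_iff_of_not_coConnected hD (hr a) ca
    have e2 := positive_iff_of_not_coConnected hD hrb cb
    have e3 := positive_iff_of_not_coConnected hD hrc cc
    have a1 := ((hr a).1.resolve_left ca).symm.adj
    have a2 := (hrb.1.resolve_left cb).symm.adj
    have a3 := (hrc.1.resolve_left cc).symm.adj
    have b1 := hD.proper.iff_not a1
    have b2 := hD.proper.iff_not a2
    have b3 := hD.proper.iff_not a3
    unfold GoodAt
    rw [ori hab h1, ori hac h2, ori hbc (h1.symm.trans h2)]
    -- Now the representative is adjacent to all three vertices, and `D` is good on the four of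
    -- them. Signs record arcs from the representative while `of_shadow` uses arcs towards it,
    -- whence the negated sign of `e`.
    refine FourGood.of_shadow (s := r a < r e ↔ ¬ P.Positive e)
      (hD.good (⟨h.ab, h.ac, a1, h.bc, a2, a3⟩ : P.underlyingGraph.IsFour a b c (r a))) ?_ ?_ ?_
    · rw [une hae h3 h.ae]; exact iff_aux₄ e1 b1
    · rw [une hbe (h1 ▸ h3) h.be, ← h1]; exact iff_aux₄ e2 b2
    · rw [une hce (h2 ▸ h3) h.ce, ← h2]; exact iff_aux₄ e3 b3
  have hba := fun h => hab (SimpleGraph.CoConnected.symm h)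
  have hca := fun h => hac (SimpleGraph.CoConnected.symm h)
  have hea := fun h => hae (SimpleGraph.CoConnected.symm h)
  have hcb := fun h => hbc (SimpleGraph.CoConnected.symm h)
  have heb := fun h => hbe (SimpleGraph.CoConnected.symm h)
  have hec := fun h => hce (SimpleGraph.CoConnected.symm h)
  by_cases rab : r a = r b
  · by_cases rac : r a = r c
    · by_cases rae : r a = r e
      · unfold GoodAt
        rw [ori hab rab, ori hac rac, ori hae rae, ori hbc (rab.symm.trans rac),
          ori hbe (rab.symm.trans rae), ori hce (rac.symm.trans rae)]
        exact hD.good h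
      · exact three h hab hac hbc hae hbe hce rab rac rae
    · by_cases rae : r a = r e
      · exact h.good_swap_lst hp (three h.swap_lst hab hae hbe hac hbc hec rab rae rac)
      · exact pair h hac hae hbc hbe rab rac rae
  by_cases rac : r a = r c
  · refine h.good_swap_mid hp ?_
    by_cases rae : r a = r e
    · exact h.swap_mid.good_swap_lst hp (three h.swap_mid.swap_lst hac hae hce hab hcb heb
        rac rae rab)
    · exact pair h.swap_mid hab hae hcb hce rac rab rae
  by_cases rae : r a = r e
  · exact h.good_swap_lst hp (h.swap_lst.good_swap_mid hp (pair h.swap_lst.swap_mid hab hac heb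
      hec rae rab rac))
  by_cases rbc : r b = r c
  · refine h.good_swap_fst hp (h.swap_fst.good_swap_mid hp ?_)
    by_cases rbe : r b = r e
    · exact h.swap_fst.swap_mid.good_swap_lst hp (three h.swap_fst.swap_mid.swap_lst hbc hbe hce
        hba hca hea rbc rbe (Ne.symm rab))
    · exact pair h.swap_fst.swap_mid hba hbe hca hce rbc (Ne.symm rab) rbe
  by_cases rbe : r b = r e
  · exact h.good_swap_fst hp (h.swap_fst.good_swap_lst hp (h.swap_fst.swap_lst.good_swap_mid hp
      (pair h.swap_fst.swap_lst.swap_mid hba hbc hea hec rbe (Ne.symm rab) rbc)))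
  by_cases rce : r c = r e
  · exact h.good_swap_mid hp (h.swap_mid.good_swap_fst hp (h.swap_mid.swap_fst.good_swap_lst hp
      (h.swap_mid.swap_fst.swap_lst.good_swap_mid hp
        (pair h.swap_mid.swap_fst.swap_lst.swap_mid hca hcb hea heb rce (Ne.symm rac)
          (Ne.symm rbc)))))
  exact FourGood.of_linear (une hab rab h.ab) (une hac rac h.ac) (une hae rae h.ae)
    (une hbc rbc h.bc) (une hbe rbe h.be) (une hce rce h.ce)

/-- Goodness does not depend on the order of the vertices. Transpositions bring co-connected ones to
the front and reduce everything to the cases above. -/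
theorem canonicalArc_good (h : P.underlyingGraph.IsFour a b c e) :
    GoodAt P.canonicalArc a b c e := by
  have hp := canonicalArc_isProperOrientation hP hD
  by_cases hab : P.underlyingGraph.CoConnected a b
  · by_cases hac : P.underlyingGraph.CoConnected a c
    · by_cases hae : P.underlyingGraph.CoConnected a e
      · exact good_of_coConnected_four hP hD h hab hac hae
      · exact good_of_coConnected_three hP hD h hab hac hae
    · by_cases hae : P.underlyingGraph.CoConnected a e
      · exact h.good_swap_lst hp (good_of_coConnected_three hP hD h.swap_lst hab hae hac)
      · exact good_of_coConnected_pair hP hD h hab hac hae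
  by_cases hac : P.underlyingGraph.CoConnected a c
  · refine h.good_swap_mid hp ?_
    by_cases hae : P.underlyingGraph.CoConnected a e
    · exact h.swap_mid.good_swap_lst hp
        (good_of_coConnected_three hP hD h.swap_mid.swap_lst hac hae hab)
    · exact good_of_coConnected_pair hP hD h.swap_mid hac hab hae
  by_cases hae : P.underlyingGraph.CoConnected a e
  · exact h.good_swap_lst hp (h.swap_lst.good_swap_mid hp
      (good_of_coConnected_pair hP hD h.swap_lst.swap_mid hae hab hac))
  have hba := fun h => hab (SimpleGraph.CoConnected.symm h)
  have hca := fun h => hac (SimpleGraph.CoConnected.symm h)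
  by_cases hbc : P.underlyingGraph.CoConnected b c
  · refine h.good_swap_fst hp (h.swap_fst.good_swap_mid hp ?_)
    by_cases hbe : P.underlyingGraph.CoConnected b e
    · exact h.swap_fst.swap_mid.good_swap_lst hp
        (good_of_coConnected_three hP hD h.swap_fst.swap_mid.swap_lst hbc hbe hba)
    · exact good_of_coConnected_pair hP hD h.swap_fst.swap_mid hbc hba hbe
  have hcb := fun h => hbc (SimpleGraph.CoConnected.symm h)
  by_cases hbe : P.underlyingGraph.CoConnected b e
  · exact h.good_swap_fst hp (h.swap_fst.good_swap_lst hp (h.swap_fst.swap_lst.good_swap_mid hp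
      (good_of_coConnected_pair hP hD h.swap_fst.swap_lst.swap_mid hbe hba hbc)))
  by_cases hce : P.underlyingGraph.CoConnected c e
  · exact h.good_swap_mid hp (h.swap_mid.good_swap_fst hp (h.swap_mid.swap_fst.good_swap_lst hp
      (h.swap_mid.swap_fst.swap_lst.good_swap_mid hp
        (good_of_coConnected_pair hP hD h.swap_mid.swap_fst.swap_lst.swap_mid hce hca hcb))))
  exact good_of_not_coConnected hP hD h hab hac hae hbc hbe hce

theorem canonicalArc_isGoodOrientation : P.IsGoodOrientation P.canonicalArc where
  proper := canonicalArc_isProperOrientation hP hD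
  of_arc _ _ h := canonicalArc_of_arc h
  good _ _ _ _ h := canonicalArc_good hP hD h

end Good

end PartiallyOrientedGraph

/-! ### Friendly graphs with a completion are tame -/

namespace SimpleGraph

variable {V : Type} {G : SimpleGraph V} {D : V → V → Prop}

theorem auxiliaryGraph_sameClass {a b : G.Dart} (h : G.auxiliaryGraph.Adj a b) :
    G.SameClass a.toProd b.toProd := by
  obtain ⟨⟨a1, a2⟩, ha⟩ := a
  obtain ⟨⟨b1, b2⟩, hb⟩ := b
  obtain ⟨hne, h⟩ := h
  rcases h with ⟨h1, h2⟩ | ⟨h1, h2⟩ | ⟨h1, h2⟩ <;> simp only at h1 h2 ha hb ⊢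
  · subst h1
    have h3 : a2 ≠ b2 := by rintro rfl; exact hne rfl
    exact Or.inr (Forced.left hb ⟨h3, h2⟩)
  · subst h2
    have h3 : a1 ≠ b1 := by rintro rfl; exact hne rfl
    exact Or.inr (Forced.right hb ⟨h3, h1⟩)
  · subst h1 h2
    exact (SameClass.refl _).swap_right

theorem auxiliaryGraph_adj_left {x y z : V} (h : G.Adj x y) (h' : G.Adj x z) (hyz : G.Apart y z) :
    G.auxiliaryGraph.Adj ⟨(x, y), h⟩ ⟨(x, z), h'⟩ :=
  ⟨fun he => hyz.1 (congrArg (fun d : G.Dart => d.snd) he), Or.inl ⟨rfl, hyz.2⟩⟩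

theorem auxiliaryGraph_adj_right {x y z : V} (h : G.Adj y x) (h' : G.Adj z x)
    (hyz : G.Apart y z) : G.auxiliaryGraph.Adj ⟨(y, x), h⟩ ⟨(z, x), h'⟩ :=
  ⟨fun he => hyz.1 (congrArg (fun d : G.Dart => d.fst) he), Or.inr (Or.inl ⟨hyz.2, rfl⟩)⟩

theorem auxiliaryGraph_adj_symm {x y : V} (h : G.Adj x y) :
    G.auxiliaryGraph.Adj ⟨(x, y), h⟩ ⟨(y, x), h.symm⟩ :=
  ⟨fun he => h.ne (congrArg (fun d : G.Dart => d.fst) he), Or.inr (Or.inr ⟨rfl, rfl⟩)⟩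

theorem auxiliaryGraph_reachable_sameClass {a b : G.Dart} (h : G.auxiliaryGraph.Reachable a b) :
    G.SameClass a.toProd b.toProd := by
  rw [reachable_iff_reflTransGen] at h
  induction h with
  | refl => exact SameClass.refl _
  | tail _ h2 ih => exact ih.trans (auxiliaryGraph_sameClass h2)

/-- A forcing step is a path of length two in `G⁺`: replace one end by a vertex apart from it, then
reverse the pair. -/
theorem Forced.auxiliaryGraph_reachable {a b : V × V} (h : G.Forced a b) (ha : G.Adj a.1 a.2) :
    G.auxiliaryGraph.Reachable ⟨a, ha⟩ ⟨b, Forced.adj h ha⟩ := by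
  induction h with
  | refl => exact Reachable.refl _
  | @tail b c h1 h2 ih =>
    refine ih.trans ?_
    have hb := Forced.adj h1 ha
    obtain ⟨b1, b2⟩ := b
    obtain ⟨c1, c2⟩ := c
    rcases h2 with ⟨h3, h4, h5⟩ | ⟨h3, h4, h5⟩ <;> simp only at h3 h4 h5 hb <;> subst h3
    · exact (auxiliaryGraph_adj_left hb h4.symm h5.symm).reachable.trans
        (auxiliaryGraph_adj_symm h4.symm).reachable
    · exact (auxiliaryGraph_adj_right hb h4 h5.symm).reachable.trans
        (auxiliaryGraph_adj_symm h4).reachable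

theorem IsProperOrientation.auxiliaryGraph_adj (hD : G.IsProperOrientation D) {a b : G.Dart}
    (h : G.auxiliaryGraph.Adj a b) : D a.fst a.snd ↔ ¬ D b.fst b.snd := by
  obtain ⟨⟨a1, a2⟩, ha⟩ := a
  obtain ⟨⟨b1, b2⟩, hb⟩ := b
  obtain ⟨hne, h⟩ := h
  rcases h with ⟨h1, h2⟩ | ⟨h1, h2⟩ | ⟨h1, h2⟩ <;> simp only at h1 h2 ha hb ⊢
  · subst h1
    have h3 : a2 ≠ b2 := by rintro rfl; exact hne rfl
    rw [hD.flip ha hb ⟨h3, h2⟩, hD.iff_not hb.symm]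
  · subst h2
    have h3 : a1 ≠ b1 := by rintro rfl; exact hne rfl
    rw [hD.iff_not ha, hD.flip ha.symm hb.symm ⟨h3, h1⟩]
  · subst h1 h2
    exact hD.iff_not ha

/-- The arcs of `D` and their reverses are the two sides of a bipartition of `G⁺`. -/
theorem IsProperOrientation.even_length_iff (hD : G.IsProperOrientation D) {a b : G.Dart}
    (p : G.auxiliaryGraph.Walk a b) : Even p.length ↔ (D a.fst a.snd ↔ D b.fst b.snd) := by
  induction p with
  | nil => simp
  | cons h p ih =>
    rw [Walk.length_cons, Nat.even_add_one, ih, hD.auxiliaryGraph_adj h]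
    tauto

end SimpleGraph

namespace PartiallyOrientedGraph

variable {V : Type} {P : PartiallyOrientedGraph V}

/-- By the bipartition coming from `D`, a pair and one forced by it are at even distance in `G⁺`,
where consentaneity makes both or neither arcs. Pairs in different forcing classes lie in different
components of `G⁺`, so a violation of the triangle condition is a bad triple. -/
theorem isTame_of_isFriendly (hP : P.IsFriendly) {D : V → V → Prop}
    (hD : P.underlyingGraph.IsProperOrientation D) : P.IsTame where
  forced := by
    intro x y u v h hf
    have hr := hf.auxiliaryGraph_reachable h
    obtain ⟨p, hp⟩ := hr.exists_walk_length_eq_dist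
    refine hP.1.2 _ _ hr ?_
    rw [← hp, hD.even_length_iff p]
    exact hD.forced hf h
  triangle := by
    intro x y z hxy hyz hzx h1 h2 h3 o1 o2
    by_contra o3
    exact hP.2 x y z ⟨hxy, hyz, hzx,
      fun h => h1 (SimpleGraph.auxiliaryGraph_reachable_sameClass h),
      fun h => h2 (SimpleGraph.auxiliaryGraph_reachable_sameClass h),
      fun h => h3 (SimpleGraph.auxiliaryGraph_reachable_sameClass h), Or.inl ⟨o1, o2, o3⟩⟩

theorem IsCompletion.isGoodOrientation {D : OrientedGraph V} (hD : P.IsCompletion D)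
    (h1 : D.IsLocalTournament) (h2 : D.IsLocallyTransitive) : P.IsGoodOrientation D.arc where
  of_arc := hD.1
  proper :=
    { iff_not := fun x y h => by
        have := (hD.2 x y).1 h
        have := D.asymm x y
        tauto
      flip := fun x y z hy hz hyz => by
        have a1 := (hD.2 _ _).1 hy
        have a2 := (hD.2 _ _).1 hz
        have a3 := D.asymm x y
        have a4 := D.asymm x z
        have b1 := fun h h' => (h1 x).1 y h z h' hyz.1
        have b2 := fun h h' => (h1 x).2 y h z h' hyz.1
        have b3 : ¬ (D.arc y z ∨ D.arc z y) := fun h => hyz.2 ((hD.2 _ _).2 h)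
        simp only [OrientedGraph.outNeighbours, OrientedGraph.inNeighbours, Set.mem_ofPred_eq]
          at b1 b2
        tauto }
  good := by
    -- Each choice of the apex `a` leaves a triangle with two cyclic orientations, which accounts
    -- for the eight instances below.
    have key : ∀ {a b c e}, ¬ (D.arc a b ∧ D.arc a c ∧ D.arc a e ∧ D.arc b c ∧ D.arc c e ∧
        D.arc e b) ∧ ¬ (D.arc b a ∧ D.arc c a ∧ D.arc e a ∧ D.arc b c ∧ D.arc c e ∧
        D.arc e b) := by
      intro a b c e
      constructor
      · rintro ⟨d1, d2, d3, d4, d5, d6⟩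
        exact D.asymm _ _ d6 ((h2 a).1.2 b d1 c d2 e d3 d4 d5)
      · rintro ⟨d1, d2, d3, d4, d5, d6⟩
        exact D.asymm _ _ d6 ((h2 a).2.2 b d1 c d2 e d3 d4 d5)
    intro a b c e h
    have iff_not : ∀ {x y}, P.underlyingGraph.Adj x y → (D.arc x y ↔ ¬ D.arc y x) := by
      intro x y h
      have := (hD.2 x y).1 h
      have := D.asymm x y
      tauto
    have k1 := @key a b c e
    have k1' := @key a e c b
    have k2 := @key b a c e
    have k2' := @key b e c a
    have k3 := @key c a b e
    have k3' := @key c e b a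
    have k4 := @key e a b c
    have k4' := @key e c b a
    have i1 := iff_not h.ab
    have i2 := iff_not h.ac
    have i3 := iff_not h.ae
    have i4 := iff_not h.bc
    have i5 := iff_not h.be
    have i6 := iff_not h.ce
    unfold GoodAt FourGood
    clear key iff_not h h1 h2 hD
    grind

/-- Apart out-neighbours, or apart in-neighbours, contradict `flip`. A failure of transitivity among
them closes a cyclic triangle, excluded by the first clause of `FourGood` with `v` as apex. -/
theorem IsGoodOrientation.exists_completion {A : V → V → Prop} (hA : P.IsGoodOrientation A)
    (hadj : ∀ x y, A x y → P.underlyingGraph.Adj x y) :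
    ∃ D : OrientedGraph V, D.arc = A ∧ P.IsCompletion D ∧ D.IsLocalTournament ∧
      D.IsLocallyTransitive := by
  have has : ∀ u v, A u v → ¬ A v u := fun u v h => (hA.proper.iff_not (hadj u v h)).1 h
  have hlt : ∀ v, (∀ x, A v x → ∀ y, A v y → x ≠ y → A x y ∨ A y x) ∧
      ∀ x, A x v → ∀ y, A y v → x ≠ y → A x y ∨ A y x := by
    intro v
    have tot : ∀ {x y}, P.underlyingGraph.Adj x y → A x y ∨ A y x := fun {x y} h => by
      have := hA.proper.iff_not h
      tauto
    constructor
    · intro x hx y hy hxy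
      refine tot ?_
      by_contra hn
      exact has _ _ hy ((hA.proper.flip (hadj _ _ hx) (hadj _ _ hy) ⟨hxy, hn⟩).1 hx)
    · intro x hx y hy hxy
      refine tot ?_
      by_contra hn
      exact has _ _ hx ((hA.proper.flip (hadj _ _ hx).symm (hadj _ _ hy).symm ⟨hxy, hn⟩).2 hy)
  refine ⟨⟨A, has⟩, rfl, ⟨hA.of_arc, fun u v => ?_⟩, hlt, fun v => ⟨⟨(hlt v).1, ?_⟩,
    ⟨(hlt v).2, ?_⟩⟩⟩
  · constructor
    · intro h
      have := hA.proper.iff_not h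
      change A u v ∨ A v u
      tauto
    · rintro (h | h)
      · exact hadj _ _ h
      · exact (hadj _ _ h).symm
  · intro x hx y hy z hz hxy hyz
    have hxz : x ≠ z := by rintro rfl; exact has _ _ hxy hyz
    have h1 := (hlt v).1 x hx z hz hxz
    refine h1.resolve_right fun hzx => ?_
    have hg := hA.good (⟨hadj _ _ hx, hadj _ _ hy, hadj _ _ hz, hadj _ _ hxy, (hadj _ _ hzx).symm,
      hadj _ _ hyz⟩ : P.underlyingGraph.IsFour v x y z)
    have := has _ _ hzx
    exact hg.1 ⟨iff_of_true hx hy, iff_of_true hy hz, iff_of_true hxy hyz,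
      iff_of_true hxy this⟩
  · intro x hx y hy z hz hxy hyz
    have hxz : x ≠ z := by rintro rfl; exact has _ _ hxy hyz
    have h1 := (hlt v).2 x hx z hz hxz
    refine h1.resolve_right fun hzx => ?_
    have hg := hA.good (⟨(hadj _ _ hx).symm, (hadj _ _ hy).symm, (hadj _ _ hz).symm, hadj _ _ hxy,
      (hadj _ _ hzx).symm, hadj _ _ hyz⟩ : P.underlyingGraph.IsFour v x y z)
    have := has _ _ hzx
    exact hg.1 ⟨iff_of_false (has _ _ hx) (has _ _ hy), iff_of_false (has _ _ hy) (has _ _ hz),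
      iff_of_true hxy hyz, iff_of_true hxy this⟩

/-- If a friendly graph has a completion to a locally transitive local tournament at all, then the
canonical one is such a completion. -/
theorem IsFriendly.canonical_completion [LinearOrder V] [WellFoundedLT V] (hP : P.IsFriendly)
    {D : OrientedGraph V} (hD : P.IsCompletion D) (h1 : D.IsLocalTournament)
    (h2 : D.IsLocallyTransitive) :
    ∃ D : OrientedGraph V, D.arc = P.canonicalArc ∧ P.IsCompletion D ∧ D.IsLocalTournament ∧
      D.IsLocallyTransitive := by
  have hg := hD.isGoodOrientation h1 h2
  exact (canonicalArc_isGoodOrientation (isTame_of_isFriendly hP hg.proper) hg).exists_completion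
    fun _ _ h => h.1

end PartiallyOrientedGraph

/-! ### Structured programs -/

namespace RAM

/-- The registers and the memory. -/
structure State where
  reg : ℕ → ℕ
  mem : ℕ → ℕ

/-- Set register `r` to `v`. -/
def State.set (s : State) (r v : ℕ) : State := ⟨Function.update s.reg r v, s.mem⟩

/-- The configuration with given program counter. -/
def State.at (s : State) (o : ℕ) : Config := ⟨o, s.reg, s.mem⟩

/-- Structured programs. The command `loop i c` executes `c` for the values `0, …, n - 1` of
register `i`, where `n` is the content of register `0`; it uses register `6`. -/
inductive Cmd where
  | prim (i : Instr)
  | seq (c d : Cmd)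
  | ifZero (r : ℕ) (c d : Cmd)
  | loop (i : ℕ) (c : Cmd)

namespace Cmd

/-- The number of instructions. -/
def len : Cmd → ℕ
  | prim _ => 1
  | seq c d => c.len + d.len
  | ifZero _ c d => d.len + 1 + c.len + 1
  | loop _ c => c.len + 5

/-- The instructions, if the first of them has number `o`. -/
def code : Cmd → ℕ → List Instr
  | prim i, _ => [i]
  | seq c d, o => c.code o ++ d.code (o + c.len)
  | ifZero r c d, o => .jumpIfZero r (o + d.len + 2) ::
      (d.code (o + 1) ++ .jump (o + d.len + 2 + c.len) :: c.code (o + d.len + 2))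
  -- Register `6` holds the truncated difference `n - i`, which vanishes exactly when the loop is
  -- over. The counter grows by the content of register `1`, which has to be `1`.
  | loop i c, o => .const i 0 :: .sub 6 0 i :: .jumpIfZero 6 (o + c.len + 5) ::
      (c.code (o + 3) ++ [.add i i 1, .jump (o + 1)])

theorem length_code (c : Cmd) (o : ℕ) : (c.code o).length = c.len := by
  induction c generalizing o with
  | prim i => rfl
  | seq c d ihc ihd => simp [code, len, ihc, ihd]
  | ifZero r c d ihc ihd => simp [code, len, ihc, ihd]; omega
  | loop i c ih => simp [code, len, ih]

end Cmd

/-- The instructions `l` stand in the program from number `o` on. -/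
def Placed (prog : Program) (o : ℕ) (l : List Instr) : Prop :=
  ∃ p q, prog = p ++ l ++ q ∧ p.length = o

theorem Placed.get {prog : Program} {o : ℕ} {i : Instr} {l : List Instr}
    (h : Placed prog o (i :: l)) : prog[o]? = some i := by
  obtain ⟨p, q, rfl, rfl⟩ := h
  simp

theorem Placed.tail {prog : Program} {o : ℕ} {i : Instr} {l : List Instr}
    (h : Placed prog o (i :: l)) : Placed prog (o + 1) l := by
  obtain ⟨p, q, rfl, rfl⟩ := h
  exact ⟨p ++ [i], q, by simp, by simp⟩

theorem Placed.left {prog : Program} {o : ℕ} {l m : List Instr}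
    (h : Placed prog o (l ++ m)) : Placed prog o l := by
  obtain ⟨p, q, rfl, rfl⟩ := h
  exact ⟨p, m ++ q, by simp, rfl⟩

theorem Placed.right {prog : Program} {o : ℕ} {l m : List Instr}
    (h : Placed prog o (l ++ m)) : Placed prog (o + l.length) m := by
  obtain ⟨p, q, rfl, rfl⟩ := h
  exact ⟨p ++ l, q, by simp, by simp⟩

theorem step_eq {prog : Program} {c : Config} {i : Instr} (h : prog[c.pc]? = some i) :
    step prog c = i.exec c := by
  simp [step, h]

/-- From the state `s`, the command reaches in `t` steps the state `s'`. -/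
def Exec (c : Cmd) (s : State) (t : ℕ) (s' : State) : Prop :=
  ∀ prog o, Placed prog o (c.code o) → (step prog)^[t] (s.at o) = s'.at (o + c.len)

/-- From the state `s`, the command reaches in at most `T` steps a state with the property `Q`. -/
def Ens (c : Cmd) (s : State) (T : ℕ) (Q : State → Prop) : Prop :=
  ∃ t ≤ T, ∃ s', Exec c s t s' ∧ Q s'

/-! ### Time bounds for structured commands -/

namespace Ens

variable {c d : Cmd} {s : State} {T T' : ℕ} {Q Q' : State → Prop}

theorem mono (h : Ens c s T Q) (hT : T ≤ T') (hQ : ∀ s, Q s → Q' s) : Ens c s T' Q' := by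
  obtain ⟨t, ht, s', h1, h2⟩ := h
  exact ⟨t, ht.trans hT, s', h1, hQ _ h2⟩

theorem prim {i : Instr} {s' : State} (h : ∀ o, i.exec (s.at o) = s'.at (o + 1)) (hQ : Q s') :
    Ens (.prim i) s 1 Q := by
  refine ⟨1, le_rfl, s', fun prog o hp => ?_, hQ⟩
  rw [Function.iterate_one, step_eq (c := s.at o) hp.get, h]
  rfl

theorem const {r k : ℕ} (h : Q (s.set r k)) : Ens (.prim (.const r k)) s 1 Q :=
  prim (fun _ => rfl) h

theorem copy {r a : ℕ} (h : Q (s.set r (s.reg a))) : Ens (.prim (.copy r a)) s 1 Q :=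
  prim (fun _ => rfl) h

theorem add {r a b : ℕ} (h : Q (s.set r (s.reg a + s.reg b))) :
    Ens (.prim (.add r a b)) s 1 Q :=
  prim (fun _ => rfl) h

theorem sub {r a b : ℕ} (h : Q (s.set r (s.reg a - s.reg b))) :
    Ens (.prim (.sub r a b)) s 1 Q :=
  prim (fun _ => rfl) h

theorem load {r a : ℕ} (h : Q (s.set r (s.mem (s.reg a)))) : Ens (.prim (.load r a)) s 1 Q :=
  prim (fun _ => rfl) h

theorem store {r a : ℕ} (h : Q ⟨s.reg, Function.update s.mem (s.reg r) (s.reg a)⟩) :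
    Ens (.prim (.store r a)) s 1 Q :=
  prim (fun _ => rfl) h

theorem seq (h : Ens c s T fun s' => Ens d s' T' Q) : Ens (.seq c d) s (T + T') Q := by
  obtain ⟨t, ht, s', h1, t', ht', s'', h2, hQ⟩ := h
  refine ⟨t' + t, by omega, s'', fun prog o hp => ?_, hQ⟩
  have hp2 := hp.right
  rw [Cmd.length_code] at hp2
  rw [Function.iterate_add_apply, h1 prog o hp.left, h2 prog _ hp2, Cmd.len, add_assoc]

theorem ifZero {r : ℕ} (h : s.reg r = 0 → Ens c s T Q) (h' : s.reg r ≠ 0 → Ens d s T Q) :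
    Ens (.ifZero r c d) s (T + 2) Q := by
  by_cases hr : s.reg r = 0
  · obtain ⟨t, ht, s', h1, hQ⟩ := h hr
    refine ⟨t + 1, by omega, s', fun prog o hp => ?_, hQ⟩
    have hp2 := hp.tail.right.tail
    rw [Cmd.length_code] at hp2
    have h2 : step prog (s.at o) = s.at (o + d.len + 2) := by
      rw [step_eq (c := s.at o) hp.get]
      simp [Instr.exec, State.at, hr]
    have h3 := h1 prog (o + d.len + 2) (by convert hp2 using 1; ring)
    rw [Function.iterate_add_apply, Function.iterate_one, h2, h3, Cmd.len]
    congr 1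
    ring
  · obtain ⟨t, ht, s', h1, hQ⟩ := h' hr
    refine ⟨1 + (t + 1), by omega, s', fun prog o hp => ?_, hQ⟩
    have hp2 := hp.tail.right
    rw [Cmd.length_code] at hp2
    have h2 : step prog (s.at o) = s.at (o + 1) := by
      rw [step_eq (c := s.at o) hp.get]
      simp [Instr.exec, State.at, hr]
    rw [Function.iterate_add_apply, Function.iterate_add_apply, Function.iterate_one, h2,
      h1 prog _ hp.tail.left, step_eq (c := s'.at (o + 1 + d.len)) hp2.get, Cmd.len]
    simp only [Instr.exec, State.at, Config.mk.injEq, and_true]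
    ring

/-- `Inv j` describes the state just before the test with counter `j`. Besides the body, a round
costs two steps for the test and two for increment and jump; initialisation and the last test cost
three. -/
theorem loop {i n : ℕ} (Inv : ℕ → State → Prop)
    (hI : ∀ j s, Inv j s → s.reg 0 = n ∧ s.reg i = j) (h0 : Inv 0 (s.set i 0))
    (hstep : ∀ j < n, ∀ s, Inv j s → Ens c (s.set 6 (n - j)) T fun s' =>
      Inv (j + 1) (s'.set i (s'.reg i + s'.reg 1)))
    (hQ : ∀ s, Inv n s → Q (s.set 6 0)) : Ens (.loop i c) s (3 + n * (T + 4)) Q := by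
  -- Induction on the number `m` of remaining rounds, starting at the test, which is instruction `o
  -- + 1`.
  have main : ∀ m j, j + m = n → ∀ s, Inv j s → ∃ t ≤ 2 + m * (T + 4), ∃ s', Q s' ∧
      ∀ prog o, Placed prog o ((Cmd.loop i c).code o) →
        (step prog)^[t] (s.at (o + 1)) = s'.at (o + (Cmd.loop i c).len) := by
    intro m
    induction m with
    | zero =>
      intro j hj s hs
      obtain rfl : j = n := by omega
      obtain ⟨e1, e2⟩ := hI _ _ hs
      refine ⟨2, by omega, s.set 6 0, hQ _ hs, fun prog o hp => ?_⟩
      have h2 : step prog (s.at (o + 1)) = (s.set 6 0).at (o + 2) := by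
        rw [step_eq (c := s.at (o + 1)) hp.tail.get]
        simp [Instr.exec, State.at, State.set, e1, e2]
      have h3 : step prog ((s.set 6 0).at (o + 2)) = (s.set 6 0).at (o + (Cmd.loop i c).len) := by
        rw [step_eq (c := (s.set 6 0).at (o + 2)) hp.tail.tail.get]
        simp [Instr.exec, State.at, State.set, Cmd.len]
        ring
      rw [Function.iterate_succ_apply, h2, Function.iterate_one, h3]
    | succ m ih =>
      intro j hj s hs
      obtain ⟨e1, e2⟩ := hI _ _ hs
      obtain ⟨t, ht, s1, h1, hs1⟩ := hstep j (by omega) s hs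
      obtain ⟨t', ht', s', hQ', h'⟩ := ih (j + 1) (by omega) _ hs1
      refine ⟨t' + (2 + (t + 2)), by
        calc t' + (2 + (t + 2)) ≤ (2 + m * (T + 4)) + (2 + (T + 2)) := by omega
          _ = 2 + (m + 1) * (T + 4) := by ring, s', hQ', fun prog o hp => ?_⟩
      have hpos : n - j ≠ 0 := by omega
      have h2 : step prog (s.at (o + 1)) = (s.set 6 (n - j)).at (o + 2) := by
        rw [step_eq (c := s.at (o + 1)) hp.tail.get]
        simp [Instr.exec, State.at, State.set, e1, e2]
      have h3 : step prog ((s.set 6 (n - j)).at (o + 2)) = (s.set 6 (n - j)).at (o + 3) := by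
        rw [step_eq (c := (s.set 6 (n - j)).at (o + 2)) hp.tail.tail.get]
        simp [Instr.exec, State.at, State.set, hpos]
      have hp3 := hp.tail.tail.tail
      have hp4 := hp3.right
      rw [Cmd.length_code] at hp4
      have h4 := h1 prog (o + 3) hp3.left
      have h5 : step prog (s1.at (o + 3 + c.len)) =
          (s1.set i (s1.reg i + s1.reg 1)).at (o + 3 + c.len + 1) := by
        rw [step_eq (c := s1.at (o + 3 + c.len)) hp4.get]
        rfl
      have h6 : step prog ((s1.set i (s1.reg i + s1.reg 1)).at (o + 3 + c.len + 1)) =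
          (s1.set i (s1.reg i + s1.reg 1)).at (o + 1) := by
        rw [step_eq (c := (s1.set i (s1.reg i + s1.reg 1)).at (o + 3 + c.len + 1)) hp4.tail.get]
        rfl
      have two : ∀ x, (step prog)^[2] x = step prog (step prog x) := fun _ => rfl
      rw [Function.iterate_add_apply, Function.iterate_add_apply, Function.iterate_add_apply,
        two (s.at (o + 1)), h2, h3, h4, two, h5, h6, h' prog o hp]
  obtain ⟨t, ht, s', hQ', h'⟩ := main n 0 (by omega) _ h0
  refine ⟨t + 1, by omega, s', fun prog o hp => ?_, hQ'⟩
  have h2 : step prog (s.at o) = (s.set i 0).at (o + 1) := by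
    rw [step_eq (c := s.at o) hp.get]
    rfl
  rw [Function.iterate_add_apply, Function.iterate_one, h2, h' prog o hp]

end Ens

@[simp] theorem State.set_mem (s : State) (r v : ℕ) : (s.set r v).mem = s.mem := rfl

theorem State.set_reg (s : State) (r v x : ℕ) :
    (s.set r v).reg x = if x = r then v else s.reg x := Function.update_apply ..

@[simp] theorem State.set_reg_self (s : State) (r v : ℕ) : (s.set r v).reg r = v := by
  simp [State.set_reg]

theorem State.set_reg_ne (s : State) {r x : ℕ} (v : ℕ) (h : x ≠ r) :
    (s.set r v).reg x = s.reg x := by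
  simp [State.set_reg, h]

/-! ### Addresses -/

/-- Register `3` := register `3` * `n` + register `v`. -/
def mulAdd (v : ℕ) : Cmd :=
  .seq (.prim (.const 5 0)) (.seq (.loop 4 (.prim (.add 5 5 3))) (.prim (.add 3 5 v)))

/-- The two states differ at most in the registers `3, 4, 5, 6`. -/
def SameBut (s s' : State) : Prop :=
  s'.mem = s.mem ∧ ∀ r, ¬ (3 ≤ r ∧ r ≤ 6) → s'.reg r = s.reg r

/-- The machine cannot multiply, so the product is accumulated by `n` additions in register `5`,
with counter `4`. -/
theorem ens_mulAdd {s : State} {n v : ℕ} (h0 : s.reg 0 = n) (h1 : s.reg 1 = 1)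
    (hv : ¬ (3 ≤ v ∧ v ≤ 6)) :
    Ens (mulAdd v) s (5 * n + 5) fun s' => s'.reg 3 = s.reg 3 * n + s.reg v ∧ SameBut s s' := by
  have hT : 5 * n + 5 = 1 + ((3 + n * (1 + 4)) + 1) := by ring
  rw [hT]
  refine Ens.seq (Ens.const (Ens.seq ?_))
  refine Ens.loop (fun j s' => s'.reg 5 = j * s.reg 3 ∧ s'.reg 4 = j ∧ s'.reg 3 = s.reg 3 ∧
    SameBut s s') ?_ ?_ ?_ ?_
  · rintro j s' ⟨-, h2, -, -, h3⟩
    exact ⟨(h3 0 (by omega)).trans h0, h2⟩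
  · refine ⟨by simp [State.set_reg], by simp, by simp [State.set_reg], rfl, fun r hr => ?_⟩
    rw [State.set_reg_ne _ _ (by omega), State.set_reg_ne _ _ (by omega)]
  · rintro j hj s' ⟨h2, h3, h4, h5, h6⟩
    refine Ens.add ?_
    have h7 : s'.reg 1 = 1 := (h6 1 (by omega)).trans h1
    refine ⟨?_, ?_, ?_, h5, fun r hr => ?_⟩
    · simp [State.set_reg, h2, h4]; ring
    · simp [State.set_reg, h3, h7]
    · simp [State.set_reg, h4]
    · rw [State.set_reg_ne _ _ (by omega), State.set_reg_ne _ _ (by omega),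
        State.set_reg_ne _ _ (by omega)]
      exact h6 r hr
  · rintro s' ⟨h2, -, h4, h5, h6⟩
    refine Ens.add ⟨?_, h5, fun r hr => ?_⟩
    · rw [State.set_reg_self, State.set_reg_ne _ _ (by omega), State.set_reg_ne _ _ (by omega), h2,
        h6 v hv]
      ring
    · rw [State.set_reg_ne _ _ (by omega), State.set_reg_ne _ _ (by omega)]
      exact h6 r hr

theorem SameBut.trans {s s' s'' : State} (h : SameBut s s') (h' : SameBut s' s'') :
    SameBut s s'' :=
  ⟨h'.1.trans h.1, fun r hr => (h'.2 r hr).trans (h.2 r hr)⟩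

theorem SameBut.foldl {s s' : State} (h : SameBut s s') {n : ℕ} {vs : List ℕ} (a : ℕ)
    (hv : ∀ v ∈ vs, ¬ (3 ≤ v ∧ v ≤ 6)) :
    vs.foldl (fun a v => a * n + s'.reg v) a = vs.foldl (fun a v => a * n + s.reg v) a := by
  induction vs generalizing a with
  | nil => rfl
  | cons x l ih =>
    rw [List.foldl_cons, List.foldl_cons, h.2 x (hv x (by simp)),
      ih _ fun w hw => hv w (by simp [hw])]

/-- Evaluate the digits in the registers `vs`, following the digits in register `3`. -/
def mulAdds : List ℕ → Cmd
  | [] => .prim (.copy 3 3)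
  | v :: vs => .seq (mulAdd v) (mulAdds vs)

theorem ens_mulAdds {n : ℕ} : ∀ {vs : List ℕ} {s : State}, s.reg 0 = n → s.reg 1 = 1 →
    (∀ v ∈ vs, ¬ (3 ≤ v ∧ v ≤ 6)) →
    Ens (mulAdds vs) s (vs.length * (5 * n + 5) + 1) fun s' =>
      s'.reg 3 = vs.foldl (fun a v => a * n + s.reg v) (s.reg 3) ∧ SameBut s s'
  | [], s, _, _, _ => by
    refine (Ens.copy (Q := _) ?_).mono (by simp) fun s h => h
    refine ⟨by simp, rfl, fun r hr => State.set_reg_ne _ _ (by omega)⟩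
  | v :: vs, s, h0, h1, hv => by
    have hT : (v :: vs).length * (5 * n + 5) + 1 =
        (5 * n + 5) + (vs.length * (5 * n + 5) + 1) := by simp; ring
    rw [hT]
    refine Ens.seq ((ens_mulAdd h0 h1 (hv v (by simp))).mono le_rfl fun s' hs' => ?_)
    obtain ⟨h2, h3⟩ := hs'
    have hv' : ∀ v ∈ vs, ¬ (3 ≤ v ∧ v ≤ 6) := fun w hw => hv w (by simp [hw])
    refine (ens_mulAdds ((h3.2 0 (by omega)).trans h0) ((h3.2 1 (by omega)).trans h1)
      hv').mono le_rfl fun s'' hs'' => ⟨?_, h3.trans hs''.2⟩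
    rw [hs''.1, h2, List.foldl_cons]
    exact h3.foldl _ hv'

/-- Register `3` := the number with leading digit `k` and further digits in the registers `vs`. -/
def addr (k : ℕ) (vs : List ℕ) : Cmd := .seq (.prim (.const 3 k)) (mulAdds vs)

theorem ens_addr {n k : ℕ} {vs : List ℕ} {s : State} (h0 : s.reg 0 = n) (h1 : s.reg 1 = 1)
    (hv : ∀ v ∈ vs, ¬ (3 ≤ v ∧ v ≤ 6)) :
    Ens (addr k vs) s (vs.length * (5 * n + 5) + 2) fun s' =>
      s'.reg 3 = vs.foldl (fun a v => a * n + s.reg v) k ∧ SameBut s s' := by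
  have hT : vs.length * (5 * n + 5) + 2 = 1 + (vs.length * (5 * n + 5) + 1) := by ring
  rw [hT]
  refine Ens.seq (Ens.const ?_)
  have hs : SameBut s (s.set 3 k) := ⟨rfl, fun r hr => State.set_reg_ne _ _ (by omega)⟩
  refine (ens_mulAdds ((hs.2 0 (by omega)).trans h0) ((hs.2 1 (by omega)).trans h1) hv).mono
    le_rfl fun s' hs' => ⟨?_, hs.trans hs'.2⟩
  rw [hs'.1, State.set_reg_self]
  exact hs.foldl _ hv

end RAM

/-! ### First-order formulas over tables -/

namespace RAM

/-- The number of a truth value. -/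
noncomputable def truth (p : Prop) : ℕ := open Classical in if p then 1 else 0

theorem truth_of {p : Prop} (h : p) : truth p = 1 := if_pos h

theorem truth_of_not {p : Prop} (h : ¬ p) : truth p = 0 := if_neg h

theorem truth_eq_zero {p : Prop} : truth p = 0 ↔ ¬ p := by
  by_cases h : p <;> simp [truth, h]

/-- Relations with four arguments on `0, …, n - 1`. -/
abbrev Table (n : ℕ) : Type := Fin n → Fin n → Fin n → Fin n → Prop

/-- Formulas about a matrix and a sequence of tables. The variables are numbered; a quantifier in
the scope of `d` variables binds variable number `d`. -/
inductive Fml where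
  | entry (i j v : ℕ)
  | tab (k a b c d : ℕ)
  | eq (i j : ℕ)
  | lt (i j : ℕ)
  | not (φ : Fml)
  | and (φ ψ : Fml)
  | ex (φ : Fml)

namespace Fml

/-- The formula `φ`, in the scope of `d` variables, is true for the given matrix, tables and values
of the variables. -/
def Sat {n : ℕ} (A : Fin n → Fin n → ℕ) (T : ℕ → Table n) : ℕ → Fml → (ℕ → Fin n) → Prop
  | _, entry i j v, ρ => A (ρ i) (ρ j) = v
  | _, tab k a b c d, ρ => T k (ρ a) (ρ b) (ρ c) (ρ d)
  | _, eq i j, ρ => ρ i = ρ j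
  | _, lt i j, ρ => ρ i < ρ j
  | d, not φ, ρ => ¬ Sat A T d φ ρ
  | d, and φ ψ, ρ => Sat A T d φ ρ ∧ Sat A T d ψ ρ
  | d, ex φ, ρ => ∃ x, Sat A T (d + 1) φ (Function.update ρ d x)

/-- The free variables of the formula are among the first `d` variables. -/
def Closed : ℕ → Fml → Prop
  | n, entry i j _ => i < n ∧ j < n
  | n, tab _ a b c d => a < n ∧ b < n ∧ c < n ∧ d < n
  | n, eq i j => i < n ∧ j < n
  | n, lt i j => i < n ∧ j < n
  | n, not φ => Closed n φ
  | n, and φ ψ => Closed n φ ∧ Closed n ψ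
  | n, ex φ => Closed (n + 1) φ

/-- The formula does not mention table `k`. -/
def Avoids (k : ℕ) : Fml → Prop
  | entry _ _ _ => True
  | tab l _ _ _ _ => l ≠ k
  | eq _ _ => True
  | lt _ _ => True
  | not φ => Avoids k φ
  | and φ ψ => Avoids k φ ∧ Avoids k ψ
  | ex φ => Avoids k φ

variable {n : ℕ} {A : Fin n → Fin n → ℕ} {T T' : ℕ → Table n}

theorem sat_congr_table {k : ℕ} (hT : ∀ l, l ≠ k → T l = T' l) {φ : Fml} (h : φ.Avoids k) {d : ℕ}
    {ρ : ℕ → Fin n} : Sat A T d φ ρ ↔ Sat A T' d φ ρ := by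
  induction φ generalizing d ρ with
  | entry | eq | lt => rfl
  | tab l => simp only [Sat, hT l h]
  | not φ ih => exact not_congr (ih h)
  | and φ ψ ih ih' => exact and_congr (ih h.1) (ih' h.2)
  | ex φ ih => exact exists_congr fun x => ih h

theorem sat_congr {φ : Fml} {d : ℕ} (h : φ.Closed d) {ρ σ : ℕ → Fin n} (hρ : ∀ i < d, ρ i = σ i) :
    Sat A T d φ ρ ↔ Sat A T d φ σ := by
  induction φ generalizing d ρ σ with
  | entry i j v => simp only [Sat, hρ i h.1, hρ j h.2]
  | tab k a b c e => simp only [Sat, hρ a h.1, hρ b h.2.1, hρ c h.2.2.1, hρ e h.2.2.2]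
  | eq i j => simp only [Sat, hρ i h.1, hρ j h.2]
  | lt i j => simp only [Sat, hρ i h.1, hρ j h.2]
  | not φ ih => exact not_congr (ih h hρ)
  | and φ ψ ih ih' => exact and_congr (ih h.1 hρ) (ih' h.2 hρ)
  | ex φ ih =>
    refine exists_congr fun x => ih h fun i hi => ?_
    by_cases hid : i = d
    · subst hid; simp
    · rw [Function.update_of_ne hid, Function.update_of_ne hid, hρ i (by omega)]

end Fml

/-- The address of a cell of table `k`. -/
def cell (n k a b c d : ℕ) : ℕ := ((((k + 1) * n + a) * n + b) * n + c) * n + d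

theorem digit_inj {n x y a b : ℕ} (ha : a < n) (hb : b < n) (h : x * n + a = y * n + b) :
    x = y ∧ a = b := by
  have hn : 0 < n := by omega
  have h1 : (x * n + a) / n = (y * n + b) / n := by rw [h]
  have h2 : (x * n + a) % n = (y * n + b) % n := by rw [h]
  rw [mul_comm x, mul_comm y, Nat.mul_add_div hn, Nat.mul_add_div hn, Nat.div_eq_of_lt ha,
    Nat.div_eq_of_lt hb] at h1
  rw [mul_comm x, mul_comm y, Nat.mul_add_mod, Nat.mul_add_mod, Nat.mod_eq_of_lt ha,
    Nat.mod_eq_of_lt hb] at h2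
  exact ⟨by omega, h2⟩

theorem cell_inj {n k a b c d k' a' b' c' d' : ℕ} (ha : a < n) (hb : b < n) (hc : c < n)
    (hd : d < n) (ha' : a' < n) (hb' : b' < n) (hc' : c' < n) (hd' : d' < n)
    (h : cell n k a b c d = cell n k' a' b' c' d') :
    k = k' ∧ a = a' ∧ b = b' ∧ c = c' ∧ d = d' := by
  obtain ⟨h1, h2⟩ := digit_inj hd hd' h
  obtain ⟨h3, h4⟩ := digit_inj hc hc' h1
  obtain ⟨h5, h6⟩ := digit_inj hb hb' h3
  obtain ⟨h7, h8⟩ := digit_inj ha ha' h5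
  exact ⟨by omega, h8, h6, h4, h2⟩

/-- The leading digit `k + 1` of an address is positive, so the tables lie beyond the matrix. -/
theorem sq_le_cell {n k a b c d : ℕ} (hn : 0 < n) : n * n ≤ cell n k a b c d := by
  have h1 : n ≤ (k + 1) * n + a := by nlinarith
  have h2 : n ≤ ((k + 1) * n + a) * n + b := by nlinarith
  have h3 : n * n ≤ (((k + 1) * n + a) * n + b) * n := Nat.mul_le_mul_right n h2
  have h4 : n * n ≤ (((k + 1) * n + a) * n + b) * n + c := by omega
  have h5 : (((k + 1) * n + a) * n + b) * n + c ≤ ((((k + 1) * n + a) * n + b) * n + c) * n :=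
    Nat.le_mul_of_pos_right _ hn
  unfold cell
  omega

theorem entry_lt {n i j : ℕ} (hi : i < n) (hj : j < n) : i * n + j < n * n := by
  calc i * n + j < i * n + n := by omega
    _ = (i + 1) * n := by ring
    _ ≤ n * n := Nat.mul_le_mul_right n hi

/-- The state holds `n`, the constant `1`, the matrix `A` and the tables `T`. -/
structure Rep (n : ℕ) (A : Fin n → Fin n → ℕ) (T : ℕ → Table n) (s : State) : Prop where
  zero : s.reg 0 = n
  one : s.reg 1 = 1
  entry : ∀ i j : Fin n, s.mem ((i : ℕ) * n + j) = A i j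
  cell : ∀ k (a b c d : Fin n), s.mem (cell n k a b c d) = truth (T k a b c d)

variable {n : ℕ} {A : Fin n → Fin n → ℕ} {T : ℕ → Table n} {s s' : State}

theorem Rep.congr (h : Rep n A T s) (h0 : s'.reg 0 = s.reg 0) (h1 : s'.reg 1 = s.reg 1)
    (hm : s'.mem = s.mem) : Rep n A T s' where
  zero := h0.trans h.zero
  one := h1.trans h.one
  entry := by rw [hm]; exact h.entry
  cell := by rw [hm]; exact h.cell

theorem Rep.set (h : Rep n A T s) {r v : ℕ} (hr : 2 ≤ r) : Rep n A T (s.set r v) :=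
  h.congr (State.set_reg_ne _ _ (by omega)) (State.set_reg_ne _ _ (by omega)) rfl

/-- The register of variable `i`. -/
def var (i : ℕ) : ℕ := 2 * i + 10

/-- The register of the loop counter at depth `i`. -/
def counter (i : ℕ) : ℕ := 2 * i + 11

/-- The register is not used for the evaluation of formulas in the scope of `d` variables. -/
def Kept (d r : ℕ) : Prop := r = 0 ∨ r = 1 ∨ (∃ i < d, r = var i) ∨ ∃ i, r = counter i

theorem Kept.mono {d d' r : ℕ} (hd : d ≤ d') (h : Kept d r) : Kept d' r := by
  rcases h with h | h | ⟨i, hi, h⟩ | h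
  · exact Or.inl h
  · exact Or.inr (Or.inl h)
  · exact Or.inr (Or.inr (Or.inl ⟨i, by omega, h⟩))
  · exact Or.inr (Or.inr (Or.inr h))

theorem Kept.spec {d r : ℕ} (h : Kept d r) : (r < 2 ∨ 9 < r) ∧ r ≠ var d := by
  rcases h with h | h | ⟨i, hi, h⟩ | ⟨i, h⟩ <;> subst h <;> unfold var <;> try unfold counter
  all_goals omega

theorem kept_var {d i : ℕ} (h : i < d) : Kept d (var i) := Or.inr (Or.inr (Or.inl ⟨i, h, rfl⟩))

theorem kept_counter {d i : ℕ} : Kept d (counter i) := Or.inr (Or.inr (Or.inr ⟨i, rfl⟩))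

/-- The states agree in the memory and in the kept registers. -/
def Frame (d : ℕ) (s s' : State) : Prop := s'.mem = s.mem ∧ ∀ r, Kept d r → s'.reg r = s.reg r

theorem Frame.refl (d : ℕ) (s : State) : Frame d s s := ⟨rfl, fun _ _ => rfl⟩

theorem Frame.trans {d : ℕ} {s s' s'' : State} (h : Frame d s s') (h' : Frame d s' s'') :
    Frame d s s'' := ⟨h'.1.trans h.1, fun r hr => (h'.2 r hr).trans (h.2 r hr)⟩

theorem Frame.mono {d d' : ℕ} (hd : d ≤ d') (h : Frame d' s s') : Frame d s s' :=
  ⟨h.1, fun r hr => h.2 r (hr.mono hd)⟩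

theorem Frame.set {d : ℕ} (h : Frame d s s') {r v : ℕ} (hr : (2 ≤ r ∧ r ≤ 9) ∨ r = var d) :
    Frame d s (s'.set r v) := by
  refine ⟨h.1, fun x hx => ?_⟩
  have := hx.spec
  rw [State.set_reg_ne _ _ (by rcases hr with hr | rfl <;> omega)]
  exact h.2 x hx

theorem Frame.rep {d : ℕ} (h : Frame d s s') (hr : Rep n A T s) : Rep n A T s' :=
  hr.congr (h.2 0 (Or.inl rfl)) (h.2 1 (Or.inr (Or.inl rfl))) h.1

theorem SameBut.frame (h : SameBut s s') (d : ℕ) : Frame d s s' :=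
  ⟨h.1, fun r hr => h.2 r (by have := hr.spec; omega)⟩

/-- The function is bounded by a polynomial. -/
def PolyBound (T : ℕ → ℕ) : Prop := ∃ p : Polynomial ℕ, ∀ n, T n ≤ p.eval n

theorem PolyBound.const (k : ℕ) : PolyBound fun _ => k := ⟨.C k, by simp⟩

theorem PolyBound.id : PolyBound fun n => n := ⟨.X, by simp⟩

theorem PolyBound.add {T T' : ℕ → ℕ} (h : PolyBound T) (h' : PolyBound T') :
    PolyBound fun n => T n + T' n := by
  obtain ⟨p, hp⟩ := h
  obtain ⟨q, hq⟩ := h'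
  exact ⟨p + q, fun n => by simpa using Nat.add_le_add (hp n) (hq n)⟩

theorem PolyBound.mul {T T' : ℕ → ℕ} (h : PolyBound T) (h' : PolyBound T') :
    PolyBound fun n => T n * T' n := by
  obtain ⟨p, hp⟩ := h
  obtain ⟨q, hq⟩ := h'
  exact ⟨p * q, fun n => by simpa using Nat.mul_le_mul (hp n) (hq n)⟩

theorem PolyBound.loop {T : ℕ → ℕ} (h : PolyBound T) : PolyBound fun n => 3 + n * (T n + 4) :=
  (PolyBound.const 3).add (PolyBound.id.mul (h.add (PolyBound.const 4)))

theorem PolyBound.addr (k : ℕ) : PolyBound fun n => k * (5 * n + 5) + 2 :=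
  ((PolyBound.const k).mul (((PolyBound.const 5).mul PolyBound.id).add (PolyBound.const 5))).add
    (PolyBound.const 2)

/-- The command leaves the truth value of the formula in register `2`, in time `τ n`. -/
def Evaluates (c : Cmd) (τ : ℕ → ℕ) (d : ℕ) (φ : Fml) : Prop :=
  ∀ n (A : Fin n → Fin n → ℕ) (T : ℕ → Table n) (ρ : ℕ → Fin n) (s : State), Rep n A T s →
    (∀ i < d, s.reg (var i) = ρ i) →
    Ens c s (τ n) fun s' => s'.reg 2 = truth (φ.Sat A T d ρ) ∧ Frame d s s'

/-- Register `2` := `k` if register `2` is zero, and `l` otherwise. -/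
def select (k l : ℕ) : Cmd := .ifZero 2 (.prim (.const 2 k)) (.prim (.const 2 l))

theorem ens_select {k l : ℕ} {Q : State → Prop} (h : Q (s.set 2 (if s.reg 2 = 0 then k else l))) :
    Ens (select k l) s 3 Q := by
  refine Ens.ifZero (T := 1) (fun h0 => Ens.const ?_) fun h0 => Ens.const ?_
  · simpa [h0] using h
  · simpa [h0] using h

/-- A quantifier becomes a loop over the register of its variable. The depth of nesting depends only
on the formula, so the time is polynomial in `n`. -/
theorem Fml.exists_evaluates (φ : Fml) : ∀ d, φ.Closed d →
    ∃ c τ, PolyBound τ ∧ Evaluates c τ d φ := by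
  induction φ with
  | entry i j v =>
    intro d ⟨hi, hj⟩
    -- Equality with `v` is tested by adding the two truncated differences; the sum vanishes only
    -- for equal numbers.
    refine ⟨.seq (addr 0 [var i, var j]) (.seq (.prim (.load 2 3)) (.seq (.prim (.const 7 v))
      (.seq (.prim (.sub 8 2 7)) (.seq (.prim (.sub 7 7 2)) (.seq (.prim (.add 2 8 7))
      (select 1 0)))))), _, (PolyBound.addr 2).add (PolyBound.const 8), ?_⟩
    intro n A T ρ s hs hρ
    refine Ens.seq ((ens_addr hs.zero hs.one (by simp [var])).mono le_rfl ?_)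
    rintro s' ⟨h1, h2⟩
    simp only [List.foldl_cons, List.foldl_nil, hρ i hi, hρ j hj, zero_mul, zero_add] at h1
    refine Ens.seq (T := 1) (T' := 7) (Ens.load ?_)
    refine Ens.seq (T := 1) (T' := 6) (Ens.const ?_)
    refine Ens.seq (T := 1) (T' := 5) (Ens.sub ?_)
    refine Ens.seq (T := 1) (T' := 4) (Ens.sub ?_)
    refine Ens.seq (T := 1) (T' := 3) (Ens.add ?_)
    refine ens_select ⟨?_, ?_⟩
    · simp only [State.set_reg, h1, (h2.frame d).1, hs.entry, Fml.Sat]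
      by_cases h : A (ρ i) (ρ j) = v
      · simp [h, truth]
      · have : (A (ρ i) (ρ j) - v) + (v - A (ρ i) (ρ j)) ≠ 0 := by omega
        simp [h, truth]
        omega
    · exact ((((((h2.frame d).set (by omega)).set (by omega)).set (by omega)).set (by omega)).set
        (by omega)).set (by omega)
  | tab k a b c e =>
    intro d ⟨ha, hb, hc, he⟩
    refine ⟨.seq (addr (k + 1) [var a, var b, var c, var e]) (.prim (.load 2 3)), _,
      (PolyBound.addr 4).add (PolyBound.const 1), ?_⟩
    intro n A T ρ s hs hρ
    refine Ens.seq ((ens_addr hs.zero hs.one (by simp [var])).mono le_rfl ?_)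
    rintro s' ⟨h1, h2⟩
    simp only [List.foldl_cons, List.foldl_nil, hρ a ha, hρ b hb, hρ c hc, hρ e he] at h1
    refine Ens.load ⟨?_, (h2.frame d).set (by omega)⟩
    rw [State.set_reg_self, h1, h2.1]
    exact hs.cell ..
  | eq i j =>
    intro d ⟨hi, hj⟩
    refine ⟨.seq (.prim (.sub 7 (var i) (var j))) (.seq (.prim (.sub 8 (var j) (var i)))
      (.seq (.prim (.add 2 7 8)) (select 1 0))), _, PolyBound.const 6, ?_⟩
    intro n A T ρ s hs hρ
    have h7 : ∀ i, var i ≠ 7 := fun i => by unfold var; omega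
    refine Ens.seq (T := 1) (T' := 5) (Ens.sub ?_)
    refine Ens.seq (T := 1) (T' := 4) (Ens.sub ?_)
    refine Ens.seq (T := 1) (T' := 3) (Ens.add ?_)
    refine ens_select ⟨?_, ((((Frame.refl d s).set (by omega)).set (by omega)).set
      (by omega)).set (by omega)⟩
    simp only [State.set_reg, h7, hρ i hi, hρ j hj, Fml.Sat, if_false, if_true]
    by_cases h : ρ i = ρ j
    · simp [h, truth]
    · have h' : (ρ i : ℕ) ≠ ρ j := fun h' => h (Fin.ext h')
      simp [h, truth]
      omega
  | lt i j =>
    intro d ⟨hi, hj⟩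
    refine ⟨.seq (.prim (.sub 2 (var j) (var i))) (select 0 1), _, PolyBound.const 4, ?_⟩
    intro n A T ρ s hs hρ
    refine Ens.seq (T := 1) (T' := 3) (Ens.sub ?_)
    refine ens_select ⟨?_, ((Frame.refl d s).set (by omega)).set (by omega)⟩
    simp only [State.set_reg, hρ i hi, hρ j hj, Fml.Sat, if_true]
    by_cases h : ρ i < ρ j
    · have h' : (ρ i : ℕ) < ρ j := h
      have : (ρ j : ℕ) - ρ i ≠ 0 := by omega
      simp [h, truth, this]
    · have h' : ¬ (ρ i : ℕ) < ρ j := h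
      have : (ρ j : ℕ) - ρ i = 0 := by omega
      simp [h, truth, this]
  | not φ ih =>
    intro d h
    obtain ⟨c, τ, hτ, hc⟩ := ih d h
    refine ⟨.seq c (select 1 0), _, hτ.add (PolyBound.const 3), ?_⟩
    intro n A T ρ s hs hρ
    refine Ens.seq ((hc n A T ρ s hs hρ).mono le_rfl ?_)
    rintro s' ⟨h1, h2⟩
    refine ens_select ⟨?_, h2.set (by omega)⟩
    rw [State.set_reg_self, h1]
    by_cases h : Sat A T d φ ρ <;> simp [truth, h, Fml.Sat]
  | and φ ψ ih ih' =>
    intro d h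
    obtain ⟨c, τ, hτ, hc⟩ := ih d h.1
    obtain ⟨c', τ', hτ', hc'⟩ := ih' d h.2
    refine ⟨.seq c (.ifZero 2 (.prim (.const 2 0)) c'), _,
      hτ.add (((PolyBound.const 1).add hτ').add (PolyBound.const 2)), ?_⟩
    intro n A T ρ s hs hρ
    refine Ens.seq ((hc n A T ρ s hs hρ).mono le_rfl ?_)
    rintro s' ⟨h1, h2⟩
    refine Ens.ifZero (fun h0 => ?_) fun h0 => ?_
    · refine (Ens.const (Q := _) ?_).mono (by omega) fun s h => h
      rw [h1, truth_eq_zero] at h0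
      exact ⟨by simp [truth, Fml.Sat, h0], h2.set (by omega)⟩
    · rw [h1, Ne, truth_eq_zero, not_not] at h0
      refine (hc' n A T ρ s' (h2.rep hs) fun i hi => (h2.2 _ (kept_var hi)).trans (hρ i hi)).mono
        (by omega) ?_
      rintro s'' ⟨h3, h4⟩
      exact ⟨by simp [h3, Fml.Sat, h0], h2.trans h4⟩
  | ex φ ih =>
    intro d h
    obtain ⟨c, τ, hτ, hc⟩ := ih (d + 1) h
    refine ⟨.seq (.prim (.const 2 0)) (.loop (var d) (.ifZero 2 c (.prim (.const 2 1)))), _,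
      (PolyBound.const 1).add ((hτ.add (PolyBound.const 1)).add (PolyBound.const 2)).loop, ?_⟩
    intro n A T ρ s hs hρ
    refine Ens.seq (Ens.const ?_)
    have v2 : ∀ {i}, var i ≠ 2 ∧ var i ≠ 6 := fun {i} => by unfold var; omega
    -- Register `2` records whether a witness below `j` has been found; once it has, the body is no
    -- longer evaluated.
    refine Ens.loop (fun j s' => Frame d s s' ∧ s'.reg (var d) = j ∧ s'.reg 2 =
      truth (∃ x : Fin n, (x : ℕ) < j ∧ Sat A T (d + 1) φ (Function.update ρ d x))) ?_ ?_ ?_ ?_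
    · rintro j s' ⟨h1, h2, -⟩
      exact ⟨(h1.rep hs).zero, h2⟩
    · refine ⟨((Frame.refl d s).set (by omega)).set (Or.inr rfl), by simp, ?_⟩
      rw [State.set_reg_ne _ _ v2.1.symm, State.set_reg_self, truth_of_not]
      simp
    · rintro j hj s' ⟨h1, h2, h3⟩
      have h1' : Frame d s (s'.set 6 (n - j)) := h1.set (by omega)
      have key : (∃ x : Fin n, (x : ℕ) < j + 1 ∧ Sat A T (d + 1) φ (Function.update ρ d x)) ↔
          (∃ x : Fin n, (x : ℕ) < j ∧ Sat A T (d + 1) φ (Function.update ρ d x)) ∨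
            Sat A T (d + 1) φ (Function.update ρ d ⟨j, hj⟩) := by
        constructor
        · rintro ⟨x, hx, hsat⟩
          by_cases hxj : (x : ℕ) = j
          · right
            rwa [show (⟨j, hj⟩ : Fin n) = x from Fin.ext hxj.symm]
          · exact Or.inl ⟨x, by omega, hsat⟩
        · rintro (⟨x, hx, hsat⟩ | hsat)
          · exact ⟨x, by omega, hsat⟩
          · exact ⟨_, by simp, hsat⟩
      refine Ens.ifZero (fun h0 => ?_) fun h0 => ?_
      · rw [State.set_reg_ne _ _ (by omega), h3, truth_eq_zero] at h0
        have hρ' : ∀ i < d + 1, (s'.set 6 (n - j)).reg (var i) =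
            Function.update ρ d ⟨j, hj⟩ i := by
          intro i hi
          rw [State.set_reg_ne _ _ v2.2]
          by_cases hid : i = d
          · subst hid; simp [h2]
          · rw [Function.update_of_ne hid, h1.2 _ (kept_var (by omega)), hρ i (by omega)]
        refine (hc n A T _ _ (h1'.rep hs) hρ').mono (by omega) ?_
        rintro s'' ⟨h4, h5⟩
        have h6 : Frame d s s'' := h1'.trans (h5.mono (by omega))
        refine ⟨h6.set (Or.inr rfl), ?_, ?_⟩
        · rw [State.set_reg_self, (h6.rep hs).one, h5.2 _ (kept_var (by omega)),
            State.set_reg_ne _ _ v2.2, h2]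
        · rw [State.set_reg_ne _ _ v2.1.symm, h4, key]
          simp only [h0, false_or]
      · rw [State.set_reg_ne _ _ (by omega), h3, Ne, truth_eq_zero, not_not] at h0
        refine (Ens.const (Q := _) ?_).mono (by omega) fun s h => h
        have h6 := h1'.set (r := 2) (v := 1) (Or.inl (by omega))
        refine ⟨h6.set (Or.inr rfl), ?_, ?_⟩
        · rw [State.set_reg_self, (h6.rep hs).one, State.set_reg_ne _ _ v2.1,
            State.set_reg_ne _ _ v2.2, h2]
        · rw [State.set_reg_ne _ _ v2.1.symm, State.set_reg_self, key, truth_of (Or.inl h0)]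
    · rintro s' ⟨h1, h2, h3⟩
      refine ⟨?_, h1.set (by omega)⟩
      rw [State.set_reg_ne _ _ (by omega), h3]
      congr 1
      simp [Fml.Sat]

/-! ### Programs on tables -/

/-- Programs on tables: fill a table according to a formula in the variables `0, 1, 2, 3`; do one
thing after the other; repeat something `n` times. -/
inductive Prog where
  | assign (k : ℕ) (φ : Fml)
  | seq (p q : Prog)
  | loop (p : Prog)

/-- The first four values are given. -/
def env {n : ℕ} (a b c d : Fin n) (i : ℕ) : Fin n :=
  if i = 0 then a else if i = 1 then b else if i = 2 then c else d

/-- Replace table `k`. -/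
def setTable {n : ℕ} (T : ℕ → Table n) (k : ℕ) (X : Table n) : ℕ → Table n := Function.update T k X

namespace Prog

/-- The effect of a program. -/
def eval (A : Fin n → Fin n → ℕ) : Prog → (ℕ → Table n) → ℕ → Table n
  | assign k φ, T => setTable T k fun a b c d => φ.Sat A T 4 (env a b c d)
  | seq p q, T => q.eval A (p.eval A T)
  | loop p, T => (p.eval A)^[n] T

/-- All formulas are closed, and no table is used in its own definition. -/
def WellFormed : Prog → Prop
  | assign k φ => φ.Closed 4 ∧ φ.Avoids k
  | seq p q => p.WellFormed ∧ q.WellFormed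
  | loop p => p.WellFormed

end Prog

/-- The cells of table `k` whose first `m` coordinates are given by `ρ` are filled. -/
def fill (A : Fin n → Fin n → ℕ) (k : ℕ) (φ : Fml) (m : ℕ) (ρ : ℕ → Fin n) (T : ℕ → Table n) :
    ℕ → Table n := fun l a b c d =>
  (l = k ∧ (∀ i < m, env a b c d i = ρ i) ∧ φ.Sat A T 4 (env a b c d)) ∨
    (¬ (l = k ∧ ∀ i < m, env a b c d i = ρ i) ∧ T l a b c d)

/-- The command fills the cells of table `k` whose first `m` coordinates are given. -/
def Fills (c : Cmd) (τ : ℕ → ℕ) (k : ℕ) (φ : Fml) (m : ℕ) : Prop :=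
  ∀ n (A : Fin n → Fin n → ℕ) (T : ℕ → Table n) (ρ : ℕ → Fin n) (s : State), Rep n A T s →
    (∀ i < m, s.reg (var i) = ρ i) →
    Ens c s (τ n) fun s' => Rep n A (fill A k φ m ρ T) s' ∧ ∀ r, Kept m r → s'.reg r = s.reg r

theorem exists_fills_four {k : ℕ} {φ : Fml} (hφ : φ.Closed 4) :
    ∃ c τ, PolyBound τ ∧ Fills c τ k φ 4 := by
  obtain ⟨c, τ, hτ, hc⟩ := φ.exists_evaluates 4 hφ
  refine ⟨.seq c (.seq (addr (k + 1) [var 0, var 1, var 2, var 3]) (.prim (.store 3 2))), _,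
    hτ.add ((PolyBound.addr 4).add (PolyBound.const 1)), ?_⟩
  intro n A T ρ s hs hρ
  refine Ens.seq ((hc n A T ρ s hs hρ).mono le_rfl ?_)
  rintro s1 ⟨h1, h2⟩
  have hs1 := h2.rep hs
  refine Ens.seq ((ens_addr hs1.zero hs1.one (by simp [var])).mono le_rfl ?_)
  rintro s2 ⟨h3, h4⟩
  have h5 := h4.frame 4
  have hs2 := h5.rep hs1
  have hv : ∀ i < 4, s1.reg (var i) = ρ i := fun i hi => (h2.2 _ (kept_var hi)).trans (hρ i hi)
  simp only [List.foldl_cons, List.foldl_nil, hv 0 (by omega), hv 1 (by omega), hv 2 (by omega),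
    hv 3 (by omega)] at h3
  have h3' : s2.reg 3 = cell n k (ρ 0) (ρ 1) (ρ 2) (ρ 3) := h3
  -- The address computation touches only the registers `3` to `6`, so the truth value survives it.
  have h6 : s2.reg 2 = truth (φ.Sat A T 4 ρ) := (h4.2 2 (by omega)).trans h1
  refine Ens.store ⟨⟨hs2.zero, hs2.one, fun i j => ?_, fun l a b c d => ?_⟩, fun r hr => ?_⟩
  · have e1 := entry_lt i.2 j.2
    have e2 := sq_le_cell (n := n) (k := k) (a := ρ 0) (b := ρ 1) (c := ρ 2) (d := ρ 3)
      (by have := i.2; omega)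
    show Function.update s2.mem (s2.reg 3) (s2.reg 2) _ = _
    rw [Function.update_of_ne (by omega), hs2.entry]
  · show Function.update s2.mem (s2.reg 3) (s2.reg 2) _ = _
    by_cases h : l = k ∧ ∀ i < 4, env a b c d i = ρ i
    · obtain ⟨rfl, h⟩ := h
      have e0 : a = ρ 0 := h 0 (by omega)
      have e1 : b = ρ 1 := h 1 (by omega)
      have e2 : c = ρ 2 := h 2 (by omega)
      have e3 : d = ρ 3 := h 3 (by omega)
      rw [h3', e0, e1, e2, e3, Function.update_self, h6, ← e0, ← e1, ← e2, ← e3]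
      congr 1
      rw [← Fml.sat_congr hφ h, fill, eq_iff_iff]
      tauto
    · rw [Function.update_of_ne, hs2.cell]
      · congr 1
        rw [fill]
        simp only [h, not_false_eq_true, true_and, eq_iff_iff]
        tauto
      · rw [h3']
        intro he
        obtain ⟨e0, e1, e2, e3, e4⟩ := cell_inj a.2 b.2 c.2 d.2 (ρ 0).2 (ρ 1).2 (ρ 2).2 (ρ 3).2 he
        refine h ⟨e0, fun i hi => ?_⟩
        interval_cases i
        · exact Fin.ext e1
        · exact Fin.ext e2
        · exact Fin.ext e3
        · exact Fin.ext e4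
  · exact (h5.2 r hr).trans (h2.2 r hr)

/-- One loop runs through coordinate `m`. Overwriting the table while the formula is still to be
evaluated elsewhere is harmless, because the formula does not mention table `k`. -/
theorem Fills.pred {k : ℕ} {φ : Fml} (hφ : φ.Avoids k) {m : ℕ}
    (h : ∃ c τ, PolyBound τ ∧ Fills c τ k φ (m + 1)) :
    ∃ c τ, PolyBound τ ∧ Fills c τ k φ m := by
  obtain ⟨c, τ, hτ, hc⟩ := h
  refine ⟨.loop (var m) c, _, hτ.loop, ?_⟩
  intro n A T ρ s hs hρ
  have v6 : ∀ {i}, 2 ≤ var i ∧ var i ≠ 6 := fun {i} => by unfold var; omega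
  have kept_set : ∀ {r}, Kept m r → ∀ (s : State) v, (s.set (var m) v).reg r = s.reg r :=
    fun hr s v => State.set_reg_ne _ _ hr.spec.2
  have kept_set' : ∀ {r}, Kept m r → ∀ (s : State) v, (s.set 6 v).reg r = s.reg r :=
    fun hr s v => State.set_reg_ne _ _ (by have := hr.spec.1; omega)
  -- The tables after the first `j` values of coordinate `m` have been treated.
  let part : ℕ → ℕ → Table n := fun j l a b c d =>
    (l = k ∧ (∀ i < m, env a b c d i = ρ i) ∧ (env a b c d m : ℕ) < j ∧
      φ.Sat A T 4 (env a b c d)) ∨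
    (¬ (l = k ∧ (∀ i < m, env a b c d i = ρ i) ∧ (env a b c d m : ℕ) < j) ∧ T l a b c d)
  refine Ens.loop (fun j s' => Rep n A (part j) s' ∧ s'.reg (var m) = j ∧
    ∀ r, Kept m r → s'.reg r = s.reg r) ?_ ?_ ?_ ?_
  · rintro j s' ⟨h1, h2, -⟩
    exact ⟨h1.zero, h2⟩
  · refine ⟨?_, by simp, fun r hr => kept_set hr _ _⟩
    have : part 0 = T := by
      funext l a b c d
      simp [part]
    rw [this]
    exact hs.set v6.1
  · rintro j hj s' ⟨h1, h2, h3⟩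
    have hρ' : ∀ i < m + 1, (s'.set 6 (n - j)).reg (var i) = Function.update ρ m ⟨j, hj⟩ i := by
      intro i hi
      rw [State.set_reg_ne _ _ v6.2]
      by_cases him : i = m
      · subst him; simp [h2]
      · rw [Function.update_of_ne him, h3 _ (kept_var (by omega)), hρ i (by omega)]
    refine (hc n A (part j) _ _ (h1.set (by omega)) hρ').mono le_rfl ?_
    rintro s'' ⟨h4, h5⟩
    refine ⟨?_, ?_, fun r hr => ?_⟩
    · have : fill A k φ (m + 1) (Function.update ρ m ⟨j, hj⟩) (part j) = part (j + 1) := by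
        funext l a b c d
        have e1 : φ.Sat A (part j) 4 (env a b c d) ↔ φ.Sat A T 4 (env a b c d) := by
          refine Fml.sat_congr_table (k := k) (fun l hl => ?_) hφ
          funext a b c d
          simp [part, hl]
        have e2 : (∀ i < m + 1, env a b c d i = Function.update ρ m ⟨j, hj⟩ i) ↔
            (∀ i < m, env a b c d i = ρ i) ∧ (env a b c d m : ℕ) = j := by
          constructor
          · intro h
            refine ⟨fun i hi => ?_, ?_⟩
            · rw [h i (by omega), Function.update_of_ne (by omega)]
            · rw [h m (by omega), Function.update_self]
          · rintro ⟨h, h'⟩ i hi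
            by_cases him : i = m
            · subst him; rw [Function.update_self]; exact Fin.ext h'
            · rw [Function.update_of_ne him, h i (by omega)]
        have e3 : (env a b c d m : ℕ) < j + 1 ↔
            (env a b c d m : ℕ) < j ∨ (env a b c d m : ℕ) = j := by omega
        simp only [fill, e1, e2, eq_iff_iff]
        simp only [part, e3]
        have e4 : (env a b c d m : ℕ) = j → ¬ (env a b c d m : ℕ) < j := by omega
        generalize ((env a b c d m : ℕ) < j) = q1 at *
        generalize ((env a b c d m : ℕ) = j) = q2 at *
        clear e1 e2 e3 h4 h5 hρ' hc kept_set kept_set' v6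
        tauto
      rw [← this]
      exact h4.set v6.1
    · rw [State.set_reg_self, h4.one, h5 _ (kept_var (by omega)), State.set_reg_ne _ _ v6.2, h2]
    · rw [kept_set hr, h5 r (hr.mono (by omega)), kept_set' hr, h3 r hr]
  · rintro s' ⟨h1, h2, h3⟩
    refine ⟨?_, fun r hr => (kept_set' hr _ _).trans (h3 r hr)⟩
    have : part n = fill A k φ m ρ T := by
      funext l a b c d
      simp only [part, fill, (env a b c d m).2, true_and, and_true]
    rw [← this]
    exact h1.set (by omega)

theorem exists_fills {k : ℕ} {φ : Fml} (hφ : φ.Closed 4) (hφ' : φ.Avoids k) :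
    ∃ c τ, PolyBound τ ∧ Fills c τ k φ 0 :=
  Fills.pred hφ' (Fills.pred hφ' (Fills.pred hφ' (Fills.pred hφ' (exists_fills_four hφ))))

theorem fill_zero (k : ℕ) (φ : Fml) (ρ : ℕ → Fin n) :
    fill A k φ 0 ρ T = (Prog.assign k φ).eval A T := by
  funext l a b c d
  by_cases h : l = k
  · subst h; simp [fill, Prog.eval, setTable]
  · simp [fill, Prog.eval, setTable, h]

/-- The command executes the program on tables, in time `τ n`, without using the counters up to
depth `l`. -/
def Executes (c : Cmd) (τ : ℕ → ℕ) (l : ℕ) (p : Prog) : Prop :=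
  ∀ n (A : Fin n → Fin n → ℕ) (T : ℕ → Table n) (s : State), 0 < n → Rep n A T s →
    Ens c s (τ n) fun s' => Rep n A (p.eval A T) s' ∧
      ∀ i < l, s'.reg (counter i) = s.reg (counter i)

/-- Nested loops need different counters, hence the depth `l`; filling tables leaves all counters
alone. -/
theorem Prog.exists_executes (p : Prog) (hp : p.WellFormed) :
    ∀ l, ∃ c τ, PolyBound τ ∧ Executes c τ l p := by
  induction p with
  | assign k φ =>
    intro l
    obtain ⟨c, τ, hτ, hc⟩ := exists_fills hp.1 hp.2
    refine ⟨c, τ, hτ, fun n A T s hn hs => ?_⟩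
    refine (hc n A T (fun _ => ⟨0, hn⟩) s hs (by simp)).mono le_rfl ?_
    rintro s' ⟨h1, h2⟩
    rw [fill_zero] at h1
    exact ⟨h1, fun i _ => h2 _ kept_counter⟩
  | seq p q ihp ihq =>
    intro l
    obtain ⟨c, τ, hτ, hc⟩ := ihp hp.1 l
    obtain ⟨c', τ', hτ', hc'⟩ := ihq hp.2 l
    refine ⟨.seq c c', _, hτ.add hτ', fun n A T s hn hs => ?_⟩
    refine Ens.seq ((hc n A T s hn hs).mono le_rfl ?_)
    rintro s' ⟨h1, h2⟩
    refine (hc' n A _ s' hn h1).mono le_rfl ?_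
    rintro s'' ⟨h3, h4⟩
    exact ⟨h3, fun i hi => (h4 i hi).trans (h2 i hi)⟩
  | loop p ih =>
    intro l
    obtain ⟨c, τ, hτ, hc⟩ := ih hp (l + 1)
    refine ⟨.loop (counter l) c, _, hτ.loop, fun n A T s hn hs => ?_⟩
    have c6 : ∀ {i}, 2 ≤ counter i ∧ counter i ≠ 6 := fun {i} => by unfold counter; omega
    have cne : ∀ {i}, i < l → counter i ≠ counter l := fun {i} h => by unfold counter; omega
    refine Ens.loop (fun j s' => Rep n A ((p.eval A)^[j] T) s' ∧ s'.reg (counter l) = j ∧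
      ∀ i < l, s'.reg (counter i) = s.reg (counter i)) ?_ ?_ ?_ ?_
    · rintro j s' ⟨h1, h2, -⟩
      exact ⟨h1.zero, h2⟩
    · exact ⟨hs.set c6.1, by simp, fun i hi => State.set_reg_ne _ _ (cne hi)⟩
    · rintro j hj s' ⟨h1, h2, h3⟩
      refine (hc n A _ _ hn (h1.set (r := 6) (by omega))).mono le_rfl ?_
      rintro s'' ⟨h4, h5⟩
      rw [← Function.iterate_succ_apply' (Prog.eval A p)] at h4
      refine ⟨h4.set c6.1, ?_, fun i hi => ?_⟩
      · rw [State.set_reg_self, h4.one, h5 l (by omega), State.set_reg_ne _ _ c6.2, h2]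
      · rw [State.set_reg_ne _ _ (cne hi), h5 i (by omega), State.set_reg_ne _ _ c6.2, h3 i hi]
    · rintro s' ⟨h1, h2, h3⟩
      exact ⟨h1.set (by omega), fun i hi => (State.set_reg_ne _ _ c6.2).trans (h3 i hi)⟩

end RAM

/-! ### From programs on tables to random access machines -/

namespace RAM

variable {n : ℕ} {A : Fin n → Fin n → ℕ} {T : ℕ → Table n} {s s' : State}

/-- The entry of the adjacency matrix of an oriented graph. -/
noncomputable def arcEntry (X : Table n) (i j : Fin n) : ℕ :=
  open Classical in if X i j i j then 2 else if X j i j i then 3 else 0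

/-- The command writes one entry of the output. -/
def WritesEntry (c : Cmd) (τ : ℕ → ℕ) (k : ℕ) : Prop :=
  ∀ n (A : Fin n → Fin n → ℕ) (T : ℕ → Table n) (i j : Fin n) (s : State), Rep n A T s →
    s.reg (var 0) = i → s.reg (var 1) = j → Ens c s (τ n) fun s' =>
      Rep n (Function.update A i (Function.update (A i) j (arcEntry (T k) i j))) T s' ∧
        ∀ r, Kept 2 r → s'.reg r = s.reg r

theorem exists_writesEntry (k : ℕ) : ∃ c τ, PolyBound τ ∧ WritesEntry c τ k := by
  obtain ⟨c1, τ1, hτ1, h1⟩ := (Fml.tab k 0 1 0 1).exists_evaluates 2 (by simp [Fml.Closed])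
  obtain ⟨c2, τ2, hτ2, h2⟩ := (Fml.tab k 1 0 1 0).exists_evaluates 2 (by simp [Fml.Closed])
  refine ⟨.seq (.seq c1 (.ifZero 2 (.seq c2 (select 0 3)) (.prim (.const 2 2))))
    (.seq (addr 0 [var 0, var 1]) (.prim (.store 3 2))), _,
    (hτ1.add ((hτ2.add (PolyBound.const 3)).add (PolyBound.const 2))).add
      ((PolyBound.addr 2).add (PolyBound.const 1)), ?_⟩
  intro n A T i j s hs hi hj
  have hval : Ens (.seq c1 (.ifZero 2 (.seq c2 (select 0 3)) (.prim (.const 2 2)))) s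
      (τ1 n + (τ2 n + 3 + 2)) fun s' => s'.reg 2 = arcEntry (T k) i j ∧ Frame 2 s s' := by
    have hρ : ∀ l < 2, s.reg (var l) = (fun l => if l = 0 then i else j : ℕ → Fin n) l := by
      intro l hl
      interval_cases l
      · exact hi
      · exact hj
    refine Ens.seq ((h1 n A T _ s hs hρ).mono le_rfl ?_)
    rintro s1 ⟨e1, f1⟩
    refine Ens.ifZero (fun h0 => ?_) fun h0 => ?_
    · rw [e1, truth_eq_zero] at h0
      refine Ens.seq ((h2 n A T _ s1 (f1.rep hs)
        fun l hl => (f1.2 _ (kept_var hl)).trans (hρ l hl)).mono le_rfl ?_)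
      rintro s2 ⟨e2, f2⟩
      refine ens_select ⟨?_, (f1.trans f2).set (by omega)⟩
      rw [State.set_reg_self, e2]
      simp only [Fml.Sat, if_true, one_ne_zero, if_false] at h0 ⊢
      by_cases h : T k j i j i <;> simp [arcEntry, truth, h0, h]
    · rw [e1, Ne, truth_eq_zero, not_not] at h0
      refine (Ens.const (Q := _) ?_).mono (by omega) fun s h => h
      refine ⟨?_, f1.set (by omega)⟩
      simp only [Fml.Sat, if_true, one_ne_zero, if_false] at h0 ⊢
      simp [arcEntry, h0]
  refine Ens.seq (hval.mono le_rfl ?_)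
  rintro s1 ⟨e1, f1⟩
  have hs1 := f1.rep hs
  refine Ens.seq ((ens_addr hs1.zero hs1.one (by simp [var])).mono le_rfl ?_)
  rintro s2 ⟨e2, f2⟩
  have hs2 := (f2.frame 2).rep hs1
  simp only [List.foldl_cons, List.foldl_nil, f1.2 _ (kept_var (Nat.zero_lt_two)),
    f1.2 _ (kept_var (Nat.one_lt_two)), hi, hj, zero_mul, zero_add] at e2
  have e3 : s2.reg 2 = arcEntry (T k) i j := (f2.2 2 (by omega)).trans e1
  refine Ens.store ⟨⟨hs2.zero, hs2.one, fun i' j' => ?_, fun l a b c d => ?_⟩, fun r hr => ?_⟩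
  · show Function.update s2.mem (s2.reg 3) (s2.reg 2) _ = _
    rw [e2, e3]
    by_cases h : (i' : ℕ) * n + j' = i * n + j
    · obtain ⟨ha, hb⟩ := digit_inj j'.2 j.2 h
      obtain rfl := Fin.ext ha
      obtain rfl := Fin.ext hb
      simp
    · rw [Function.update_of_ne h, hs2.entry]
      by_cases hi' : i' = i
      · subst hi'
        have hj' : j' ≠ j := by rintro rfl; exact h rfl
        rw [Function.update_self, Function.update_of_ne hj']
      · rw [Function.update_of_ne hi']
  · have q1 := entry_lt i.2 j.2
    have q2 := sq_le_cell (n := n) (k := l) (a := a) (b := b) (c := c) (d := d)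
      (by have := i.2; omega)
    show Function.update s2.mem (s2.reg 3) (s2.reg 2) _ = _
    rw [Function.update_of_ne (by omega), hs2.cell]
  · exact ((f2.frame 2).2 r hr).trans (f1.2 r hr)

/-- The command writes the output. -/
def Writes (c : Cmd) (τ : ℕ → ℕ) (k : ℕ) : Prop :=
  ∀ n (A : Fin n → Fin n → ℕ) (T : ℕ → Table n) (s : State), Rep n A T s →
    Ens c s (τ n) fun s' => Rep n (arcEntry (T k)) T s' ∧ s'.reg (counter 0) = s.reg (counter 0)

theorem exists_writes (k : ℕ) : ∃ c τ, PolyBound τ ∧ Writes c τ k := by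
  obtain ⟨c, τ, hτ, hc⟩ := exists_writesEntry k
  refine ⟨.loop (var 0) (.loop (var 1) c), _, hτ.loop.loop, ?_⟩
  intro n A T s hs
  have hv : ∀ {r m v : ℕ} (s : State), Kept m r → (s.set (var m) v).reg r = s.reg r :=
    fun s h => State.set_reg_ne _ _ h.spec.2
  have h6 : ∀ {r m v : ℕ} (s : State), Kept m r → (s.set 6 v).reg r = s.reg r :=
    fun s h => State.set_reg_ne _ _ (by have := h.spec.1; omega)
  have v2 : ∀ {i}, 2 ≤ var i := fun {i} => by unfold var; omega
  have row : ∀ (A : Fin n → Fin n → ℕ) (i : Fin n) (s : State), Rep n A T s → s.reg (var 0) = i →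
      Ens (.loop (var 1) c) s (3 + n * (τ n + 4)) fun s' =>
        Rep n (Function.update A i (arcEntry (T k) i)) T s' ∧
          ∀ r, Kept 1 r → s'.reg r = s.reg r := by
    intro A i s hs hi
    refine Ens.loop (fun j s' => Rep n (Function.update A i fun j' =>
      if (j' : ℕ) < j then arcEntry (T k) i j' else A i j') T s' ∧ s'.reg (var 1) = j ∧
      ∀ r, Kept 1 r → s'.reg r = s.reg r) ?_ ?_ ?_ ?_
    · rintro j s' ⟨h1, h2, -⟩
      exact ⟨h1.zero, h2⟩
    · refine ⟨?_, by simp, fun r hr => hv _ hr⟩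
      simp only [Nat.not_lt_zero, if_false, Function.update_eq_self]
      exact hs.set v2
    · rintro j hj s' ⟨h1, h2, h3⟩
      refine (hc n _ T i ⟨j, hj⟩ _ (h1.set (r := 6) (by omega))
        (by rw [h6 _ (kept_var zero_lt_one), h3 _ (kept_var zero_lt_one), hi])
        (by rw [h6 _ (kept_var one_lt_two), h2])).mono le_rfl ?_
      rintro s'' ⟨h4, h5⟩
      refine ⟨?_, ?_, fun r hr => ?_⟩
      · refine Rep.set ?_ v2
        rw [Function.update_idem, Function.update_self] at h4
        convert h4 using 3
        rename_i j'
        by_cases hj' : j' = ⟨j, hj⟩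
        · subst hj'; simp
        · have : (j' : ℕ) ≠ j := fun h => hj' (Fin.ext h)
          have e : (j' : ℕ) < j + 1 ↔ (j' : ℕ) < j := by omega
          simp [Function.update_of_ne hj', e]
      · rw [State.set_reg_self, h4.one, h5 _ (kept_var one_lt_two), h6 _ (kept_var one_lt_two), h2]
      · rw [hv _ hr, h5 r (hr.mono one_le_two), h6 _ hr, h3 r hr]
    · rintro s' ⟨h1, h2, h3⟩
      refine ⟨?_, fun r hr => (h6 _ hr).trans (h3 r hr)⟩
      simp only [Fin.is_lt, if_true] at h1
      exact h1.set (by omega)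
  refine Ens.loop (fun i s' => Rep n (fun i' =>
      if (i' : ℕ) < i then arcEntry (T k) i' else A i') T s' ∧ s'.reg (var 0) = i ∧
      s'.reg (counter 0) = s.reg (counter 0)) ?_ ?_ ?_ ?_
  · rintro j s' ⟨h1, h2, -⟩
    exact ⟨h1.zero, h2⟩
  · refine ⟨?_, by simp, hv _ kept_counter⟩
    simp only [Nat.not_lt_zero, if_false]
    exact hs.set v2
  · rintro i hi s' ⟨h1, h2, h3⟩
    refine (row _ ⟨i, hi⟩ _ (h1.set (r := 6) (by omega))
      (by rw [h6 _ (kept_var zero_lt_one), h2])).mono le_rfl ?_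
    rintro s'' ⟨h4, h5⟩
    refine ⟨?_, ?_, ?_⟩
    · refine Rep.set ?_ v2
      convert h4 using 2
      rename_i i'
      by_cases hi' : i' = ⟨i, hi⟩
      · subst hi'; simp
      · have : (i' : ℕ) ≠ i := fun h => hi' (Fin.ext h)
        have e : (i' : ℕ) < i + 1 ↔ (i' : ℕ) < i := by omega
        simp [Function.update_of_ne hi', e]
    · rw [State.set_reg_self, h4.one, h5 _ (kept_var zero_lt_one), h6 _ (kept_var zero_lt_one), h2]
    · rw [hv _ kept_counter, h5 _ kept_counter, h6 (m := 0) _ kept_counter, h3]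
  · rintro s' ⟨h1, h2, h3⟩
    refine ⟨?_, (h6 (m := 0) _ kept_counter).trans h3⟩
    simp only [Fin.is_lt, if_true] at h1
    exact h1.set (by omega)

/-- The registers and the memory at the start. -/
noncomputable def startState {n : ℕ} (P : PartiallyOrientedGraph (Fin n)) : State :=
  ⟨(start P).reg, (start P).mem⟩

theorem rep_startState (hn : 0 < n) (P : PartiallyOrientedGraph (Fin n)) :
    Rep n P.entry (fun _ _ _ _ _ => False) ((startState P).set 1 1) where
  zero := by rw [State.set_reg_ne _ _ (by omega)]; rfl
  one := by simp
  entry i j := by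
    have h := entry_lt i.2 j.2
    have h1 : Fin.divNat ⟨(i : ℕ) * n + j, h⟩ = i := by
      apply Fin.ext
      rw [Fin.coe_divNat]
      show ((i : ℕ) * n + j) / n = i
      rw [mul_comm, Nat.mul_add_div hn, Nat.div_eq_of_lt j.2, add_zero]
    have h2 : Fin.modNat ⟨(i : ℕ) * n + j, h⟩ = j := by
      apply Fin.ext
      rw [Fin.coe_modNat]
      show ((i : ℕ) * n + j) % n = j
      rw [mul_comm, Nat.mul_add_mod, Nat.mod_eq_of_lt j.2]
    show (if h : _ then _ else _) = _
    rw [dif_pos h, h1, h2]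
  cell k a b c d := by
    have h := sq_le_cell (n := n) (k := k) (a := a) (b := b) (c := c) (d := d) hn
    show (if h : _ then _ else _) = _
    rw [dif_neg (by omega), truth_of_not (fun h => h)]

/-- A program on tables, followed by the evaluation of a formula and the output of a table, can be
executed by a random access machine in polynomial time. -/
theorem exists_machine (p : Prog) (hp : p.WellFormed) (φ : Fml) (hφ : φ.Closed 0) (k : ℕ) :
    ∃ (prog : Program) (q : Polynomial ℕ), ∀ n (P : PartiallyOrientedGraph (Fin n)),
      ∃ c, HaltsWithin prog (start P) (q.eval n) c ∧ (n = 0 → c.reg 0 = 1) ∧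
        ∀ ρ : ℕ → Fin n,
          c.reg 0 = truth (φ.Sat P.entry (p.eval P.entry fun _ _ _ _ _ => False) 0 ρ) ∧
          ∀ i j : Fin n, c.mem ((i : ℕ) * n + j) =
            arcEntry (p.eval P.entry (fun _ _ _ _ _ => False) k) i j := by
  obtain ⟨c1, τ1, hτ1, h1⟩ := p.exists_executes hp 0
  obtain ⟨c2, τ2, hτ2, h2⟩ := φ.exists_evaluates 0 hφ
  obtain ⟨c3, τ3, hτ3, h3⟩ := exists_writes k
  obtain ⟨q, hq⟩ := ((PolyBound.const 1).add (hτ1.add (hτ2.add ((PolyBound.const 1).add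
    (hτ3.add (PolyBound.const 1)))))).add (PolyBound.const 2)
  -- Without vertices the answer is `1` at once, since variables would have no value. Otherwise the
  -- formula is evaluated before the output overwrites the matrix, and the verdict is kept in
  -- `counter 0` meanwhile.
  let main : Cmd := .ifZero 0 (.prim (.const 0 1)) (.seq (.prim (.const 1 1)) (.seq c1 (.seq c2
    (.seq (.prim (.copy (counter 0) 2)) (.seq c3 (.prim (.copy 0 (counter 0))))))))
  have hmain : ∀ n (P : PartiallyOrientedGraph (Fin n)), Ens main (startState P) (q.eval n)
      fun s => (n = 0 → s.reg 0 = 1) ∧ ∀ ρ : ℕ → Fin n,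
          s.reg 0 = truth (φ.Sat P.entry (p.eval P.entry fun _ _ _ _ _ => False) 0 ρ) ∧
          ∀ i j : Fin n, s.mem ((i : ℕ) * n + j) =
            arcEntry (p.eval P.entry (fun _ _ _ _ _ => False) k) i j := by
    intro n P
    refine Ens.mono (Q := _) (Ens.ifZero (fun h0 => ?_) fun h0 => ?_) (hq n) fun s h => h
    · refine (Ens.const (Q := _) ?_).mono (by omega) fun s h => h
      refine ⟨fun _ => by simp, fun ρ => ?_⟩
      have hn : n = 0 := h0
      subst hn
      exact (ρ 0).elim0
    · have hn : 0 < n := Nat.pos_of_ne_zero h0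
      refine Ens.seq (Ens.const ?_)
      refine Ens.seq ((h1 n _ _ _ hn (rep_startState hn P)).mono le_rfl ?_)
      rintro s1 ⟨r1, -⟩
      refine Ens.seq ((h2 n _ _ (fun _ => ⟨0, hn⟩) s1 r1 (by simp)).mono le_rfl ?_)
      rintro s2 ⟨e2, f2⟩
      refine Ens.seq (Ens.copy ?_)
      have r2 := (f2.rep r1).set (r := counter 0) (v := s2.reg 2) (by unfold counter; omega)
      refine Ens.seq ((h3 n _ _ _ r2).mono le_rfl ?_)
      rintro s3 ⟨r3, e3⟩
      refine Ens.copy ⟨fun h => by omega, fun ρ => ⟨?_, fun i j => ?_⟩⟩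
      · rw [State.set_reg_self, e3, State.set_reg_self, e2]
        congr 1
        exact propext (Fml.sat_congr hφ (by simp))
      · exact r3.entry i j
  refine ⟨main.code 0, q, fun n P => ?_⟩
  obtain ⟨t, ht, s, he, hs⟩ := hmain n P
  refine ⟨s.at (0 + main.len), ⟨t, ht, he _ 0 ⟨[], [], by simp, rfl⟩, ?_⟩, hs⟩
  show (main.code 0).length ≤ 0 + main.len
  rw [Cmd.length_code, zero_add]

end RAM

namespace RAM

/-! ### Derived connectives and least fixed points -/

namespace Fml

/-- Disjunction. -/
def or (φ ψ : Fml) : Fml := not (and (not φ) (not ψ))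

/-- Implication. -/
def imp (φ ψ : Fml) : Fml := not (and φ (not ψ))

/-- Equivalence. -/
def iff (φ ψ : Fml) : Fml := and (imp φ ψ) (imp ψ φ)

/-- Universal quantification. -/
def all (φ : Fml) : Fml := not (ex (not φ))

/-- A binary table. -/
def rel (k i j : ℕ) : Fml := tab k i j i j

variable {n : ℕ} {A : Fin n → Fin n → ℕ} {T : ℕ → Table n} {d : ℕ} {φ ψ : Fml} {ρ : ℕ → Fin n}

theorem sat_or : Sat A T d (or φ ψ) ρ ↔ Sat A T d φ ρ ∨ Sat A T d ψ ρ := by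
  simp only [or, Sat]; tauto

theorem sat_imp : Sat A T d (imp φ ψ) ρ ↔ (Sat A T d φ ρ → Sat A T d ψ ρ) := by
  simp only [imp, Sat]; tauto

theorem sat_iff : Sat A T d (iff φ ψ) ρ ↔ (Sat A T d φ ρ ↔ Sat A T d ψ ρ) := by
  simp only [iff, Sat, sat_imp]; tauto

theorem sat_all : Sat A T d (all φ) ρ ↔ ∀ x, Sat A T (d + 1) φ (Function.update ρ d x) := by
  simp only [all, Sat, not_exists, not_not]

end Fml

/-- Compute in table `k` the least fixed point of the formula `φ`, which may mention this table;
table `k + 1` is used in between. -/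
def Prog.lfp (k : ℕ) (φ : Fml) : Prog :=
  .seq (.assign k (.not (.eq 0 0)))
    -- Four nested loops give `n ^ 4` rounds, one for each cell of a table. An assignment must not
    -- mention its own table, so each round goes through table `k + 1`.
    (.loop (.loop (.loop (.loop (.seq (.assign (k + 1) φ) (.assign k (.tab (k + 1) 0 1 2 3)))))))

/-- Until the iteration is stationary, each application raises the measure by at least one. -/
theorem iterate_eq_of_strictMono {β : Type} [PartialOrder β] {f : β → β} (hf : ∀ x, x ≤ f x)
    {μ : β → ℕ} (hμ : StrictMono μ) {N : ℕ} (hN : ∀ x, μ x ≤ N) (x : β) :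
    f (f^[N] x) = f^[N] x := by
  have key : ∀ m, f (f^[m] x) = f^[m] x ∨ m ≤ μ (f^[m] x) := by
    intro m
    induction m with
    | zero => exact Or.inr (Nat.zero_le _)
    | succ m ih =>
      rw [Function.iterate_succ_apply']
      rcases ih with h | h
      · left; rw [h, h]
      · rcases (hf (f^[m] x)).eq_or_lt with h' | h'
        · left; rw [← h', ← h']
        · right
          have := hμ h'
          omega
  rcases key N with h | h
  · exact h
  · by_contra hne
    have h1 := hμ (lt_of_le_of_ne (hf (f^[N] x)) (Ne.symm hne))
    have h2 := hN (f (f^[N] x))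
    omega

open Classical in
theorem table_iterate_eq {n : ℕ} {f : Table n → Table n} (hf : ∀ X, X ≤ f X) (X : Table n) :
    f (f^[n * n * n * n] X) = f^[n * n * n * n] X := by
  refine iterate_eq_of_strictMono hf (μ := fun X => (Finset.univ.filter
    fun t : Fin n × Fin n × Fin n × Fin n => X t.1 t.2.1 t.2.2.1 t.2.2.2).card) ?_ ?_ X
  · intro X Y hXY
    obtain ⟨hle, hnot⟩ := lt_iff_le_not_ge.1 hXY
    refine Finset.card_lt_card ⟨fun t ht => ?_, fun h => hnot fun a b c d hY => ?_⟩
    · rw [Finset.mem_filter] at ht ⊢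
      exact ⟨ht.1, hle _ _ _ _ ht.2⟩
    · have := h (Finset.mem_filter.2 ⟨Finset.mem_univ (a, b, c, d), hY⟩)
      exact (Finset.mem_filter.1 this).2
  · intro X
    refine (Finset.card_le_univ _).trans ?_
    simp [mul_assoc]

variable {n : ℕ} {A : Fin n → Fin n → ℕ} {T : ℕ → Table n}

theorem Prog.eval_assign_self (k : ℕ) (φ : Fml) :
    (Prog.assign k φ).eval A T k = fun a b c d => φ.Sat A T 4 (env a b c d) :=
  Function.update_self ..

theorem Prog.eval_assign_ne {k l : ℕ} (φ : Fml) (h : l ≠ k) :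
    (Prog.assign k φ).eval A T l = T l :=
  Function.update_of_ne h ..

/-- The iterates stay below `S` by `hle`. Since the operator is inflationary they become stationary,
and a stationary table is above `S` by `hmin`. -/
theorem Prog.eval_lfp {k : ℕ} {φ : Fml} (hφ : φ.Avoids (k + 1)) {S : Table n}
    (hinfl : ∀ X, X ≤ fun a b c d => φ.Sat A (setTable T k X) 4 (env a b c d))
    (hle : ∀ X, X ≤ S → (fun a b c d => φ.Sat A (setTable T k X) 4 (env a b c d)) ≤ S)
    (hmin : ∀ X, (fun a b c d => φ.Sat A (setTable T k X) 4 (env a b c d)) ≤ X → S ≤ X) :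
    (Prog.lfp k φ).eval A T k = S ∧ ∀ l, l ≠ k → l ≠ k + 1 → (Prog.lfp k φ).eval A T l = T l := by
  let F : Table n → Table n := fun X a b c d => φ.Sat A (setTable T k X) 4 (env a b c d)
  let body : Prog := .seq (.assign (k + 1) φ) (.assign k (.tab (k + 1) 0 1 2 3))
  have hbody : ∀ U : ℕ → Table n, (∀ l, l ≠ k → l ≠ k + 1 → U l = T l) →
      body.eval A U k = F (U k) ∧ ∀ l, l ≠ k → l ≠ k + 1 → body.eval A U l = T l := by
    intro U hU
    constructor
    · funext a b c d
      simp only [body, Prog.eval, setTable, Function.update_self, Fml.Sat, F, eq_iff_iff]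
      have e : env (env a b c d 0) (env a b c d 1) (env a b c d 2) (env a b c d 3) =
        env a b c d := rfl
      rw [e]
      refine Fml.sat_congr_table (k := k + 1) (fun l hl => ?_) hφ
      by_cases h : l = k
      · subst h; rw [Function.update_self]
      · rw [Function.update_of_ne h, hU l h hl]
    · intro l h1 h2
      simp only [body, Prog.eval, setTable]
      rw [Function.update_of_ne h1, Function.update_of_ne h2, hU l h1 h2]
  let T0 := (Prog.assign k (.not (.eq 0 0))).eval A T
  have hT0 : T0 k = ⊥ := by
    funext a b c d
    simp [T0, Prog.eval, setTable, Fml.Sat]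
  have hiter : ∀ m, ((body.eval A)^[m] T0) k = F^[m] ⊥ ∧
      ∀ l, l ≠ k → l ≠ k + 1 → ((body.eval A)^[m] T0) l = T l := by
    intro m
    induction m with
    | zero => exact ⟨hT0, fun l h1 h2 => Prog.eval_assign_ne _ h1⟩
    | succ m ih =>
      rw [Function.iterate_succ_apply', Function.iterate_succ_apply', ← ih.1]
      exact hbody _ ih.2
  have heval : (Prog.lfp k φ).eval A T = (body.eval A)^[n * n * n * n] T0 := by
    rw [Function.iterate_mul, Function.iterate_mul, Function.iterate_mul]
    rfl
  have hle' : ∀ m, F^[m] ⊥ ≤ S := by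
    intro m
    induction m with
    | zero => exact bot_le
    | succ m ih => rw [Function.iterate_succ_apply']; exact hle _ ih
  rw [heval]
  refine ⟨(hiter _).1.trans (le_antisymm (hle' _) (hmin _ (table_iterate_eq hinfl ⊥).le)),
    (hiter _).2⟩

end RAM

/-! ### The adjacency matrix -/

namespace PartiallyOrientedGraph

variable {V : Type} (P : PartiallyOrientedGraph V) (u v : V)

theorem entry_eq_two : P.entry u v = 2 ↔ P.arc u v := by
  have := P.disjoint u v
  unfold entry
  split_ifs <;> simp_all

theorem entry_eq_zero : P.entry u v = 0 ↔ ¬ P.underlyingGraph.Adj u v := by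
  have : P.underlyingGraph.Adj u v ↔ P.edges.Adj u v ∨ P.arc u v ∨ P.arc v u := Iff.rfl
  rw [this]
  unfold entry
  split_ifs <;> simp_all

end PartiallyOrientedGraph

namespace RAM

/-! ### The program on tables -/

namespace Fml

/-- `i` and `j` are adjacent. -/
def adj (i j : ℕ) : Fml := not (entry i j 0)

/-- `(i, j)` is an arc. -/
def arc (i j : ℕ) : Fml := entry i j 2

/-- `i` and `j` are distinct and not adjacent. -/
def apart (i j : ℕ) : Fml := and (not (eq i j)) (entry i j 0)

/-- `i` and `j` are joined by an arc. -/
def oriented (i j : ℕ) : Fml := or (arc i j) (arc j i)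

variable {n : ℕ} {P : PartiallyOrientedGraph (Fin n)} {T : ℕ → Table n} {d i j : ℕ}
  {ρ : ℕ → Fin n}

theorem sat_adj : Sat P.entry T d (adj i j) ρ ↔ P.underlyingGraph.Adj (ρ i) (ρ j) := by
  simp only [adj, Sat, PartiallyOrientedGraph.entry_eq_zero, not_not]

theorem sat_arc : Sat P.entry T d (arc i j) ρ ↔ P.arc (ρ i) (ρ j) := by
  simp only [arc, Sat, PartiallyOrientedGraph.entry_eq_two]

theorem sat_apart : Sat P.entry T d (apart i j) ρ ↔ P.underlyingGraph.Apart (ρ i) (ρ j) := by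
  simp only [apart, Sat, PartiallyOrientedGraph.entry_eq_zero]; rfl

theorem sat_oriented : Sat P.entry T d (oriented i j) ρ ↔ P.Oriented (ρ i) (ρ j) := by
  simp only [oriented, sat_or, sat_arc]; rfl

theorem sat_rel {A : Fin n → Fin n → ℕ} {k : ℕ} :
    Sat A T d (rel k i j) ρ ↔ T k (ρ i) (ρ j) (ρ i) (ρ j) := Iff.rfl

/-- Defines `Forced`, in table `0`. -/
def forced : Fml := or (tab 0 0 1 2 3) (or (and (eq 0 2) (eq 1 3))
  (ex (or (and (tab 0 0 1 3 4) (and (adj 2 3) (apart 2 4)))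
    (and (tab 0 0 1 4 2) (and (adj 3 2) (apart 3 4))))))

/-- Defines reachability, in table `2`. -/
def reachable : Fml := or (tab 2 0 1 2 3) (or (eq 0 1) (ex (and (tab 2 0 4 2 3) (adj 4 1))))

/-- Defines `CoConnected`, in table `4`. -/
def coConnected : Fml := or (tab 4 0 1 2 3) (or (eq 0 1)
  (ex (and (tab 4 0 4 2 3) (and (rel 2 4 1) (apart 4 1)))))

/-- Defines `Twins`, for table `6`. -/
def twins : Fml := all (imp (not (eq 4 0)) (imp (not (eq 4 1)) (iff (adj 4 0) (adj 4 1))))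

/-- Defines `Linked`, for table `7`. -/
def linked : Fml := or (rel 4 0 1) (oriented 0 1)

/-- Defines `TwinLinked`, for table `8`. -/
def twinLinked : Fml := or (eq 0 1) (and (rel 6 0 1) (oriented 0 1))

/-- Defines `Before` for the relation in table `k`. -/
def before (k : ℕ) : Fml := ex (and (rel k 4 0) (all (imp (rel k 5 1) (lt 4 5))))

/-- Defines `Positive`, for table `11`. -/
def positive : Fml := ex (and (and (rel 7 4 0) (all (imp (rel 7 5 0) (not (lt 5 4)))))
  (or (and (not (rel 4 4 0)) (arc 4 0)) (and (rel 4 4 0)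
    (ex (and (adj 5 0) (and (not (rel 4 5 0)) (tab 0 5 4 5 0)))))))

/-- Defines `Leading`, for table `12`. -/
def leading : Fml := ex (ex (and (adj 4 5) (and (tab 0 4 5 0 1) (all (all (imp (adj 6 7)
  (imp (or (tab 0 6 7 0 1) (tab 0 6 7 1 0))
    (or (lt 4 6) (and (eq 4 6) (not (lt 7 5)))))))))))

/-- Defines `canonicalArc`, for table `13`. -/
def canonical : Fml := and (adj 0 1) (or (arc 0 1) (and (not (arc 1 0))
  (or (and (not (rel 4 0 1)) (iff (rel 9 0 1) (iff (rel 11 0 0) (rel 11 1 1))))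
    (or (and (rel 4 0 1) (and (rel 6 0 1) (rel 10 0 1)))
      (and (rel 4 0 1) (and (not (rel 6 0 1)) (rel 12 0 1)))))))

/-- Table `13` holds the arcs of a completion to a locally transitive local tournament. -/
def correct : Fml := all (all (all (all (and (and (imp (arc 0 1) (rel 13 0 1))
  (and (iff (adj 0 1) (or (rel 13 0 1) (rel 13 1 0))) (imp (rel 13 0 1) (not (rel 13 1 0)))))
  (and (and (imp (rel 13 0 1) (imp (rel 13 0 2) (imp (not (eq 1 2))
      (or (rel 13 1 2) (rel 13 2 1)))))
    (imp (rel 13 1 0) (imp (rel 13 2 0) (imp (not (eq 1 2)) (or (rel 13 1 2) (rel 13 2 1))))))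
  (and (imp (rel 13 0 1) (imp (rel 13 0 2) (imp (rel 13 0 3) (imp (rel 13 1 2) (imp (rel 13 2 3)
      (rel 13 1 3))))))
    (imp (rel 13 1 0) (imp (rel 13 2 0) (imp (rel 13 3 0) (imp (rel 13 1 2) (imp (rel 13 2 3)
      (rel 13 1 3))))))))))))

end Fml

/-- Computes `canonicalArc` in table `13`. -/
def canonicalProg : Prog := .seq (.lfp 0 .forced) (.seq (.lfp 2 .reachable)
  (.seq (.lfp 4 .coConnected) (.seq (.assign 6 .twins) (.seq (.assign 7 .linked)
  (.seq (.assign 8 .twinLinked) (.seq (.assign 9 (.before 7)) (.seq (.assign 10 (.before 8))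
  (.seq (.assign 11 .positive) (.seq (.assign 12 .leading) (.assign 13 .canonical))))))))))

theorem canonicalProg_wellFormed : canonicalProg.WellFormed := by
  simp [canonicalProg, Prog.lfp, Prog.WellFormed, Fml.Closed, Fml.Avoids, Fml.forced,
    Fml.reachable, Fml.coConnected, Fml.twins, Fml.linked, Fml.twinLinked, Fml.before,
    Fml.positive, Fml.leading, Fml.canonical, Fml.or, Fml.imp, Fml.iff, Fml.all, Fml.rel, Fml.adj,
    Fml.arc, Fml.apart, Fml.oriented]

theorem correct_closed : Fml.correct.Closed 0 := by
  simp [Fml.correct, Fml.Closed, Fml.or, Fml.imp, Fml.iff, Fml.all, Fml.rel, Fml.adj, Fml.arc]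

/-! ### Correctness of the program on tables -/

section

variable {n : ℕ} {P : PartiallyOrientedGraph (Fin n)} {T : ℕ → Table n}

theorem env_zero (a b c d : Fin n) : env a b c d 0 = a := rfl
theorem env_one (a b c d : Fin n) : env a b c d 1 = b := rfl
theorem env_two (a b c d : Fin n) : env a b c d 2 = c := rfl
theorem env_three (a b c d : Fin n) : env a b c d 3 = d := rfl

/-- The disjunct repeating the table makes the operator inflationary; the others are the two ways in
which a reflexive transitive closure grows. -/
theorem eval_lfp_forced :
    (Prog.lfp 0 .forced).eval P.entry T 0 =
        (fun a b c d => P.underlyingGraph.Forced (a, b) (c, d)) ∧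
      ∀ l, l ≠ 0 → l ≠ 1 → (Prog.lfp 0 .forced).eval P.entry T l = T l := by
  have hsat : ∀ (X : Table n) a b c d,
      Fml.forced.Sat P.entry (setTable T 0 X) 4 (env a b c d) ↔
      X a b c d ∨ (a = c ∧ b = d) ∨ ∃ e,
        (X a b d e ∧ P.underlyingGraph.Adj c d ∧ P.underlyingGraph.Apart c e) ∨
        (X a b e c ∧ P.underlyingGraph.Adj d c ∧ P.underlyingGraph.Apart d e) := by
    intro X a b c d
    simp [Fml.forced, Fml.sat_or, Fml.sat_adj, Fml.sat_apart, Fml.Sat, setTable,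
      env_zero, env_one, env_two, env_three]
  refine Prog.eval_lfp ?_ ?_ ?_ ?_
  · simp [Fml.forced, Fml.Avoids, Fml.or, Fml.adj, Fml.apart]
  · intro X a b c d h
    exact (hsat X a b c d).2 (Or.inl h)
  · intro X hX a b c d h
    rcases (hsat X a b c d).1 h with h | ⟨rfl, rfl⟩ | ⟨e, ⟨h1, h2, h3⟩ | ⟨h1, h2, h3⟩⟩
    · exact hX _ _ _ _ h
    · exact SimpleGraph.Forced.refl _
    · exact Relation.ReflTransGen.tail (hX _ _ _ _ h1) (Or.inl ⟨rfl, h2, h3⟩)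
    · exact Relation.ReflTransGen.tail (hX _ _ _ _ h1) (Or.inr ⟨rfl, h2, h3⟩)
  · intro X hX a b c d h
    have main : ∀ t : Fin n × Fin n, P.underlyingGraph.Forced (a, b) t → X a b t.1 t.2 := by
      intro t ht
      induction ht with
      | refl => exact hX _ _ _ _ ((hsat X a b a b).2 (Or.inr (Or.inl ⟨rfl, rfl⟩)))
      | @tail u v _ huv ih =>
        refine hX _ _ _ _ ((hsat X a b v.1 v.2).2 (Or.inr (Or.inr ?_)))
        obtain ⟨u1, u2⟩ := u
        obtain ⟨v1, v2⟩ := v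
        rcases huv with ⟨h1, h2, h3⟩ | ⟨h1, h2, h3⟩ <;> simp only at h1 h2 h3 ih ⊢ <;> subst h1
        · exact ⟨u2, Or.inl ⟨ih, h2, h3⟩⟩
        · exact ⟨u1, Or.inr ⟨ih, h2, h3⟩⟩
    exact main (c, d) h

/-- The last two coordinates of the table are idle parameters. -/
theorem eval_lfp_reachable :
    (Prog.lfp 2 .reachable).eval P.entry T 2 =
        (fun a b _ _ => P.underlyingGraph.Reachable a b) ∧
      ∀ l, l ≠ 2 → l ≠ 3 → (Prog.lfp 2 .reachable).eval P.entry T l = T l := by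
  have hsat : ∀ (X : Table n) a b c d,
      Fml.reachable.Sat P.entry (setTable T 2 X) 4 (env a b c d) ↔
      X a b c d ∨ a = b ∨ ∃ e, X a e c d ∧ P.underlyingGraph.Adj e b := by
    intro X a b c d
    simp [Fml.reachable, Fml.sat_or, Fml.sat_adj, Fml.Sat, setTable,
      env_zero, env_one, env_two, env_three]
  refine Prog.eval_lfp ?_ ?_ ?_ ?_
  · simp [Fml.reachable, Fml.Avoids, Fml.or, Fml.adj]
  · intro X a b c d h
    exact (hsat X a b c d).2 (Or.inl h)
  · intro X hX a b c d h
    rcases (hsat X a b c d).1 h with h | rfl | ⟨e, h1, h2⟩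
    · exact hX _ _ _ _ h
    · exact SimpleGraph.Reachable.refl _
    · exact SimpleGraph.Reachable.trans (hX _ _ _ _ h1) h2.reachable
  · intro X hX a b c d h
    replace h : P.underlyingGraph.Reachable a b := h
    rw [SimpleGraph.reachable_iff_reflTransGen] at h
    induction h with
    | refl => exact hX _ _ _ _ ((hsat X a a c d).2 (Or.inr (Or.inl rfl)))
    | tail _ huv ih => exact hX _ _ _ _ ((hsat X a _ c d).2 (Or.inr (Or.inr ⟨_, ih, huv⟩)))

theorem eval_lfp_coConnected
    (h2 : T 2 = fun a b _ _ => P.underlyingGraph.Reachable a b) :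
    (Prog.lfp 4 .coConnected).eval P.entry T 4 =
        (fun a b _ _ => P.underlyingGraph.CoConnected a b) ∧
      ∀ l, l ≠ 4 → l ≠ 5 → (Prog.lfp 4 .coConnected).eval P.entry T l = T l := by
  have hsat : ∀ (X : Table n) a b c d,
      Fml.coConnected.Sat P.entry (setTable T 4 X) 4 (env a b c d) ↔
      X a b c d ∨ a = b ∨ ∃ e, X a e c d ∧ P.underlyingGraph.Reachable e b ∧
        P.underlyingGraph.Apart e b := by
    intro X a b c d
    simp [Fml.coConnected, Fml.sat_or, Fml.sat_rel, Fml.sat_apart, Fml.Sat, setTable,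
      env_zero, env_one, env_two, env_three, h2]
  refine Prog.eval_lfp ?_ ?_ ?_ ?_
  · simp [Fml.coConnected, Fml.Avoids, Fml.or, Fml.apart, Fml.rel]
  · intro X a b c d h
    exact (hsat X a b c d).2 (Or.inl h)
  · intro X hX a b c d h
    rcases (hsat X a b c d).1 h with h | rfl | ⟨e, h1, h2⟩
    · exact hX _ _ _ _ h
    · exact SimpleGraph.CoConnected.refl _
    · exact Relation.ReflTransGen.tail (hX _ _ _ _ h1) h2
  · intro X hX a b c d h
    replace h : P.underlyingGraph.CoConnected a b := h
    induction h with
    | refl => exact hX _ _ _ _ ((hsat X a a c d).2 (Or.inr (Or.inl rfl)))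
    | tail _ huv ih => exact hX _ _ _ _ ((hsat X a _ c d).2 (Or.inr (Or.inr ⟨_, ih, huv⟩)))

variable {a b c d : Fin n}

theorem sat_twins :
    Fml.twins.Sat P.entry T 4 (env a b c d) ↔ P.underlyingGraph.Twins a b := by
  simp [Fml.twins, Fml.sat_all, Fml.sat_imp, Fml.sat_iff, Fml.sat_adj, Fml.Sat, env_zero, env_one,
    SimpleGraph.Twins]

theorem sat_linked (h4 : T 4 = fun a b _ _ => P.underlyingGraph.CoConnected a b) :
    Fml.linked.Sat P.entry T 4 (env a b c d) ↔ P.Linked a b := by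
  simp only [Fml.linked, Fml.sat_or, Fml.sat_rel, Fml.sat_oriented, h4]
  rfl

theorem sat_twinLinked (h6 : T 6 = fun a b _ _ => P.underlyingGraph.Twins a b) :
    Fml.twinLinked.Sat P.entry T 4 (env a b c d) ↔ P.TwinLinked a b := by
  simp only [Fml.twinLinked, Fml.sat_or, Fml.Sat, Fml.sat_rel, Fml.sat_oriented, h6]
  rfl

theorem sat_before {k : ℕ} {S : Fin n → Fin n → Prop} (hk : T k = fun a b _ _ => S a b) :
    (Fml.before k).Sat P.entry T 4 (env a b c d) ↔ Before S a b := by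
  simp [Fml.before, Fml.sat_all, Fml.sat_imp, Fml.sat_rel, Fml.Sat, hk, env_zero, env_one,
    Before]

theorem sat_positive
    (h0 : T 0 = fun a b c d => P.underlyingGraph.Forced (a, b) (c, d))
    (h4 : T 4 = fun a b _ _ => P.underlyingGraph.CoConnected a b)
    (h7 : T 7 = fun a b _ _ => P.Linked a b) :
    Fml.positive.Sat P.entry T 4 (env a b c d) ↔ P.Positive a := by
  simp [Fml.positive, Fml.sat_all, Fml.sat_imp, Fml.sat_or, Fml.sat_rel, Fml.sat_adj, Fml.sat_arc,
    Fml.Sat, h0, h4, h7, env_zero, PartiallyOrientedGraph.Positive]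

theorem sat_leading
    (h0 : T 0 = fun a b c d => P.underlyingGraph.Forced (a, b) (c, d)) :
    Fml.leading.Sat P.entry T 4 (env a b c d) ↔ P.Leading a b := by
  simp [Fml.leading, Fml.sat_all, Fml.sat_imp, Fml.sat_or, Fml.sat_adj,
    Fml.Sat, h0, env_zero, env_one, PartiallyOrientedGraph.Leading, SimpleGraph.SameClass,
    Prod.Lex.toLex_le_toLex]

theorem sat_canonical
    (h4 : T 4 = fun a b _ _ => P.underlyingGraph.CoConnected a b)
    (h6 : T 6 = fun a b _ _ => P.underlyingGraph.Twins a b)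
    (h9 : T 9 = fun a b _ _ => Before P.Linked a b)
    (h10 : T 10 = fun a b _ _ => Before P.TwinLinked a b)
    (h11 : T 11 = fun a _ _ _ => P.Positive a)
    (h12 : T 12 = fun a b _ _ => P.Leading a b) :
    Fml.canonical.Sat P.entry T 4 (env a b c d) ↔ P.canonicalArc a b := by
  simp only [Fml.canonical, Fml.sat_iff, Fml.sat_or, Fml.sat_rel, Fml.sat_adj, Fml.sat_arc,
    Fml.Sat, h4, h6, h9, h10, h11, h12]
  rfl

theorem eval_assign {k : ℕ} {φ : Fml} {S : Table n}
    (h : ∀ a b c d, φ.Sat P.entry T 4 (env a b c d) ↔ S a b c d) :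
    (Prog.assign k φ).eval P.entry T k = S ∧
      ∀ l, l ≠ k → (Prog.assign k φ).eval P.entry T l = T l := by
  refine ⟨?_, fun l hl => Prog.eval_assign_ne φ hl⟩
  rw [Prog.eval_assign_self]
  funext a b c d
  exact propext (h a b c d)

theorem eval_canonicalProg :
    canonicalProg.eval P.entry T 13 = fun a b _ _ => P.canonicalArc a b := by
  have eval_seq : ∀ (p q : Prog) (T : ℕ → Table n),
      (Prog.seq p q).eval P.entry T = q.eval P.entry (p.eval P.entry T) := fun _ _ _ => rfl
  simp only [canonicalProg, eval_seq]
  -- After each stage the facts still needed are transferred to the new tables, and the way these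
  -- were obtained is forgotten.
  obtain ⟨a0, -⟩ := eval_lfp_forced (P := P) (T := T)
  generalize (Prog.lfp 0 .forced).eval P.entry T = T at *
  obtain ⟨a2, b2⟩ := eval_lfp_reachable (P := P) (T := T)
  rw [← b2 0 (by decide) (by decide)] at a0
  clear b2
  generalize (Prog.lfp 2 .reachable).eval P.entry T = T at *
  obtain ⟨a4, b4⟩ := eval_lfp_coConnected (P := P) a2
  rw [← b4 0 (by decide) (by decide)] at a0
  clear b4 a2
  generalize (Prog.lfp 4 .coConnected).eval P.entry T = T at *
  obtain ⟨a6, b6⟩ := eval_assign (k := 6) (fun a b c d => sat_twins (P := P) (T := T))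
  rw [← b6 _ (by decide)] at a0 a4
  clear b6
  generalize (Prog.assign 6 .twins).eval P.entry T = T at *
  obtain ⟨a7, b7⟩ := eval_assign (k := 7) (fun a b c d => sat_linked (P := P) a4)
  rw [← b7 _ (by decide)] at a0 a4 a6
  clear b7
  generalize (Prog.assign 7 .linked).eval P.entry T = T at *
  obtain ⟨a8, b8⟩ := eval_assign (k := 8) (fun a b c d => sat_twinLinked (P := P) a6)
  rw [← b8 _ (by decide)] at a0 a4 a6 a7
  clear b8
  generalize (Prog.assign 8 .twinLinked).eval P.entry T = T at *
  obtain ⟨a9, b9⟩ := eval_assign (k := 9) (fun a b c d => sat_before (P := P) a7)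
  rw [← b9 _ (by decide)] at a0 a4 a6 a7 a8
  clear b9
  generalize (Prog.assign 9 (.before 7)).eval P.entry T = T at *
  obtain ⟨a10, b10⟩ := eval_assign (k := 10) (fun a b c d => sat_before (P := P) a8)
  rw [← b10 _ (by decide)] at a0 a4 a6 a7 a9
  clear b10 a8
  generalize (Prog.assign 10 (.before 8)).eval P.entry T = T at *
  obtain ⟨a11, b11⟩ := eval_assign (k := 11) (fun a b c d => sat_positive a0 a4 a7)
  rw [← b11 _ (by decide)] at a0 a4 a6 a9 a10
  clear b11 a7
  generalize (Prog.assign 11 .positive).eval P.entry T = T at *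
  obtain ⟨a12, b12⟩ := eval_assign (k := 12) (fun a b c d => sat_leading a0)
  rw [← b12 _ (by decide)] at a4 a6 a9 a10 a11
  clear b12 a0
  generalize (Prog.assign 12 .leading).eval P.entry T = T at *
  exact (eval_assign (k := 13) fun a b c d => sat_canonical a4 a6 a9 a10 a11 a12).1

theorem sat_correct {X : Fin n → Fin n → Prop} (h : T 13 = fun a b _ _ => X a b)
    (ρ : ℕ → Fin n) : Fml.correct.Sat P.entry T 0 ρ ↔ ∀ a b c d,
      ((P.arc a b → X a b) ∧ (P.underlyingGraph.Adj a b ↔ X a b ∨ X b a) ∧ (X a b → ¬ X b a)) ∧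
      ((X a b → X a c → b ≠ c → X b c ∨ X c b) ∧ (X b a → X c a → b ≠ c → X b c ∨ X c b)) ∧
      ((X a b → X a c → X a d → X b c → X c d → X b d) ∧
        (X b a → X c a → X d a → X b c → X c d → X b d)) := by
  simp [Fml.correct, Fml.sat_all, Fml.sat_imp, Fml.sat_iff, Fml.sat_or, Fml.sat_rel, Fml.sat_adj,
    Fml.sat_arc, Fml.Sat, h]

/-- The formula holds if and only if the arcs in table `13` form a completion of the right kind. -/
theorem sat_correct_iff {X : Fin n → Fin n → Prop} (h : T 13 = fun a b _ _ => X a b)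
    (ρ : ℕ → Fin n) : Fml.correct.Sat P.entry T 0 ρ ↔ ∃ D : OrientedGraph (Fin n), D.arc = X ∧
      P.IsCompletion D ∧ D.IsLocalTournament ∧ D.IsLocallyTransitive := by
  rw [sat_correct h]
  constructor
  · intro h
    have ht : ∀ v, (∀ x, X v x → ∀ y, X v y → x ≠ y → X x y ∨ X y x) ∧
        ∀ x, X x v → ∀ y, X y v → x ≠ y → X x y ∨ X y x := fun v =>
      ⟨fun x hx y hy => (h v x y y).2.1.1 hx hy, fun x hx y hy => (h v x y y).2.1.2 hx hy⟩
    exact ⟨⟨X, fun u v => (h u v v v).1.2.2⟩, rfl,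
      ⟨fun u v => (h u v v v).1.1, fun u v => (h u v v v).1.2.1⟩, ht, fun v =>
      ⟨⟨(ht v).1, fun x hx y hy z hz => (h v x y z).2.2.1 hx hy hz⟩,
        ⟨(ht v).2, fun x hx y hy z hz => (h v x y z).2.2.2 hx hy hz⟩⟩⟩
  · rintro ⟨D, rfl, h1, h2, h3⟩ a b c d
    exact ⟨⟨h1.1 a b, h1.2 a b, D.asymm a b⟩, ⟨fun hb hc => (h2 a).1 b hb c hc,
      fun hb hc => (h2 a).2 b hb c hc⟩, fun hb hc hd => (h3 a).1.2 b hb c hc d hd,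
      fun hb hc hd => (h3 a).2.2 b hb c hc d hd⟩

theorem arcEntry_eq (D : OrientedGraph (Fin n)) {X : Table n} (h : X = fun a b _ _ => D.arc a b)
    (i j : Fin n) : arcEntry X i j = D.toPartiallyOrientedGraph.entry i j := by
  subst h
  by_cases h₁ : D.arc i j <;> by_cases h₂ : D.arc j i <;>
    simp [arcEntry, PartiallyOrientedGraph.entry, OrientedGraph.toPartiallyOrientedGraph, h₁, h₂]

end

end RAM

/-- One random access machine decides, for every friendly partially oriented graph `P` with `n`
vertices, whether `P` can be completed to a locally transitive local tournament (answer `1` or `0`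
in register `0`) and, if so, leaves the adjacency matrix of such a completion in its memory; the
number of its steps is bounded by a polynomial in `n`. -/
theorem corollary4p13 :
    ∃ (prog : RAM.Program) (p : Polynomial ℕ),
      ∀ (n : ℕ) (P : PartiallyOrientedGraph (Fin n)), P.IsFriendly →
        ∃ c : RAM.Config, RAM.HaltsWithin prog (RAM.start P) (p.eval n) c ∧
          ((c.reg 0 = 1 ∧
              ∃ D : OrientedGraph (Fin n), P.IsCompletion D ∧
                D.IsLocalTournament ∧ D.IsLocallyTransitive ∧
                c.Stores D.toPartiallyOrientedGraph) ∨
            (c.reg 0 = 0 ∧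
              ¬ ∃ D : OrientedGraph (Fin n), P.IsCompletion D ∧
                D.IsLocalTournament ∧ D.IsLocallyTransitive)) := by
  obtain ⟨prog, q, h⟩ := RAM.exists_machine RAM.canonicalProg RAM.canonicalProg_wellFormed
    RAM.Fml.correct RAM.correct_closed 13
  refine ⟨prog, q, fun n P hP => ?_⟩
  obtain ⟨c, hc, h0, hρ⟩ := h n P
  refine ⟨c, hc, ?_⟩
  rcases Nat.eq_zero_or_pos n with rfl | hn
  · exact Or.inl ⟨h0 rfl, ⟨P.arc, P.asymm⟩, ⟨fun _ _ h => h, fun u => u.elim0⟩,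
      fun v => v.elim0, fun v => v.elim0, fun i => i.elim0⟩
  obtain ⟨h1, h2⟩ := hρ fun _ => ⟨0, hn⟩
  rw [RAM.eval_canonicalProg] at h2
  have hsat := RAM.sat_correct_iff (P := P) (RAM.eval_canonicalProg (P := P)
    (T := fun _ _ _ _ _ => False)) fun _ => ⟨0, hn⟩
  -- The machine checks the canonical orientation itself, so a positive answer is right in any case.
  -- Friendliness enters for the negative one: if the canonical orientation fails, there is no
  -- completion at all.
  by_cases hD : ∃ D : OrientedGraph (Fin n), D.arc = P.canonicalArc ∧ P.IsCompletion D ∧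
      D.IsLocalTournament ∧ D.IsLocallyTransitive
  · left
    rw [RAM.truth_of (hsat.2 hD)] at h1
    obtain ⟨D, hDarc, hD1, hD2, hD3⟩ := hD
    refine ⟨h1, D, hD1, hD2, hD3, fun i j => ?_⟩
    rw [h2, RAM.arcEntry_eq D (by rw [hDarc])]
  · right
    rw [RAM.truth_of_not (fun h => hD (hsat.1 h))] at h1
    refine ⟨h1, ?_⟩
    rintro ⟨D, hD1, hD2, hD3⟩
    exact hD (hP.canonical_completion hD1 hD2 hD3)
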